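/- For a closed curve $\gamma$ in $\mathbb R^3$ of length $2\pi$, parametrized by arclength $s$ (and extended $2\pi$-periodically), with unit tangent $\mathbf U=\gamma'$ in the Sobolev space $H^1$ of $2\pi$-periodic functions and curvature $\kappa=|\mathbf U'|$, let $$e_0(\gamma)=\inf_{\Phi\in H^1,\ \Phi\neq 0}\frac{\int_0^{2\pi}\bigl((\Phi')^2+\kappa^2\Phi^2\bigr)\,ds}{\int_0^{2\pi}\Phi^2\,ds}$$ be the lowest eigenvalue of $-\frac{d^2}{ds^2}+\kappa^2$ on $2\pi$-periodic functions. Let $\mathcal F$ be the family of all curves of length $2\pi$ that arise, by a rotation and a translation of $\mathbb R^3$ (and a change of the initial point of the arclength parametrization), from a planar loop whose unit tangent at arclength $s$ is the positive multiple of $(\cos s,\beta\sin s,0)$, for some constant $0<\beta\le 1$. **Theorem.** Let $\gamma_0\in\mathcal F$ with tangent $\mathbf U_0=\gamma_0'$. For all $\mu$ sufficiently close to $0$ let $\gamma_\mu$ be a closed curve of length $2\pi$, parametrized by arclength, whose tangent $\mathbf U(\mu,\cdot)$ lies in $H^1$, and suppose that there are $\mathbf u_1,\mathbf u_2\in H^1$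 with $$\bigl\|\mathbf U(\mu,\cdot)-\mathbf U_0-\mu\,\mathbf u_1-\mu^2\mathbf u_2\bigr\|_{H^1}=o(\mu^2)\qquad(\mu\to0).$$ Then $e_0(\gamma_0)=1$, and there is a number $c>0$ such that for every $\mu$ with $|\mu|<c$ one has $$e_0(\gamma_\mu)\ge e_0(\gamma_0),$$ with strict inequality unless $\gamma_\mu$ belongs to $\mathcal F$. -/

import Mathlib

open Real Set Filter Topology MeasureTheory
open scoped Asymptotics

noncomputable section

namespace CurvatureLoop

/-- Euclidean three-space. -/
abbrev E3 : Type := EuclideanSpace ℝ (Fin 3)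

/-- `IsH1 f`: the function `f` is (the continuous representative of) an element of the Sobolev
space `H¹` of `2π`-periodic functions: `f` is `2π`-periodic and absolutely continuous, i.e. it is
the integral of its a.e. derivative, and this derivative is square integrable over a period.
The value that `deriv f` takes on the null set where `f` is not differentiable is irrelevant. -/
structure IsH1 {V : Type*} [NormedAddCommGroup V] [NormedSpace ℝ V] (f : ℝ → V) : Prop where
  periodic : Function.Periodic f (2 * π)
  deriv_memLp : MemLp (deriv f) 2 (volume.restrict (Ioc 0 (2 * π)))
  integral_deriv : ∀ a b : ℝ, ∫ t in a..b, deriv f t = f b - f a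

/-- The `H¹` norm over one period (meaningful for functions with `IsH1`). -/
def h1Norm {V : Type*} [NormedAddCommGroup V] [NormedSpace ℝ V] (f : ℝ → V) : ℝ :=
  √(∫ s in (0 : ℝ)..(2 * π), (‖f s‖ ^ 2 + ‖deriv f s‖ ^ 2))

/-- A closed curve of length `2π` in space, parametrized by arc length (and extended
`2π`-periodically to the real line). -/
structure IsLoop (γ : ℝ → E3) : Prop where
  differentiable : Differentiable ℝ γ
  periodic : Function.Periodic γ (2 * π)
  unit_speed : ∀ s, ‖deriv γ s‖ = 1

/-- The tangent vector of a curve parametrized by arc length. -/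
def tangent (γ : ℝ → E3) : ℝ → E3 := deriv γ

/-- The curvature of a curve parametrized by arc length. -/
def curvature (γ : ℝ → E3) (s : ℝ) : ℝ := ‖deriv (tangent γ) s‖

/-- The Rayleigh quotient of `-d²/ds² + κ²` on `2π`-periodic functions. -/
def rayleigh (γ : ℝ → E3) (Φ : ℝ → ℝ) : ℝ :=
  (∫ s in (0 : ℝ)..(2 * π), (deriv Φ s ^ 2 + curvature γ s ^ 2 * Φ s ^ 2)) /
    ∫ s in (0 : ℝ)..(2 * π), Φ s ^ 2

/-- The lowest eigenvalue of `-d²/ds² + κ²`: the infimum of the Rayleigh quotient over the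
nonzero functions in `H¹`. The set is non-empty and bounded below by `0`. -/
def e0 (γ : ℝ → E3) : ℝ :=
  sInf {r : ℝ | ∃ Φ : ℝ → ℝ, IsH1 Φ ∧ Φ ≠ 0 ∧ r = rayleigh γ Φ}

/-- The vector `(cos s, β sin s, 0)`. -/
def ellipse (β s : ℝ) : E3 := !₂[cos s, β * sin s, 0]

/-- The planar loop, parametrized by arc length, whose unit tangent vector is the positive
multiple of `(cos s, β sin s, 0)`. -/
def planarLoop (β s : ℝ) : E3 :=
  ∫ t in (0 : ℝ)..s, ‖ellipse β t‖⁻¹ • ellipse β t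

/-- The curves of length `2π` in the family `ℱ`: the images of the planar loops with tangent
proportional to `(cos s, β sin s, 0)`, `0 < β ≤ 1`, under a rotation `R` and a translation by `a`.
As the arc-length parametrization of a closed curve has no preferred initial point, this point is
left free (the shift `θ`). The dilation factor is `1`, because the length is `2π`. -/
def InFamily (γ : ℝ → E3) : Prop :=
  ∃ β : ℝ, 0 < β ∧ β ≤ 1 ∧
    ∃ R : E3 ≃ₗᵢ[ℝ] E3, LinearMap.det (R.toLinearEquiv : E3 →ₗ[ℝ] E3) = 1 ∧
      ∃ (a : E3) (θ : ℝ), ∀ s : ℝ, γ s = a + R (planarLoop β (s + θ))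

end CurvatureLoop

end

/-!
Write `U` for the tangent of a closed curve, a unit vector field with `∫ U = 0`. As `U' ⊥ U`, the
function `X = Φ U` satisfies `|X'|² = Φ'² + κ² Φ²` and `|X|² = Φ²`. Hence `e0 ≥ 1` means that
`∫ |X'|² - |X|² ≥ 0` for all multiples `X = Φ U`, that is, for the vector fields `X` that are
proportional to a fixed `U` of mean zero. The first Fourier modes `p = cos s A + sin s B` make the
form vanish, and `p / |p|` has mean zero because `p (s + π) = -p s`; these are the tangents of the
family. The theorem is therefore a local statement near the manifold of fields `p / |p|`.

The expansion in `μ` is used only through its consequence that `U_μ → U₀` in `H¹`: the proof gives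
an `H¹` neighbourhood of `U₀` in which `e0 ≥ 1`, with equality for members of the family only
(`local_minimality_of_family`).

*Reduction to the circle.* Let `σ(θ)` be the arclength at which `(cos σ, β sin σ)` points in the
direction `(cos θ, sin θ)`. Its derivative is the Poisson kernel `P` with parameter
`q = (1 - β) / (1 + β)`, and the projective substitution `X(σ(θ)) = Z(θ) / η(θ)` preserves
`∫ |X'|² - |X|²` up to the factor `β` (`energy_unfold`). The reference tangent becomes the unit
circle, and the constraint becomes `∫ P V = 0` for `V = U ∘ σ`.

*Spectral gap.* The form `∫ |z'|² - |z|²` has the Fourier multiplier `n² - 1`, whose only negative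
value is at `n = 0`. The linearized constraint `∫ P (z - ⟨e, z⟩ e) = 0`, with `e` the unit circle,
bounds the zeroth coefficient by the even ones with `|n| ≥ 2`, with weights decaying like `q^k`,
and the Cauchy-Schwarz inequality with `∑ 1 / (4 k² - 1) = 1 / 2` shows that the form
controls the distance of `z` to its modes `±1` (`coercive_of_hasSum`, `gap`).

*Nonlinear constraint.* Let `p` be the part of `z` in the modes `±1`. Both `z / |z|` and `p / |p|`
have weighted mean zero, so `z` fulfils the linearized constraint up to a small multiple of
`∫ |z - p|`, which the gap absorbs (`local_gap`). This is applied to `z = f V`, where `f` has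
maximum `1`: if the energy of `f` is small, then `f` is close to `1` (`integral_sq_deriv_le`),
so that `z` is close to the circle (`local_estimate`).

*Equality.* If the infimum is `1`, then `V` is approximated in `L²` by normalized ellipses from a
compact set, hence is one of them (`exists_eq_normalized_spaceEllipse`). The principal axes of that
ellipse give the rotation and the shift that put the curve in the family (`inFamily_of_tangent`).
-/

open Real Set Filter Topology MeasureTheory
open scoped Asymptotics

namespace CurvatureLoop

/-! ### Periodic Sobolev functions -/

section Toolbox

theorem locallyIntegrable_of_intervalIntegrable {E : Type*} [NormedAddCommGroup E] {g : ℝ → E}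
    (hg : ∀ a b, IntervalIntegrable g volume a b) : LocallyIntegrable g volume := by
  intro x
  refine ⟨Ioc (x - 1) (x + 1), Ioc_mem_nhds (by linarith) (by linarith), ?_⟩
  exact (intervalIntegrable_iff_integrableOn_Ioc_of_le (by linarith)).1 (hg (x - 1) (x + 1))

variable {V W : Type*} [NormedAddCommGroup V] [NormedSpace ℝ V]
  [NormedAddCommGroup W] [NormedSpace ℝ W]

/-- A `2π`-periodic `H¹` function together with an explicit square integrable representative `f'`
of its weak derivative. -/
structure H1Pair (f f' : ℝ → V) : Prop where
  periodic : Function.Periodic f (2 * π)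
  periodic' : Function.Periodic f' (2 * π)
  memLp : MemLp f' 2 (volume.restrict (Ioc 0 (2 * π)))
  integral : ∀ a b : ℝ, ∫ t in a..b, f' t = f b - f a

theorem IsH1.h1Pair {f : ℝ → V} (h : IsH1 f) : H1Pair f (deriv f) where
  periodic := h.periodic
  periodic' := fun x => by
    have : (fun y => f (y + 2 * π)) = f := funext h.periodic
    rw [← deriv_comp_add_const, this]
  memLp := h.deriv_memLp
  integral := h.integral_deriv

namespace H1Pair

variable {f f' g g' : ℝ → V}

theorem intervalIntegrable (h : H1Pair f f') (a b : ℝ) : IntervalIntegrable f' volume a b := by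
  have h0 : IntervalIntegrable f' volume 0 (2 * π) := by
    rw [intervalIntegrable_iff_integrableOn_Ioc_of_le two_pi_pos.le]
    exact h.memLp.integrable (by norm_num)
  exact h.periodic'.intervalIntegrable₀ two_pi_pos.ne' h0 a b

theorem locallyIntegrable (h : H1Pair f f') : LocallyIntegrable f' volume :=
  locallyIntegrable_of_intervalIntegrable h.intervalIntegrable

theorem aestronglyMeasurable (h : H1Pair f f') : AEStronglyMeasurable f' volume :=
  h.locallyIntegrable.aestronglyMeasurable

theorem eq_add_integral (h : H1Pair f f') (a : ℝ) : f = fun x => f a + ∫ t in a..x, f' t := by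
  funext x; rw [h.integral]; abel

theorem continuous (h : H1Pair f f') : Continuous f := by
  rw [h.eq_add_integral 0]
  exact continuous_const.add
    (intervalIntegral.continuous_primitive (fun a b => h.intervalIntegrable a b) 0)

theorem ae_hasDerivAt [CompleteSpace V] (h : H1Pair f f') : ∀ᵐ x, HasDerivAt f (f' x) x := by
  filter_upwards [LocallyIntegrable.ae_hasDerivAt_integral h.locallyIntegrable] with x hx
  rw [h.eq_add_integral 0]
  exact (hx 0).const_add _

theorem sq_intervalIntegrable (h : H1Pair f f') (a b : ℝ) :
    IntervalIntegrable (fun x => ‖f' x‖ ^ 2) volume a b := by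
  have h0 : IntervalIntegrable (fun x => ‖f' x‖ ^ 2) volume 0 (2 * π) := by
    rw [intervalIntegrable_iff_integrableOn_Ioc_of_le two_pi_pos.le]
    exact h.memLp.integrable_norm_pow (by norm_num)
  exact Function.Periodic.intervalIntegrable₀ (fun x => by simp only [h.periodic' x])
    two_pi_pos.ne' h0 a b

theorem memLp_of_sq {E : Type*} [NormedAddCommGroup E] {f' : ℝ → E}
    (hm : AEStronglyMeasurable f' volume)
    (hi : IntervalIntegrable (fun x => ‖f' x‖ ^ 2) volume 0 (2 * π)) :
    MemLp f' 2 (volume.restrict (Ioc 0 (2 * π))) := by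
  rw [memLp_two_iff_integrable_sq_norm hm.restrict]
  exact (intervalIntegrable_iff_integrableOn_Ioc_of_le two_pi_pos.le).1 hi

theorem clm [CompleteSpace V] [CompleteSpace W] (h : H1Pair f f') (L : V →L[ℝ] W) :
    H1Pair (fun x => L (f x)) (fun x => L (f' x)) where
  periodic := fun x => by simp only [h.periodic x]
  periodic' := fun x => by simp only [h.periodic' x]
  memLp := L.comp_memLp' h.memLp
  integral := fun a b => by
    rw [L.intervalIntegral_comp_comm (h.intervalIntegrable a b), h.integral, map_sub]

theorem add (h : H1Pair f f') (k : H1Pair g g') :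
    H1Pair (fun x => f x + g x) (fun x => f' x + g' x) where
  periodic := fun x => by simp only [h.periodic x, k.periodic x]
  periodic' := fun x => by simp only [h.periodic' x, k.periodic' x]
  memLp := h.memLp.add k.memLp
  integral := fun a b => by
    rw [intervalIntegral.integral_add (h.intervalIntegrable a b) (k.intervalIntegrable a b),
      h.integral, k.integral]; abel

theorem sub (h : H1Pair f f') (k : H1Pair g g') :
    H1Pair (fun x => f x - g x) (fun x => f' x - g' x) where
  periodic := fun x => by simp only [h.periodic x, k.periodic x]
  periodic' := fun x => by simp only [h.periodic' x, k.periodic' x]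
  memLp := h.memLp.sub k.memLp
  integral := fun a b => by
    rw [intervalIntegral.integral_sub (h.intervalIntegrable a b) (k.intervalIntegrable a b),
      h.integral, k.integral]; abel

theorem const_smul (h : H1Pair f f') (c : ℝ) :
    H1Pair (fun x => c • f x) (fun x => c • f' x) where
  periodic := fun x => by simp only [h.periodic x]
  periodic' := fun x => by simp only [h.periodic' x]
  memLp := h.memLp.const_smul c
  integral := fun a b => by
    rw [intervalIntegral.integral_smul, h.integral, smul_sub]

theorem shift (h : H1Pair f f') (c : ℝ) :
    H1Pair (fun x => f (x + c)) (fun x => f' (x + c)) where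
  periodic := fun x => by simp only [add_right_comm x (2 * π) c, h.periodic (x + c)]
  periodic' := fun x => by simp only [add_right_comm x (2 * π) c, h.periodic' (x + c)]
  memLp := by
    apply memLp_of_sq
    · exact h.aestronglyMeasurable.comp_measurePreserving (measurePreserving_add_right volume c)
    · have := (h.sq_intervalIntegrable (0 + c) (2 * π + c)).comp_add_right c
      simpa using this
  integral := fun a b => by
    rw [intervalIntegral.integral_comp_add_right, h.integral]

/-- A `C¹` periodic function. -/
theorem of_hasDerivAt [CompleteSpace V] (hp : Function.Periodic f (2 * π))
    (hd : ∀ x, HasDerivAt f (f' x) x)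
    (hc : Continuous f') : H1Pair f f' where
  periodic := hp
  periodic' := fun x => by
    have h1 := (hd (x + 2 * π)).comp_add_const x (2 * π)
    have : (fun y => f (y + 2 * π)) = f := funext hp
    rw [this] at h1
    exact h1.unique (hd x)
  memLp := memLp_of_sq hc.aestronglyMeasurable
    ((hc.norm.pow 2).intervalIntegrable _ _)
  integral := fun a b => intervalIntegral.integral_eq_sub_of_hasDerivAt (fun x _ => hd x)
    (hc.intervalIntegrable _ _)

/-- The vector-valued version of
`IntervalIntegrable.absolutelyContinuousOnInterval_intervalIntegral`, reduced to the scalar one by comparison with the integral of the norm. -/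
theorem absolutelyContinuousOnInterval_integral
    (hi : ∀ a b, IntervalIntegrable f' volume a b) (a b : ℝ) :
    AbsolutelyContinuousOnInterval (fun x => ∫ t in a..x, f' t) a b := by
  have hr := ((hi a b).norm).absolutelyContinuousOnInterval_intervalIntegral
    (c := a) (by simp)
  rw [absolutelyContinuousOnInterval_iff] at hr ⊢
  intro ε hε
  obtain ⟨δ, hδ, H⟩ := hr ε hε
  refine ⟨δ, hδ, fun E hE hl => lt_of_le_of_lt (Finset.sum_le_sum fun i _ => ?_) (H E hE hl)⟩
  have hn : ∀ c d, IntervalIntegrable (fun x => ‖f' x‖) volume c d :=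
    fun c d => (hi c d).norm
  rw [dist_eq_norm, dist_eq_norm, intervalIntegral.integral_interval_sub_left (hn _ _) (hn _ _),
    intervalIntegral.integral_interval_sub_left (hi _ _) (hi _ _)]
  exact intervalIntegral.norm_integral_le_abs_integral_norm

theorem absolutelyContinuousOnInterval (h : H1Pair f f') (a b : ℝ) :
    AbsolutelyContinuousOnInterval f a b := by
  have hr := absolutelyContinuousOnInterval_integral (fun a b => h.intervalIntegrable a b) a b
  rw [h.eq_add_integral a]
  rw [absolutelyContinuousOnInterval_iff] at hr ⊢
  simpa only [dist_add_left] using hr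

theorem integral_of_ae [CompleteSpace V] {a b : ℝ} (hf : AbsolutelyContinuousOnInterval f a b)
    (hd : ∀ᵐ x, HasDerivAt f (f' x) x) (hi : ∀ a b, IntervalIntegrable f' volume a b)
    : ∫ t in a..b, f' t = f b - f a := by
  have hl := locallyIntegrable_of_intervalIntegrable hi
  have hF := absolutelyContinuousOnInterval_integral hi a b
  have hz : ∀ᵐ x, x ∈ uIcc a b → HasDerivAt (fun x => f x - ∫ t in a..x, f' t) 0 x := by
    filter_upwards [hd, LocallyIntegrable.ae_hasDerivAt_integral hl] with x h1 h2 _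
    have h3 := h1.sub (h2 a)
    rw [sub_self] at h3
    exact h3
  obtain ⟨C, hC⟩ := (hf.fun_sub hF).const_of_ae_hasDerivAt_zero hz
  have h1 := hC a (by simp)
  have h2 := hC b (by simp)
  simp only [intervalIntegral.integral_same, sub_zero] at h1 h2
  rw [h1, ← h2]; abel

/-- The product rule in `H¹`. -/
theorem smul {𝕜 : Type*} [NormedField 𝕜] [NormedAlgebra ℝ 𝕜] [CompleteSpace 𝕜] [NormedSpace 𝕜 V]
    [IsScalarTower ℝ 𝕜 V] [CompleteSpace V] {φ φ' : ℝ → 𝕜} (hφ : H1Pair φ φ') (h : H1Pair f f') :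
    H1Pair (fun x => φ x • f x) (fun x => φ' x • f x + φ x • f' x) where
  periodic := fun x => by simp only [h.periodic x, hφ.periodic x]
  periodic' := fun x => by simp only [h.periodic x, hφ.periodic x, h.periodic' x, hφ.periodic' x]
  memLp := by
    obtain ⟨C, hC⟩ := isCompact_Icc.exists_bound_of_continuousOn (s := Icc 0 (2 * π))
      hφ.continuous.continuousOn
    obtain ⟨D, hD⟩ := isCompact_Icc.exists_bound_of_continuousOn (s := Icc 0 (2 * π))
      h.continuous.continuousOn
    refine MemLp.add ?_ ?_
    · refine hφ.memLp.of_le_mul (c := D)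
        (hφ.aestronglyMeasurable.restrict.smul h.continuous.aestronglyMeasurable) ?_
      refine (ae_restrict_iff' measurableSet_Ioc).2 (ae_of_all _ fun x hx => ?_)
      rw [norm_smul, mul_comm]
      exact mul_le_mul_of_nonneg_right (hD x (Ioc_subset_Icc_self hx)) (norm_nonneg _)
    · refine h.memLp.of_le_mul (c := C)
        (hφ.continuous.aestronglyMeasurable.smul h.aestronglyMeasurable.restrict) ?_
      refine (ae_restrict_iff' measurableSet_Ioc).2 (ae_of_all _ fun x hx => ?_)
      rw [norm_smul]
      exact mul_le_mul_of_nonneg_right (hC x (Ioc_subset_Icc_self hx)) (norm_nonneg _)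
  integral := fun a b => by
    refine integral_of_ae ((hφ.absolutelyContinuousOnInterval a b).fun_smul
      (h.absolutelyContinuousOnInterval a b)) ?_ ?_
    · filter_upwards [hφ.ae_hasDerivAt, h.ae_hasDerivAt] with x h1 h2
      rw [add_comm]
      exact h1.smul h2
    · intro a b
      refine IntervalIntegrable.add ?_ ?_
      · exact (hφ.intervalIntegrable a b).smul_continuousOn h.continuous.continuousOn
      · exact (h.intervalIntegrable a b).continuousOn_smul hφ.continuous.continuousOn

theorem integral_period (h : H1Pair f f') : ∫ t in (0 : ℝ)..(2 * π), f' t = 0 := by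
  rw [h.integral, sub_eq_zero]
  simpa using h.periodic 0

end H1Pair

end Toolbox

/-! ### Fourier coefficients -/

/-- The character `θ ↦ exp (i n θ)`. -/
noncomputable def char (n : ℤ) (θ : ℝ) : ℂ := Complex.exp (n * θ * Complex.I)

theorem hasDerivAt_char (n : ℤ) (θ : ℝ) :
    HasDerivAt (char n) (n * Complex.I * char n θ) θ := by
  have h : HasDerivAt (fun x : ℝ => (n * x * Complex.I : ℂ)) (n * Complex.I) θ := by
    simpa using ((Complex.ofRealCLM.hasDerivAt (x := θ)).const_mul (n : ℂ)).mul_const Complex.I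
  have := h.cexp
  rw [mul_comm] at this
  exact this

theorem continuous_char (n : ℤ) : Continuous (char n) :=
  continuous_iff_continuousAt.2 fun θ => (hasDerivAt_char n θ).continuousAt

theorem char_add (m n : ℤ) (θ : ℝ) : char (m + n) θ = char m θ * char n θ := by
  simp only [char, ← Complex.exp_add]; congr 1; push_cast; ring

theorem char_zero (θ : ℝ) : char 0 θ = 1 := by simp [char]

theorem norm_char (n : ℤ) (θ : ℝ) : ‖char n θ‖ = 1 := by
  have : (n * θ * Complex.I : ℂ) = ((n * θ : ℝ) : ℂ) * Complex.I := by push_cast; ring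
  rw [char, this, Complex.norm_exp_ofReal_mul_I]

theorem conj_char (n : ℤ) (θ : ℝ) : (starRingEnd ℂ) (char n θ) = char (-n) θ := by
  simp [char, ← Complex.exp_conj]

theorem char_periodic (n : ℤ) : Function.Periodic (char n) (2 * π) := by
  intro θ
  have : (n * (θ + 2 * π : ℝ) * Complex.I : ℂ)
      = n * θ * Complex.I + n * (2 * π * Complex.I) := by push_cast; ring
  rw [char, this, Complex.exp_add, Complex.exp_int_mul_two_pi_mul_I, mul_one, char]

theorem h1Pair_char (n : ℤ) : H1Pair (char n) (fun θ => n * Complex.I * char n θ) :=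
  H1Pair.of_hasDerivAt (char_periodic n) (hasDerivAt_char n)
    (continuous_const.mul (continuous_char n))

/-- The Fourier coefficients of a function on `[0, 2π]`. -/
noncomputable def coeff (f : ℝ → ℂ) (n : ℤ) : ℂ :=
  (1 / (2 * π) : ℝ) • ∫ θ in (0 : ℝ)..(2 * π), char (-n) θ * f θ

theorem coeff_eq_fourierCoeffOn (f : ℝ → ℂ) (n : ℤ) :
    coeff f n = fourierCoeffOn two_pi_pos f n := by
  rw [fourierCoeffOn_eq_integral, coeff, sub_zero]
  congr 1
  refine intervalIntegral.integral_congr fun x _ => ?_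
  simp only [smul_eq_mul, fourier_coe_apply, char]
  congr 2
  have : (π : ℂ) ≠ 0 := by exact_mod_cast pi_ne_zero
  push_cast
  field_simp

theorem hasSum_sq_coeff {f : ℝ → ℂ} (h : MemLp f 2 (volume.restrict (Ioc 0 (2 * π)))) :
    HasSum (fun n => ‖coeff f n‖ ^ 2)
      ((1 / (2 * π)) * ∫ θ in (0 : ℝ)..(2 * π), ‖f θ‖ ^ 2) := by
  have := hasSum_sq_fourierCoeffOn two_pi_pos h
  simpa [coeff_eq_fourierCoeffOn] using this

theorem integral_char (n : ℤ) (hn : n ≠ 0) : ∫ θ in (0 : ℝ)..(2 * π), char n θ = 0 := by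
  have h := (h1Pair_char n).integral_period
  rw [intervalIntegral.integral_const_mul] at h
  have : (n : ℂ) * Complex.I ≠ 0 := mul_ne_zero (by exact_mod_cast hn) Complex.I_ne_zero
  exact (mul_eq_zero.1 h).resolve_left this

theorem coeff_char (m n : ℤ) : coeff (char m) n = if n = m then 1 else 0 := by
  have h : ∀ θ, char (-n) θ * char m θ = char (m - n) θ := fun θ => by
    rw [← char_add]; congr 1; ring
  simp only [coeff, h]
  split_ifs with hmn
  · subst hmn
    have : (π : ℂ) ≠ 0 := by exact_mod_cast pi_ne_zero
    simp [char_zero]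
    field_simp
  · rw [integral_char _ (by omega), smul_zero]

theorem coeff_sub {f g : ℝ → ℂ} (hf : Continuous f) (hg : Continuous g) (n : ℤ) :
    coeff (fun θ => f θ - g θ) n = coeff f n - coeff g n := by
  simp only [coeff, mul_sub]
  rw [intervalIntegral.integral_sub, smul_sub]
  · exact ((continuous_char _).mul hf).intervalIntegrable _ _
  · exact ((continuous_char _).mul hg).intervalIntegrable _ _

theorem coeff_add {f g : ℝ → ℂ} (hf : Continuous f) (hg : Continuous g) (n : ℤ) :
    coeff (fun θ => f θ + g θ) n = coeff f n + coeff g n := by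
  simp only [coeff, mul_add]
  rw [intervalIntegral.integral_add, smul_add]
  · exact ((continuous_char _).mul hf).intervalIntegrable _ _
  · exact ((continuous_char _).mul hg).intervalIntegrable _ _

theorem coeff_mul_const (f : ℝ → ℂ) (c : ℂ) (n : ℤ) :
    coeff (fun θ => c * f θ) n = c * coeff f n := by
  have : ∀ θ, char (-n) θ * (c * f θ) = c * (char (-n) θ * f θ) := fun θ => by ring
  simp only [coeff, this, intervalIntegral.integral_const_mul, mul_smul_comm]

theorem H1Pair.coeff_deriv {f f' : ℝ → ℂ} (h : H1Pair f f') (n : ℤ) :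
    coeff f' n = n * Complex.I * coeff f n := by
  have h1 := ((h1Pair_char (-n)).smul h).integral_period
  simp only [smul_eq_mul] at h1
  rw [intervalIntegral.integral_add] at h1
  · have h2 : ∀ θ, (((-n : ℤ) : ℂ) * Complex.I * char (-n) θ) * f θ
        = -(n * Complex.I) * (char (-n) θ * f θ) := fun θ => by push_cast; ring
    simp only [h2, intervalIntegral.integral_const_mul] at h1
    have h3 := eq_neg_of_add_eq_zero_right h1
    rw [coeff, h3, coeff, neg_mul, neg_neg, mul_smul_comm]
  · exact ((continuous_const.mul (continuous_char _)).mul h.continuous).intervalIntegrable _ _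
  · exact (h.intervalIntegrable _ _).continuousOn_mul (continuous_char _).continuousOn

theorem H1Pair.hasSum_sq {f f' : ℝ → ℂ} (h : H1Pair f f') :
    HasSum (fun n => ‖coeff f n‖ ^ 2)
      ((1 / (2 * π)) * ∫ θ in (0 : ℝ)..(2 * π), ‖f θ‖ ^ 2) :=
  hasSum_sq_coeff (H1Pair.memLp_of_sq h.continuous.aestronglyMeasurable
    ((h.continuous.norm.pow 2).intervalIntegrable _ _))

theorem H1Pair.hasSum_sq_deriv {f f' : ℝ → ℂ} (h : H1Pair f f') :
    HasSum (fun n : ℤ => (n : ℝ) ^ 2 * ‖coeff f n‖ ^ 2)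
      ((1 / (2 * π)) * ∫ θ in (0 : ℝ)..(2 * π), ‖f' θ‖ ^ 2) := by
  convert hasSum_sq_coeff h.memLp using 2 with n
  rw [h.coeff_deriv, norm_mul, norm_mul, Complex.norm_I, mul_one, mul_pow]
  congr 1
  rw [Complex.norm_intCast, sq_abs]

/-- Parseval's identity for a function without its Fourier modes `±1`. -/
theorem hasSum_sq_sub_modes {f f' : ℝ → ℂ} (h : H1Pair f f') :
    HasSum (fun n : ℤ => if n = 1 ∨ n = -1 then 0 else ‖coeff f n‖ ^ 2)
      ((1 / (2 * π)) * ∫ θ in (0 : ℝ)..(2 * π),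
        ‖f θ - (coeff f 1 * char 1 θ + coeff f (-1) * char (-1) θ)‖ ^ 2) := by
  have c1 : Continuous fun θ => coeff f 1 * char 1 θ := continuous_const.mul (continuous_char _)
  have c2 : Continuous fun θ => coeff f (-1) * char (-1) θ :=
    continuous_const.mul (continuous_char _)
  have c12 : Continuous fun θ => coeff f 1 * char 1 θ + coeff f (-1) * char (-1) θ := c1.add c2
  have hc : Continuous fun θ => f θ - (coeff f 1 * char 1 θ + coeff f (-1) * char (-1) θ) :=
    h.continuous.sub c12
  convert hasSum_sq_coeff (H1Pair.memLp_of_sq hc.aestronglyMeasurable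
    ((hc.norm.pow 2).intervalIntegrable _ _)) using 2 with n
  rw [coeff_sub h.continuous c12, coeff_add c1 c2, coeff_mul_const, coeff_mul_const,
    coeff_char, coeff_char]
  by_cases h1 : n = 1
  · subst h1; simp
  · by_cases h2 : n = -1
    · subst h2; simp
    · simp [h1, h2]

/-! ### The coercive quadratic form on Fourier coefficients -/

theorem sum_inv_four_sq_sub_one_le (N : ℕ) :
    ∑ k ∈ Finset.range N, 1 / (4 * ((k : ℝ) + 1) ^ 2 - 1) ≤ 1 / 2 := by
  have h : ∑ k ∈ Finset.range N, 1 / (4 * ((k : ℝ) + 1) ^ 2 - 1) = (N : ℝ) / (2 * N + 1) := by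
    induction N with
    | zero => simp
    | succ N ih =>
      rw [Finset.sum_range_succ, ih]
      have h1 : (4 * ((N : ℝ) + 1) ^ 2 - 1) = (2 * N + 1) * (2 * N + 3) := by ring
      rw [h1]
      push_cast
      field_simp
      ring
  rw [h, div_le_div_iff₀ (by positivity) (by norm_num)]
  linarith

theorem sum_even_le_hasSum {h : ℤ → ℝ} {S : ℝ} (h0 : ∀ n, 0 ≤ h n) (hS : HasSum h S) (N : ℕ) :
    ∑ k ∈ Finset.range N, (h (-(2 * (k + 1))) + h (2 * (k + 1))) ≤ S := by
  classical
  have i1 : Set.InjOn (fun k : ℕ => (-(2 * ((k : ℤ) + 1)))) (Finset.range N) := by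
    intro a _ b _ hab
    simp only at hab
    omega
  have i2 : Set.InjOn (fun k : ℕ => (2 * ((k : ℤ) + 1))) (Finset.range N) := by
    intro a _ b _ hab
    simp only at hab
    omega
  rw [Finset.sum_add_distrib, ← Finset.sum_image (f := h) i1, ← Finset.sum_image (f := h) i2,
    ← Finset.sum_union]
  · exact sum_le_hasSum _ (fun n _ => h0 n) hS
  · rw [Finset.disjoint_left]
    intro n h1 h2
    simp only [Finset.mem_image] at h1 h2
    obtain ⟨a, _, rfl⟩ := h1
    obtain ⟨b, _, hb⟩ := h2
    omega

/-- If `x` is bounded by a term `X` with `X² ≤ (1 - 2 ε) S`, up to an error `l`, then `S - x²` is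
coercive up to a multiple of `l²`. -/
theorem coercive_aux {ε x l X S : ℝ} (hε : 0 < ε) (hε1 : ε ≤ 1 / 2) (hx : 0 ≤ x)
    (hxl : x ≤ l + X) (hXS : X ^ 2 ≤ (1 - 2 * ε) * S) (hS : 0 ≤ S) :
    ε / 4 * (x ^ 2 + S) - 2 * (1 + 1 / ε) * l ^ 2 ≤ S - x ^ 2 := by
  have h1 : x ^ 2 ≤ (l + X) ^ 2 := pow_le_pow_left₀ hx hxl 2
  have h2 : (l + X) ^ 2 ≤ (1 + 1 / ε) * l ^ 2 + (1 + ε) * X ^ 2 := by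
    have : (1 + 1 / ε) * l ^ 2 + (1 + ε) * X ^ 2 - (l + X) ^ 2 = (l - ε * X) ^ 2 / ε := by
      field_simp; ring
    have h3 : 0 ≤ (l - ε * X) ^ 2 / ε := by positivity
    linarith
  have h3 : (1 + ε) * X ^ 2 ≤ (1 - ε) * S := by
    have : (1 + ε) * X ^ 2 ≤ (1 + ε) * ((1 - 2 * ε) * S) :=
      mul_le_mul_of_nonneg_left hXS (by linarith)
    nlinarith [mul_nonneg (sq_nonneg ε) hS]
  have h4 : 0 ≤ (1 + 1 / ε) * l ^ 2 := by positivity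
  have h5 : x ^ 2 ≤ (1 + 1 / ε) * l ^ 2 + (1 - ε) * S := by linarith
  have h6 : (1 + ε / 4) * x ^ 2 ≤ (1 + ε / 4) * ((1 + 1 / ε) * l ^ 2 + (1 - ε) * S) :=
    mul_le_mul_of_nonneg_left h5 (by linarith)
  nlinarith [mul_nonneg (sq_nonneg ε) hS, mul_nonneg hε.le hS, mul_nonneg hε.le h4]

/-- The inequality behind the spectral gap, for the absolute values `a n` of the Fourier
coefficients of a function `f`: the quadratic form `∑ (n² - 1) a n²` has the single negative term
`n = 0`, and the hypothesis `hlin` bounds `a 0` by the even modes `|n| ≥ 2` up to an error `l`. As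
`∑ 1 / (4 k² - 1) = 1 / 2`, the Cauchy-Schwarz inequality makes the form coercive up to `l²`. -/
theorem coercive_of_hasSum {q : ℝ} (hq0 : 0 ≤ q) (hq1 : q < 1) {a : ℤ → ℝ} (ha : ∀ n, 0 ≤ a n)
    {S₀ S₁ D l X : ℝ} (hS₀ : HasSum (fun n => a n ^ 2) S₀)
    (hS₁ : HasSum (fun n : ℤ => (n : ℝ) ^ 2 * a n ^ 2) S₁)
    (hD : HasSum (fun n : ℤ => if n = 1 ∨ n = -1 then 0 else a n ^ 2) D)
    (hX : HasSum (fun k : ℕ => q ^ k * (q * a (-(2 * (k + 1))) + a (2 * (k + 1)))) X)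
    (hlin : a 0 ≤ l + X) :
    (1 - q ^ 2) / 16 * D - 2 * (1 + 4 / (1 - q ^ 2)) * l ^ 2 ≤ S₁ - S₀ := by
  set h : ℤ → ℝ := fun n => if n = 0 then 0 else ((n : ℝ) ^ 2 - 1) * a n ^ 2 with hh
  have hq2 : q ^ 2 < 1 := by nlinarith
  have hsq : ∀ n : ℤ, n ≠ 0 → (1 : ℝ) ≤ (n : ℝ) ^ 2 := fun n hn => by
    have : (1 : ℤ) ≤ n ^ 2 := by have := pow_pos (abs_pos.2 hn) 2; rw [sq_abs] at this; omega
    exact_mod_cast this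
  have h0 : ∀ n, 0 ≤ h n := fun n => by
    simp only [hh]
    split_ifs with hn
    · exact le_rfl
    · exact mul_nonneg (by linarith [hsq n hn]) (sq_nonneg _)
  have hS : HasSum h (S₁ - S₀ + a 0 ^ 2) := by
    have e : h = fun n : ℤ => (n : ℝ) ^ 2 * a n ^ 2 - a n ^ 2 + if n = 0 then a 0 ^ 2 else 0 := by
      funext n
      simp only [hh]
      split_ifs with hn
      · subst hn; simp
      · ring
    rw [e]
    exact (hS₁.sub hS₀).add (hasSum_ite_eq (0 : ℤ) (a 0 ^ 2))
  set S := S₁ - S₀ + a 0 ^ 2 with hSdef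
  have hSnn : 0 ≤ S := hS.nonneg h0
  -- Cauchy-Schwarz, with weights `4 (k + 1) ^ 2 - 1`
  have hpart : ∀ N : ℕ, (∑ k ∈ Finset.range N,
      q ^ k * (q * a (-(2 * (k + 1))) + a (2 * (k + 1)))) ^ 2 ≤ (1 + q ^ 2) / 2 * S := by
    intro N
    have hm : ∀ k : ℕ, (0 : ℝ) < 4 * ((k : ℝ) + 1) ^ 2 - 1 := fun k => by
      have : (0 : ℝ) ≤ k := k.cast_nonneg
      nlinarith
    have hcs := Finset.sum_sq_le_sum_mul_sum_of_sq_le_mul (Finset.range N)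
      (r := fun k : ℕ => q ^ k * (q * a (-(2 * (k + 1))) + a (2 * (k + 1))))
      (f := fun k : ℕ => (1 + q ^ 2) * (1 / (4 * ((k : ℝ) + 1) ^ 2 - 1)))
      (g := fun k : ℕ => h (-(2 * (k + 1))) + h (2 * (k + 1)))
      (fun k _ => mul_nonneg (by positivity) (one_div_nonneg.2 (hm k).le))
      (fun k _ => add_nonneg (h0 _) (h0 _)) (fun k _ => ?_)
    · refine hcs.trans ?_
      have e1 : ∑ k ∈ Finset.range N, (1 + q ^ 2) * (1 / (4 * ((k : ℝ) + 1) ^ 2 - 1))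
          ≤ (1 + q ^ 2) / 2 := by
        rw [← Finset.mul_sum]
        have := mul_le_mul_of_nonneg_left (sum_inv_four_sq_sub_one_le N)
          (show 0 ≤ 1 + q ^ 2 by positivity)
        linarith
      exact mul_le_mul e1 (sum_even_le_hasSum h0 hS N)
        (Finset.sum_nonneg fun k _ => add_nonneg (h0 _) (h0 _)) (by positivity)
    · have n1 : (-(2 * ((k : ℤ) + 1))) ≠ 0 := by omega
      have n2 : (2 * ((k : ℤ) + 1)) ≠ 0 := by omega
      simp only [hh, n1, n2, if_false]
      have hk := (hm k).ne'
      push_cast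
      have e : (1 + q ^ 2) * (1 / (4 * ((k : ℝ) + 1) ^ 2 - 1)) *
          (((-(2 * ((k : ℝ) + 1))) ^ 2 - 1) * a (-(2 * (k + 1))) ^ 2 +
            ((2 * ((k : ℝ) + 1)) ^ 2 - 1) * a (2 * (k + 1)) ^ 2)
          = (1 + q ^ 2) * (a (-(2 * (k + 1))) ^ 2 + a (2 * (k + 1)) ^ 2) := by
        field_simp; ring
      rw [e, mul_pow]
      have hqk : (q ^ k) ^ 2 ≤ 1 := pow_le_one₀ (by positivity) (pow_le_one₀ hq0 hq1.le)
      refine (mul_le_of_le_one_left (sq_nonneg _) hqk).trans ?_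
      nlinarith [sq_nonneg (q * a (2 * (k + 1)) - a (-(2 * (k + 1))))]
  have hXS : X ^ 2 ≤ (1 + q ^ 2) / 2 * S :=
    le_of_tendsto' (hX.tendsto_sum_nat.pow 2) hpart
  have hDle : D ≤ a 0 ^ 2 + S := by
    refine hasSum_le (fun n => ?_) hD ((hasSum_ite_eq (0 : ℤ) (a 0 ^ 2)).add hS)
    simp only [hh]
    by_cases hn : n = 0
    · subst hn; simp
    · rw [if_neg hn, if_neg hn]
      by_cases hn1 : n = 1 ∨ n = -1
      · rw [if_pos hn1, zero_add]
        exact mul_nonneg (by linarith [hsq n hn]) (sq_nonneg _)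
      · rw [if_neg hn1, zero_add]
        have : (2 : ℤ) ≤ n ^ 2 := by
          push Not at hn1
          have : 2 ≤ |n| := by rcases abs_cases n with h | h <;> omega
          rw [← sq_abs]; nlinarith
        have : (2 : ℝ) ≤ (n : ℝ) ^ 2 := by exact_mod_cast this
        nlinarith [sq_nonneg (a n)]
  have hε : 0 < (1 - q ^ 2) / 4 := by linarith
  have key := coercive_aux hε (by nlinarith) (ha 0) hlin
    (by convert hXS using 2; ring) hSnn
  have e1 : 1 / ((1 - q ^ 2) / 4) = 4 / (1 - q ^ 2) := by rw [one_div_div]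
  rw [e1] at key
  have e2 : (1 - q ^ 2) / 16 * D ≤ (1 - q ^ 2) / 4 / 4 * (a 0 ^ 2 + S) := by
    have := mul_le_mul_of_nonneg_left hDle (show 0 ≤ (1 - q ^ 2) / 16 by linarith)
    linarith
  linarith

/-! ### The Poisson kernel and the scalar spectral gaps -/

/-- The Poisson kernel `(1 - q²) / (1 - 2 q cos 2θ + q²) = ∑ q^|k| exp (2 i k θ)`. -/
noncomputable def poisson (q θ : ℝ) : ℝ := (1 - q ^ 2) / (1 - 2 * q * cos (2 * θ) + q ^ 2)

/-- The analytic half `∑_{k ≥ 0} q^k exp (2 i k θ)` of the Poisson kernel. -/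
noncomputable def geom (q θ : ℝ) : ℂ := (1 - q * char 2 θ)⁻¹

theorem poisson_denom_pos {q : ℝ} (hq0 : 0 ≤ q) (hq1 : q < 1) (θ : ℝ) :
    0 < 1 - 2 * q * cos (2 * θ) + q ^ 2 := by
  nlinarith [cos_le_one (2 * θ), mul_nonneg hq0 (sub_nonneg.2 (cos_le_one (2 * θ))),
    pow_pos (sub_pos.2 hq1) 2]

theorem poisson_pos {q : ℝ} (hq0 : 0 ≤ q) (hq1 : q < 1) (θ : ℝ) : 0 < poisson q θ :=
  div_pos (by nlinarith) (poisson_denom_pos hq0 hq1 θ)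

theorem continuous_poisson {q : ℝ} (hq0 : 0 ≤ q) (hq1 : q < 1) : Continuous (poisson q) :=
  continuous_const.div (by fun_prop) fun θ => (poisson_denom_pos hq0 hq1 θ).ne'

theorem poisson_add_pi (q θ : ℝ) : poisson q (θ + π) = poisson q θ := by
  have : 2 * (θ + π) = 2 * θ + 2 * π := by ring
  rw [poisson, this, cos_add_two_pi, poisson]

theorem one_sub_mul_char_ne_zero {q : ℝ} (hq0 : 0 ≤ q) (hq1 : q < 1) (n : ℤ) (θ : ℝ) :
    (1 - q * char n θ : ℂ) ≠ 0 := by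
  intro h
  have h1 : (q * char n θ : ℂ) = 1 := (sub_eq_zero.1 h).symm
  have h2 : ‖(q * char n θ : ℂ)‖ = 1 := by rw [h1]; simp
  rw [norm_mul, norm_char, mul_one, Complex.norm_real, norm_of_nonneg hq0] at h2
  linarith

theorem continuous_geom {q : ℝ} (hq0 : 0 ≤ q) (hq1 : q < 1) : Continuous (geom q) :=
  (continuous_const.sub (continuous_const.mul (continuous_char 2))).inv₀
    fun θ => one_sub_mul_char_ne_zero hq0 hq1 2 θ

theorem char_mul_char_neg (n : ℤ) (θ : ℝ) : char n θ * char (-n) θ = 1 := by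
  rw [← char_add, add_neg_cancel, char_zero]

theorem char_one_eq (θ : ℝ) : char 1 θ = cos θ + sin θ * Complex.I := by
  simp [char, Complex.exp_mul_I]

theorem char_neg_one_eq (θ : ℝ) : char (-1) θ = cos θ - sin θ * Complex.I := by
  rw [← conj_char, char_one_eq, map_add, map_mul, Complex.conj_I, Complex.conj_ofReal,
    Complex.conj_ofReal]; ring

theorem poisson_eq {q : ℝ} (hq0 : 0 ≤ q) (hq1 : q < 1) (θ : ℝ) :
    (poisson q θ : ℂ) = (1 - q ^ 2) * (geom q θ * (1 - q * char (-2) θ)⁻¹) := by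
  have h1 := one_sub_mul_char_ne_zero hq0 hq1 2 θ
  have h2 := one_sub_mul_char_ne_zero hq0 hq1 (-2) θ
  have h3 : ((1 - 2 * q * cos (2 * θ) + q ^ 2 : ℝ) : ℂ)
      = (1 - q * char 2 θ) * (1 - q * char (-2) θ) := by
    have e1 : char 2 θ + char (-2) θ = 2 * (cos (2 * θ) : ℝ) := by
      rw [← conj_char, Complex.add_conj]
      rw [char, show ((2 : ℤ) * θ * Complex.I : ℂ) = ((2 * θ : ℝ) : ℂ) * Complex.I by push_cast; ring,
        Complex.exp_ofReal_mul_I_re]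
      push_cast; rfl
    have e2 := char_mul_char_neg 2 θ
    push_cast at e1 ⊢
    linear_combination (q : ℂ) * e1 - (q : ℂ) ^ 2 * e2
  rw [poisson, Complex.ofReal_div, h3, geom]
  push_cast
  field_simp

/-- The Poisson kernel is twice the real part of its analytic half, up to the constant term. -/
theorem poisson_eq_add {q : ℝ} (hq0 : 0 ≤ q) (hq1 : q < 1) (θ : ℝ) :
    (poisson q θ : ℂ) = geom q θ + (starRingEnd ℂ) (geom q θ) - 1 := by
  have h1 := one_sub_mul_char_ne_zero hq0 hq1 2 θ
  have h2 := one_sub_mul_char_ne_zero hq0 hq1 (-2) θ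
  have e2 := char_mul_char_neg 2 θ
  rw [poisson_eq hq0 hq1, geom, map_inv₀, map_sub, map_mul, conj_char, map_one,
    Complex.conj_ofReal]
  field_simp
  linear_combination (q : ℂ) ^ 2 * e2

theorem hasSum_geom {q : ℝ} (hq0 : 0 ≤ q) (hq1 : q < 1) (θ : ℝ) :
    HasSum (fun k : ℕ => (q : ℂ) ^ k * char (2 * k) θ) (geom q θ) := by
  have h : ‖(q * char 2 θ : ℂ)‖ < 1 := by
    rw [norm_mul, norm_char, mul_one, Complex.norm_real, norm_of_nonneg hq0]; exact hq1
  have e : (fun k : ℕ => (q : ℂ) ^ k * char (2 * k) θ) = fun k : ℕ => (q * char 2 θ) ^ k := by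
    funext k
    rw [mul_pow, char, char, ← Complex.exp_nat_mul]
    congr 2
    push_cast; ring
  rw [e]
  exact hasSum_geometric_of_norm_lt_one h

/-- Fourier coefficients of a product with `geom q`. -/
theorem hasSum_coeff_geom_mul {q : ℝ} (hq0 : 0 ≤ q) (hq1 : q < 1) {f : ℝ → ℂ}
    (hf : Continuous f) :
    HasSum (fun k : ℕ => (q : ℂ) ^ k * coeff f (-(2 * k)))
      (coeff (fun θ => geom q θ * f θ) 0) := by
  obtain ⟨C, hC⟩ := isCompact_Icc.exists_bound_of_continuousOn (s := Icc 0 (2 * π))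
      hf.continuousOn
  have hsum : Summable fun k : ℕ => q ^ k * C :=
    (summable_geometric_of_lt_one hq0 hq1).mul_right C
  have key := intervalIntegral.hasSum_integral_of_dominated_convergence (μ := volume)
    (a := 0) (b := 2 * π) (F := fun (k : ℕ) θ => (q : ℂ) ^ k * char (2 * k) θ * f θ)
    (f := fun θ => geom q θ * f θ) (bound := fun k _ => q ^ k * C)
    (fun k => ((continuous_const.mul (continuous_char _)).mul hf).aestronglyMeasurable)
    (fun k => ae_of_all _ fun θ hθ => by
      rw [uIoc_of_le two_pi_pos.le] at hθ
      rw [norm_mul, norm_mul, norm_char, mul_one, norm_pow, Complex.norm_real, norm_of_nonneg hq0]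
      exact mul_le_mul_of_nonneg_left (hC θ (Ioc_subset_Icc_self hθ)) (by positivity))
    (ae_of_all _ fun θ _ => hsum)
    (continuous_const.intervalIntegrable _ _)
    (ae_of_all _ fun θ _ => (hasSum_geom hq0 hq1 θ).mul_right _)
  have := key.const_smul (1 / (2 * π) : ℝ)
  simp only [coeff, neg_zero, char_zero, one_mul]
  have e : (fun k : ℕ => (q : ℂ) ^ k * ((1 / (2 * π) : ℝ) •
      ∫ θ in (0 : ℝ)..(2 * π), char (- -(2 * (k : ℤ))) θ * f θ)) = fun k : ℕ =>
      (1 / (2 * π) : ℝ) • ∫ θ in (0 : ℝ)..(2 * π), (q : ℂ) ^ k * char (2 * k) θ * f θ := by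
    funext k
    simp only [mul_smul_comm, ← intervalIntegral.integral_const_mul, neg_neg, mul_assoc]
  rw [e]
  exact this

theorem norm_coeff_le {f : ℝ → ℂ} {C : ℝ} (hC : ∀ θ ∈ Icc 0 (2 * π), ‖f θ‖ ≤ C)
    (n : ℤ) : ‖coeff f n‖ ≤ C := by
  have h := intervalIntegral.norm_integral_le_of_norm_le_const (a := 0) (b := 2 * π)
    (f := fun θ => char (-n) θ * f θ) (C := C) (fun θ hθ => by
      rw [uIoc_of_le two_pi_pos.le] at hθ
      rw [norm_mul, norm_char, one_mul]
      exact hC θ (Ioc_subset_Icc_self hθ))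
  rw [sub_zero, abs_of_pos two_pi_pos] at h
  rw [coeff, norm_smul, norm_of_nonneg (by positivity), one_div, inv_mul_le_iff₀ two_pi_pos]
  linarith

theorem summable_geom_coeff {q : ℝ} (hq0 : 0 ≤ q) (hq1 : q < 1) {f : ℝ → ℂ}
    (hf : Continuous f) (m : ℕ → ℤ) : Summable fun k : ℕ => q ^ k * ‖coeff f (m k)‖ := by
  obtain ⟨C, hC⟩ := isCompact_Icc.exists_bound_of_continuousOn (s := Icc 0 (2 * π))
      hf.continuousOn
  refine Summable.of_nonneg_of_le (fun k => by positivity) (fun k => ?_)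
    ((summable_geometric_of_lt_one hq0 hq1).mul_right C)
  exact mul_le_mul_of_nonneg_left (norm_coeff_le hC _) (by positivity)

theorem coeff_conj (f : ℝ → ℂ) (n : ℤ) :
    coeff (fun θ => (starRingEnd ℂ) (f θ)) n = (starRingEnd ℂ) (coeff f (-n)) := by
  rw [coeff, coeff, Complex.real_smul, Complex.real_smul, map_mul, Complex.conj_ofReal,
    ← intervalIntegral.intervalIntegral_conj]
  simp only [map_mul, conj_char, neg_neg]

theorem coeff_char_mul (f : ℝ → ℂ) (m n : ℤ) :
    coeff (fun θ => char m θ * f θ) n = coeff f (n - m) := by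
  simp only [coeff, ← mul_assoc, ← char_add]
  congr 3; funext θ; congr 2; ring

/-- The constant in front of the square of the linearized constraint. -/
noncomputable def gapConst (q : ℝ) : ℝ :=
  2 * π * (2 * (1 + 4 / (1 - q ^ 2))) * (1 / (2 * π * (1 - q))) ^ 2

/-- The spectral gap for a complex-valued function whose zeroth Fourier coefficient is bounded by
its even coefficients, up to an error proportional to `R`. -/
theorem gap_of_coeff_zero_le {q : ℝ} (hq0 : 0 ≤ q) (hq1 : q < 1) {f f' : ℝ → ℂ}
    (h : H1Pair f f') {R : ℝ}
    (hlin : ‖coeff f 0‖ ≤ R / (2 * π * (1 - q)) + ∑' k : ℕ, q ^ k *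
      (q * ‖coeff f (-(2 * (k + 1)))‖ + ‖coeff f (2 * (k + 1))‖)) :
    (1 - q ^ 2) / 16 * (∫ θ in (0 : ℝ)..(2 * π),
        ‖f θ - (coeff f 1 * char 1 θ + coeff f (-1) * char (-1) θ)‖ ^ 2) - gapConst q * R ^ 2
      ≤ (∫ θ in (0 : ℝ)..(2 * π), ‖f' θ‖ ^ 2) - ∫ θ in (0 : ℝ)..(2 * π), ‖f θ‖ ^ 2 := by
  have hs : Summable fun k : ℕ => q ^ k *
      (q * ‖coeff f (-(2 * (k + 1)))‖ + ‖coeff f (2 * (k + 1))‖) := by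
    have h1 := (summable_geom_coeff hq0 hq1 h.continuous
      (fun k => -(2 * ((k : ℤ) + 1)))).mul_left q
    have h2 := summable_geom_coeff hq0 hq1 h.continuous (fun k => 2 * ((k : ℤ) + 1))
    have e : (fun k : ℕ => q ^ k *
      (q * ‖coeff f (-(2 * (k + 1)))‖ + ‖coeff f (2 * (k + 1))‖)) = fun k : ℕ =>
        q * (q ^ k * ‖coeff f (-(2 * ((k : ℤ) + 1)))‖) + q ^ k * ‖coeff f (2 * ((k : ℤ) + 1))‖ := by
      funext k; ring
    rw [e]
    exact h1.add h2
  have key := coercive_of_hasSum hq0 hq1 (a := fun n => ‖coeff f n‖) (fun n => norm_nonneg _)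
    h.hasSum_sq h.hasSum_sq_deriv (hasSum_sq_sub_modes h) hs.hasSum hlin
  have key2 := mul_le_mul_of_nonneg_left key two_pi_pos.le
  have hpi : (2 * π) * (1 / (2 * π)) = 1 := by field_simp
  set A := ∫ θ in (0 : ℝ)..(2 * π),
        ‖f θ - (coeff f 1 * char 1 θ + coeff f (-1) * char (-1) θ)‖ ^ 2
  set B := ∫ θ in (0 : ℝ)..(2 * π), ‖f' θ‖ ^ 2
  set C := ∫ θ in (0 : ℝ)..(2 * π), ‖f θ‖ ^ 2
  have e1 : 2 * π * ((1 - q ^ 2) / 16 * (1 / (2 * π) * A) -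
      2 * (1 + 4 / (1 - q ^ 2)) * (R / (2 * π * (1 - q))) ^ 2)
      = (1 - q ^ 2) / 16 * A - gapConst q * R ^ 2 := by
    rw [gapConst, div_eq_mul_one_div R]
    linear_combination ((1 - q ^ 2) / 16 * A) * hpi
  have e2 : 2 * π * (1 / (2 * π) * B - 1 / (2 * π) * C) = B - C := by
    linear_combination (B - C) * hpi
  rw [e1, e2] at key2
  exact key2

theorem norm_coeff_zero (f : ℝ → ℂ) :
    ‖coeff f 0‖ = ‖∫ θ in (0 : ℝ)..(2 * π), f θ‖ / (2 * π) := by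
  simp only [coeff, neg_zero, char_zero, one_mul, norm_smul]
  rw [norm_of_nonneg (by positivity)]
  ring

theorem hasSum_coeff_geom_mul_sub {q : ℝ} (hq0 : 0 ≤ q) (hq1 : q < 1) {f : ℝ → ℂ}
    (hf : Continuous f) :
    HasSum (fun k : ℕ => (q : ℂ) ^ (k + 1) * coeff f (-(2 * (k + 1))))
      (coeff (fun θ => geom q θ * f θ) 0 - coeff f 0) := by
  have h := (hasSum_nat_add_iff' 1).2 (hasSum_coeff_geom_mul hq0 hq1 hf)
  simpa using h

/-- The spectral gap for the component orthogonal to the plane of the loop: the linearized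
constraint is `∫ P f = 0`, with `P` the Poisson kernel. -/
theorem gap_normal {q : ℝ} (hq0 : 0 ≤ q) (hq1 : q < 1) {f f' : ℝ → ℂ} (h : H1Pair f f')
    (hreal : ∀ θ, (starRingEnd ℂ) (f θ) = f θ) :
    (1 - q ^ 2) / 16 * (∫ θ in (0 : ℝ)..(2 * π),
        ‖f θ - (coeff f 1 * char 1 θ + coeff f (-1) * char (-1) θ)‖ ^ 2)
        - gapConst q * ‖∫ θ in (0 : ℝ)..(2 * π), (poisson q θ : ℂ) * f θ‖ ^ 2
      ≤ (∫ θ in (0 : ℝ)..(2 * π), ‖f' θ‖ ^ 2) - ∫ θ in (0 : ℝ)..(2 * π), ‖f θ‖ ^ 2 := by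
  refine gap_of_coeff_zero_le hq0 hq1 h ?_
  have hconj : ∀ n, coeff f n = (starRingEnd ℂ) (coeff f (-n)) := fun n => by
    rw [← coeff_conj]; simp only [hreal]
  have hnorm : ∀ n, ‖coeff f (-n)‖ = ‖coeff f n‖ := fun n => by
    rw [hconj n, RCLike.norm_conj]
  have hY := hasSum_coeff_geom_mul_sub hq0 hq1 h.continuous
  set Y := coeff (fun θ => geom q θ * f θ) 0 - coeff f 0 with hYdef
  have hc : Continuous fun θ => geom q θ * f θ := (continuous_geom hq0 hq1).mul h.continuous
  have hcc : Continuous fun θ => (starRingEnd ℂ) (geom q θ * f θ) :=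
    Complex.continuous_conj.comp hc
  have e1 : coeff (fun θ => (poisson q θ : ℂ) * f θ) 0 = coeff f 0 + (Y + (starRingEnd ℂ) Y) := by
    have e2 : (fun θ => (poisson q θ : ℂ) * f θ)
        = fun θ => (geom q θ * f θ + (starRingEnd ℂ) (geom q θ * f θ)) - f θ := by
      funext θ
      rw [poisson_eq_add hq0 hq1, map_mul, hreal]; ring
    have hcs : Continuous fun θ => geom q θ * f θ + (starRingEnd ℂ) (geom q θ * f θ) := hc.add hcc
    rw [e2, coeff_sub hcs h.continuous, coeff_add hc hcc, coeff_conj, neg_zero, hYdef, map_sub]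
    have := hconj 0
    rw [neg_zero] at this
    rw [← this]; ring
  have hsum : ∀ m : ℕ → ℤ, Summable fun k : ℕ => q ^ k * (q * ‖coeff f (m k)‖) := fun m => by
    have e : (fun k : ℕ => q ^ k * (q * ‖coeff f (m k)‖))
        = fun k => q * (q ^ k * ‖coeff f (m k)‖) := by funext k; ring
    rw [e]
    exact (summable_geom_coeff hq0 hq1 h.continuous m).mul_left q
  have hYle : ‖Y‖ ≤ ∑' k : ℕ, q ^ k * (q * ‖coeff f (-(2 * (k + 1)))‖) := by
    rw [← hY.tsum_eq]
    refine tsum_of_norm_bounded (hsum fun k => -(2 * ((k : ℤ) + 1))).hasSum fun k => ?_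
    rw [norm_mul, norm_pow, Complex.norm_real, norm_of_nonneg hq0]
    exact le_of_eq (by ring)
  have hle : 2 * ∑' k : ℕ, q ^ k * (q * ‖coeff f (-(2 * (k + 1)))‖) ≤
      ∑' k : ℕ, q ^ k * (q * ‖coeff f (-(2 * (k + 1)))‖ + ‖coeff f (2 * (k + 1))‖) := by
    rw [← tsum_mul_left]
    refine Summable.tsum_le_tsum (fun k => ?_)
      ((hsum fun k => -(2 * ((k : ℤ) + 1))).mul_left 2) ?_
    · rw [hnorm]
      have h1 : q * ‖coeff f (2 * (k + 1))‖ ≤ ‖coeff f (2 * (k + 1))‖ :=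
        mul_le_of_le_one_left (norm_nonneg _) hq1.le
      have h2 := mul_le_mul_of_nonneg_left h1 (pow_nonneg hq0 k)
      linarith
    · have := (hsum fun k => -(2 * ((k : ℤ) + 1))).add
        (summable_geom_coeff hq0 hq1 h.continuous (fun k => 2 * ((k : ℤ) + 1)))
      simpa only [mul_add] using this
  have e3 : coeff f 0 = coeff (fun θ => (poisson q θ : ℂ) * f θ) 0 - (Y + (starRingEnd ℂ) Y) := by
    rw [e1]; ring
  have e4 : ‖coeff f 0‖ ≤ ‖coeff (fun θ => (poisson q θ : ℂ) * f θ) 0‖ + (‖Y‖ + ‖Y‖) := by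
    conv_lhs => rw [e3]
    refine (norm_sub_le _ _).trans (add_le_add le_rfl ((norm_add_le _ _).trans ?_))
    rw [RCLike.norm_conj]
  rw [norm_coeff_zero (fun θ => (poisson q θ : ℂ) * f θ)] at e4
  have e5 : ‖∫ θ in (0 : ℝ)..(2 * π), (poisson q θ : ℂ) * f θ‖ / (2 * π) ≤
      ‖∫ θ in (0 : ℝ)..(2 * π), (poisson q θ : ℂ) * f θ‖ / (2 * π * (1 - q)) := by
    refine div_le_div_of_nonneg_left (norm_nonneg _) (by nlinarith [two_pi_pos]) ?_
    nlinarith [two_pi_pos]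
  linarith

/-- The spectral gap for the components in the plane of the loop. The linearized constraint is
`∫ P (w - e² conj w) = 0`, where `e θ = exp (i θ)` and `P` is the Poisson kernel. Combined with `q`
times its complex conjugate it involves the analytic half of `P` only. -/
theorem gap_planar {q : ℝ} (hq0 : 0 ≤ q) (hq1 : q < 1) {f f' : ℝ → ℂ} (h : H1Pair f f') :
    (1 - q ^ 2) / 16 * (∫ θ in (0 : ℝ)..(2 * π),
        ‖f θ - (coeff f 1 * char 1 θ + coeff f (-1) * char (-1) θ)‖ ^ 2)
        - gapConst q * ‖∫ θ in (0 : ℝ)..(2 * π),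
          (poisson q θ : ℂ) * (f θ - char 2 θ * (starRingEnd ℂ) (f θ))‖ ^ 2
      ≤ (∫ θ in (0 : ℝ)..(2 * π), ‖f' θ‖ ^ 2) - ∫ θ in (0 : ℝ)..(2 * π), ‖f θ‖ ^ 2 := by
  refine gap_of_coeff_zero_le hq0 hq1 h ?_
  have hcg := continuous_geom hq0 hq1
  have hcconj : Continuous fun θ => (starRingEnd ℂ) (f θ) :=
    Complex.continuous_conj.comp h.continuous
  have hcb : Continuous fun θ => char 2 θ * (starRingEnd ℂ) (f θ) :=
    (continuous_char 2).mul hcconj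
  set Λ : ℝ → ℂ := fun θ => (poisson q θ : ℂ) * (f θ - char 2 θ * (starRingEnd ℂ) (f θ)) with hΛ
  have hcΛ : Continuous Λ := (Complex.continuous_ofReal.comp
    (continuous_poisson hq0 hq1)).mul (h.continuous.sub hcb)
  have hY := hasSum_coeff_geom_mul_sub hq0 hq1 h.continuous
  have hZ := hasSum_coeff_geom_mul hq0 hq1 hcb
  set Y := coeff (fun θ => geom q θ * f θ) 0 - coeff f 0 with hYdef
  set Z := coeff (fun θ => geom q θ * (char 2 θ * (starRingEnd ℂ) (f θ))) 0 with hZdef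
  have hq2 : (1 - q ^ 2 : ℝ) ≠ 0 := by nlinarith
  have hid : coeff Λ 0 + q * (starRingEnd ℂ) (coeff Λ 0)
      = (1 - q ^ 2 : ℝ) * (coeff f 0 + Y - Z) := by
    have e1 : (starRingEnd ℂ) (coeff Λ 0) = coeff (fun θ => (starRingEnd ℂ) (Λ θ)) 0 := by
      rw [coeff_conj, neg_zero]
    have hcΛ2 : Continuous fun θ => (starRingEnd ℂ) (Λ θ) := Complex.continuous_conj.comp hcΛ
    have hcΛ3 : Continuous fun θ => (q : ℂ) * (starRingEnd ℂ) (Λ θ) := continuous_const.mul hcΛ2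
    have hg1 : Continuous fun θ => geom q θ * f θ := hcg.mul h.continuous
    have hg2 : Continuous fun θ => geom q θ * (char 2 θ * (starRingEnd ℂ) (f θ)) := hcg.mul hcb
    rw [e1, ← coeff_mul_const, ← coeff_add hcΛ hcΛ3, hYdef, add_sub_cancel, hZdef,
      ← coeff_sub hg1 hg2, ← coeff_mul_const]
    congr 1
    funext θ
    have h1 := one_sub_mul_char_ne_zero hq0 hq1 2 θ
    have h2 := one_sub_mul_char_ne_zero hq0 hq1 (-2) θ
    have e2 := char_mul_char_neg 2 θ
    simp only [hΛ, map_mul, map_sub, Complex.conj_ofReal, Complex.conj_conj, conj_char]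
    rw [poisson_eq hq0 hq1, geom]
    push_cast
    field_simp
    linear_combination ((q : ℂ) ^ 3 - q) * (starRingEnd ℂ) (f θ) * e2
  have hX1 := summable_geom_coeff hq0 hq1 h.continuous (fun k => -(2 * ((k : ℤ) + 1)))
  have hX2 := summable_geom_coeff hq0 hq1 h.continuous (fun k => 2 * ((k : ℤ) + 1))
  have hYle : ‖Y‖ ≤ ∑' k : ℕ, q * (q ^ k * ‖coeff f (-(2 * ((k : ℤ) + 1)))‖) := by
    rw [← hY.tsum_eq]
    refine tsum_of_norm_bounded (hX1.mul_left q).hasSum fun k => ?_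
    rw [norm_mul, norm_pow, Complex.norm_real, norm_of_nonneg hq0]
    exact le_of_eq (by ring)
  have hZle : ‖Z‖ ≤ ∑' k : ℕ, q ^ k * ‖coeff f (2 * ((k : ℤ) + 1))‖ := by
    rw [← hZ.tsum_eq]
    refine tsum_of_norm_bounded hX2.hasSum fun k => ?_
    rw [norm_mul, norm_pow, Complex.norm_real, norm_of_nonneg hq0, coeff_char_mul, coeff_conj,
      RCLike.norm_conj]
    exact le_of_eq (by congr 3; ring)
  have hsplit : ∑' k : ℕ, q ^ k * (q * ‖coeff f (-(2 * (k + 1)))‖ + ‖coeff f (2 * (k + 1))‖)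
      = (∑' k : ℕ, q * (q ^ k * ‖coeff f (-(2 * ((k : ℤ) + 1)))‖))
        + ∑' k : ℕ, q ^ k * ‖coeff f (2 * ((k : ℤ) + 1))‖ := by
    rw [← (hX1.mul_left q).tsum_add hX2]
    refine tsum_congr fun k => ?_
    ring
  have hmain : ‖coeff f 0 + Y - Z‖ ≤ ‖∫ θ in (0 : ℝ)..(2 * π), Λ θ‖ / (2 * π * (1 - q)) := by
    have hn : ‖coeff Λ 0 + q * (starRingEnd ℂ) (coeff Λ 0)‖ ≤ (1 + q) * ‖coeff Λ 0‖ := by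
      refine (norm_add_le _ _).trans (le_of_eq ?_)
      rw [norm_mul, RCLike.norm_conj, Complex.norm_real, norm_of_nonneg hq0]; ring
    rw [hid, norm_mul, Complex.norm_real, norm_of_nonneg (by nlinarith), norm_coeff_zero] at hn
    have h1q : 0 < 1 - q := by linarith
    have h3 : (1 + q) * ((1 - q) * ‖coeff f 0 + Y - Z‖) ≤
        (1 + q) * (‖∫ θ in (0 : ℝ)..(2 * π), Λ θ‖ / (2 * π)) := by
      refine le_trans (le_of_eq ?_) hn; ring
    have h4 := le_of_mul_le_mul_left h3 (by linarith)
    rw [← div_div, le_div_iff₀ h1q]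
    linarith
  have e6 : coeff f 0 = (coeff f 0 + Y - Z) - Y + Z := by ring
  have e7 : ‖coeff f 0‖ ≤ ‖coeff f 0 + Y - Z‖ + ‖Y‖ + ‖Z‖ := by
    conv_lhs => rw [e6]
    exact (norm_add_le _ _).trans (add_le_add (norm_sub_le _ _) le_rfl)
  rw [hsplit]
  linarith

/-! ### The spectral gap for vector fields -/

/-- The unit circle in the plane of the first two coordinates. -/
noncomputable def circ (θ : ℝ) : E3 := !₂[cos θ, sin θ, 0]

/-- The component of a vector in the plane of the first two coordinates, as a complex number. -/
noncomputable def planar : E3 →L[ℝ] ℂ :=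
  Complex.ofRealCLM.comp (EuclideanSpace.proj 0) +
    Complex.I • Complex.ofRealCLM.comp (EuclideanSpace.proj 1)

/-- The third component of a vector, as a complex number. -/
noncomputable def normal : E3 →L[ℝ] ℂ := Complex.ofRealCLM.comp (EuclideanSpace.proj 2)

theorem planar_apply (x : E3) : planar x = x 0 + Complex.I * x 1 := by
  simp [planar]

theorem normal_apply (x : E3) : normal x = x 2 := by
  simp [normal]

theorem norm_sq_eq_planar_add_normal (x : E3) : ‖x‖ ^ 2 = ‖planar x‖ ^ 2 + ‖normal x‖ ^ 2 := by
  rw [EuclideanSpace.real_norm_sq_eq, Fin.sum_univ_three, planar_apply, normal_apply,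
    Complex.norm_real, Complex.sq_norm, Complex.normSq_apply]
  simp
  ring

theorem norm_circ (θ : ℝ) : ‖circ θ‖ = 1 := by
  have : ‖circ θ‖ ^ 2 = 1 := by
    rw [EuclideanSpace.real_norm_sq_eq, Fin.sum_univ_three]
    simp [circ]
  nlinarith [norm_nonneg (circ θ)]

theorem inner_circ (θ : ℝ) (x : E3) : inner ℝ (circ θ) x = cos θ * x 0 + sin θ * x 1 := by
  simp [circ, PiLp.inner_apply, Fin.sum_univ_three]
  ring

theorem continuous_circ : Continuous circ := by
  unfold circ
  exact (PiLp.continuous_toLp 2 _).comp (continuous_pi fun i => by fin_cases i <;> simp <;> fun_prop)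

theorem circ_add_pi (θ : ℝ) : circ (θ + π) = -circ θ := by
  ext i
  fin_cases i <;> simp [circ]

/-- The projection onto the orthogonal complement of the unit vector `e`, which is the derivative
of the normalization `x ↦ x / |x|` at `e`. -/
noncomputable def tang (e x : E3) : E3 := x - inner ℝ e x • e

/-- The part of `z` that belongs to the Fourier modes `±1`. -/
noncomputable def modePart (z : ℝ → E3) (θ : ℝ) : E3 :=
  cos θ • ((1 / π) • ∫ t in (0 : ℝ)..(2 * π), cos t • z t) +
    sin θ • ((1 / π) • ∫ t in (0 : ℝ)..(2 * π), sin t • z t)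

theorem clm_modePart (L : E3 →L[ℝ] ℂ) {z : ℝ → E3} (hz : Continuous z) (θ : ℝ) :
    L (modePart z θ) = coeff (fun t => L (z t)) 1 * char 1 θ +
      coeff (fun t => L (z t)) (-1) * char (-1) θ := by
  have hc : Continuous fun t => cos t • z t := continuous_cos.smul hz
  have hs : Continuous fun t => sin t • z t := continuous_sin.smul hz
  have hLc : Continuous fun t => (cos t : ℂ) * L (z t) :=
    (Complex.continuous_ofReal.comp continuous_cos).mul (L.continuous.comp hz)
  have hLs : Continuous fun t => (sin t : ℂ) * L (z t) :=
    (Complex.continuous_ofReal.comp continuous_sin).mul (L.continuous.comp hz)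
  have hLs' : Continuous fun t => Complex.I * ((sin t : ℂ) * L (z t)) := continuous_const.mul hLs
  have e1 : L (∫ t in (0 : ℝ)..(2 * π), cos t • z t)
      = ∫ t in (0 : ℝ)..(2 * π), (cos t : ℂ) * L (z t) := by
    rw [← L.intervalIntegral_comp_comm (hc.intervalIntegrable _ _)]
    simp only [map_smul, Complex.real_smul]
  have e2 : L (∫ t in (0 : ℝ)..(2 * π), sin t • z t)
      = ∫ t in (0 : ℝ)..(2 * π), (sin t : ℂ) * L (z t) := by
    rw [← L.intervalIntegral_comp_comm (hs.intervalIntegrable _ _)]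
    simp only [map_smul, Complex.real_smul]
  set a := ∫ t in (0 : ℝ)..(2 * π), (cos t : ℂ) * L (z t)
  set b := ∫ t in (0 : ℝ)..(2 * π), (sin t : ℂ) * L (z t)
  have e3 : coeff (fun t => L (z t)) 1 = (1 / (2 * π) : ℝ) * (a - Complex.I * b) := by
    rw [coeff, Complex.real_smul]
    congr 1
    rw [← intervalIntegral.integral_const_mul, ← intervalIntegral.integral_sub
      (hLc.intervalIntegrable _ _) (hLs'.intervalIntegrable _ _)]
    congr 1; funext t
    rw [char_neg_one_eq]; ring
  have e4 : coeff (fun t => L (z t)) (-1) = (1 / (2 * π) : ℝ) * (a + Complex.I * b) := by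
    rw [coeff, Complex.real_smul]
    congr 1
    rw [← intervalIntegral.integral_const_mul, ← intervalIntegral.integral_add
      (hLc.intervalIntegrable _ _) (hLs'.intervalIntegrable _ _)]
    congr 1; funext t
    rw [neg_neg, char_one_eq]; ring
  rw [e3, e4, char_one_eq, char_neg_one_eq, modePart, map_add, map_smul, map_smul, map_smul,
    map_smul, e1, e2]
  simp only [Complex.real_smul]
  have hpi : (π : ℂ) ≠ 0 := by exact_mod_cast pi_ne_zero
  push_cast
  field_simp
  linear_combination (2 * Complex.sin θ * b) * Complex.I_sq

theorem continuous_tang {z : ℝ → E3} (hz : Continuous z) :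
    Continuous fun θ => tang (circ θ) (z θ) := by
  have h1 : Continuous fun θ => inner ℝ (circ θ) (z θ) := continuous_circ.inner hz
  have h : Continuous fun θ => inner ℝ (circ θ) (z θ) • circ θ := h1.smul continuous_circ
  exact hz.sub h

theorem planar_tang (θ : ℝ) (x : E3) :
    2 * planar (tang (circ θ) x) = planar x - char 2 θ * (starRingEnd ℂ) (planar x) := by
  have h2 : char 2 θ = char 1 θ * char 1 θ := by rw [← char_add]; norm_num
  have hcs : (Complex.cos θ) ^ 2 + (Complex.sin θ) ^ 2 = 1 := by
    rw [add_comm]; exact Complex.sin_sq_add_cos_sq _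
  rw [h2, char_one_eq, tang, inner_circ, planar_apply, planar_apply]
  simp only [map_add, map_mul, Complex.conj_I, Complex.conj_ofReal]
  simp [circ]
  linear_combination ((Complex.sin θ) ^ 2 * (x 0) - 2 * Complex.cos θ * Complex.sin θ * x 1
    - Complex.I * (Complex.sin θ) ^ 2 * x 1) * Complex.I_sq
    - (x 0 + Complex.I * x 1) * hcs

theorem normal_tang (θ : ℝ) (x : E3) : normal (tang (circ θ) x) = normal x := by
  rw [tang, normal_apply, normal_apply]
  simp [circ]

theorem continuous_modePart (z : ℝ → E3) : Continuous (modePart z) :=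
  (continuous_cos.smul continuous_const).add (continuous_sin.smul continuous_const)

/-- The spectral gap for vector-valued functions: the form `∫ |z'|² - |z|²` controls the distance
of `z` to its Fourier modes `±1`, up to the linearized constraint. -/
theorem gap {q : ℝ} (hq0 : 0 ≤ q) (hq1 : q < 1) {z z' : ℝ → E3} (h : H1Pair z z') :
    (1 - q ^ 2) / 16 * (∫ θ in (0 : ℝ)..(2 * π), ‖z θ - modePart z θ‖ ^ 2)
        - 4 * gapConst q * ‖∫ θ in (0 : ℝ)..(2 * π), poisson q θ • tang (circ θ) (z θ)‖ ^ 2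
      ≤ (∫ θ in (0 : ℝ)..(2 * π), ‖z' θ‖ ^ 2) - ∫ θ in (0 : ℝ)..(2 * π), ‖z θ‖ ^ 2 := by
  have hw := h.clm planar
  have ht := h.clm normal
  have g1 := gap_planar hq0 hq1 hw
  have g2 := gap_normal hq0 hq1 ht fun θ => by rw [normal_apply, Complex.conj_ofReal]
  have hL : Continuous fun θ => poisson q θ • tang (circ θ) (z θ) :=
    (continuous_poisson hq0 hq1).smul (continuous_tang h.continuous)
  have c1 : ∫ θ in (0 : ℝ)..(2 * π),
      (poisson q θ : ℂ) * (planar (z θ) - char 2 θ * (starRingEnd ℂ) (planar (z θ)))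
      = 2 * planar (∫ θ in (0 : ℝ)..(2 * π), poisson q θ • tang (circ θ) (z θ)) := by
    rw [← planar.intervalIntegral_comp_comm (hL.intervalIntegrable _ _),
      ← intervalIntegral.integral_const_mul]
    congr 1; funext θ
    rw [map_smul, Complex.real_smul, ← planar_tang]; ring
  have c2 : ∫ θ in (0 : ℝ)..(2 * π), (poisson q θ : ℂ) * normal (z θ)
      = normal (∫ θ in (0 : ℝ)..(2 * π), poisson q θ • tang (circ θ) (z θ)) := by
    rw [← normal.intervalIntegral_comp_comm (hL.intervalIntegrable _ _)]
    congr 1; funext θ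
    rw [map_smul, Complex.real_smul, normal_tang]
  rw [c1, norm_mul, mul_pow] at g1
  rw [c2] at g2
  simp only [← clm_modePart planar h.continuous, ← map_sub] at g1
  simp only [← clm_modePart normal h.continuous, ← map_sub] at g2
  have hsplit : ∀ y : ℝ → E3, Continuous y → ∫ θ in (0 : ℝ)..(2 * π), ‖y θ‖ ^ 2
      = (∫ θ in (0 : ℝ)..(2 * π), ‖planar (y θ)‖ ^ 2)
        + ∫ θ in (0 : ℝ)..(2 * π), ‖normal (y θ)‖ ^ 2 := fun y hy => by
    simp only [norm_sq_eq_planar_add_normal]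
    rw [intervalIntegral.integral_add]
    · exact ((planar.continuous.comp hy).norm.pow 2).intervalIntegrable _ _
    · exact ((normal.continuous.comp hy).norm.pow 2).intervalIntegrable _ _
  have hsplit' : ∫ θ in (0 : ℝ)..(2 * π), ‖z' θ‖ ^ 2
      = (∫ θ in (0 : ℝ)..(2 * π), ‖planar (z' θ)‖ ^ 2)
        + ∫ θ in (0 : ℝ)..(2 * π), ‖normal (z' θ)‖ ^ 2 := by
    simp only [norm_sq_eq_planar_add_normal]
    rw [intervalIntegral.integral_add (hw.sq_intervalIntegrable _ _)
      (ht.sq_intervalIntegrable _ _)]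
  rw [hsplit', hsplit z h.continuous, hsplit (fun θ => z θ - modePart z θ)
    (h.continuous.sub (continuous_modePart z)), norm_sq_eq_planar_add_normal
      (∫ θ in (0 : ℝ)..(2 * π), poisson q θ • tang (circ θ) (z θ))]
  have hgc : 0 ≤ gapConst q := by
    have : 0 < 1 - q ^ 2 := by nlinarith
    unfold gapConst; positivity
  have h4 : ‖(2 : ℂ)‖ ^ 2 = 4 := by norm_num
  rw [h4] at g1
  have := mul_nonneg hgc (sq_nonneg
    ‖normal (∫ θ in (0 : ℝ)..(2 * π), poisson q θ • tang (circ θ) (z θ))‖)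
  nlinarith

/-! ### The normalization of vectors -/

theorem sq_integral_le {g : ℝ → ℝ} (hg : IntervalIntegrable g volume 0 (2 * π))
    (hg2 : IntervalIntegrable (fun x => g x ^ 2) volume 0 (2 * π)) :
    (∫ x in (0 : ℝ)..(2 * π), g x) ^ 2 ≤ 2 * π * ∫ x in (0 : ℝ)..(2 * π), g x ^ 2 := by
  set m := (∫ x in (0 : ℝ)..(2 * π), g x) / (2 * π) with hm
  have h0 : 0 ≤ ∫ x in (0 : ℝ)..(2 * π), (g x - m) ^ 2 :=
    intervalIntegral.integral_nonneg two_pi_pos.le fun x _ => sq_nonneg _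
  have h1 : ∫ x in (0 : ℝ)..(2 * π), (g x - m) ^ 2
      = (∫ x in (0 : ℝ)..(2 * π), g x ^ 2) - 2 * m * (∫ x in (0 : ℝ)..(2 * π), g x)
        + 2 * π * m ^ 2 := by
    have e : ∀ x, (g x - m) ^ 2 = g x ^ 2 - 2 * m * g x + m ^ 2 := fun x => by ring
    simp only [e]
    rw [intervalIntegral.integral_add (hg2.sub (hg.const_mul _)) (by simp),
      intervalIntegral.integral_sub hg2 (hg.const_mul _), intervalIntegral.integral_const_mul]
    simp
  have h2 : (∫ x in (0 : ℝ)..(2 * π), g x) = 2 * π * m := by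
    rw [hm]; field_simp
  rw [h1, h2] at h0
  rw [h2]
  have := mul_nonneg two_pi_pos.le h0
  nlinarith

section Normalize

variable {F : Type*} [NormedAddCommGroup F] [InnerProductSpace ℝ F]

/-- A quantitative form of the strict differentiability of the normalization `x ↦ x / |x|` at a
unit vector. -/
theorem norm_normalize_sub_sub_le {e a b : F} {δ : ℝ} (he : ‖e‖ = 1) (hδ : δ ≤ 1 / 2)
    (ha : ‖a - e‖ ≤ δ) (hb : ‖b - e‖ ≤ δ) :
    ‖‖a‖⁻¹ • a - ‖b‖⁻¹ • b - ((a - b) - inner ℝ e (a - b) • e)‖ ≤ 20 * δ * ‖a - b‖ := by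
  have hδ0 : 0 ≤ δ := (norm_nonneg _).trans ha
  have ha1 : |‖a‖ - 1| ≤ δ := by rw [← he]; exact (abs_norm_sub_norm_le _ _).trans ha
  have hb1 : |‖b‖ - 1| ≤ δ := by rw [← he]; exact (abs_norm_sub_norm_le _ _).trans hb
  rw [abs_le] at ha1 hb1
  have hap : 0 < ‖a‖ := by linarith
  have hbp : 0 < ‖b‖ := by linarith
  set d := a - b with hd
  -- `m` is the vector with `⟨m, a - b⟩ = (‖a‖ - ‖b‖) / ‖a‖`, and it is close to `e`
  set κ := ((‖a‖ + ‖b‖) * ‖a‖)⁻¹ with hκ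
  have hκ0 : 0 < κ := by positivity
  have hκ2 : κ ≤ 2 := by
    rw [hκ, inv_le_comm₀ (by positivity) (by norm_num)]
    nlinarith
  have hκ1 : |2 * κ - 1| ≤ 10 * δ := by
    have h1 : 2 * κ - 1 = (2 - (‖a‖ + ‖b‖) * ‖a‖) * κ := by
      rw [hκ]; field_simp
    have h2 : |2 - (‖a‖ + ‖b‖) * ‖a‖| ≤ 5 * δ := by
      rw [abs_le]; constructor <;> nlinarith
    rw [h1, abs_mul, abs_of_pos hκ0]
    nlinarith [abs_nonneg (2 - (‖a‖ + ‖b‖) * ‖a‖)]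
  set m := κ • (a + b) with hmdef
  have hm : ‖e - m‖ ≤ 14 * δ := by
    have h1 : e - m = κ • ((e - a) + (e - b)) - (2 * κ - 1) • e := by
      rw [hmdef]; module
    rw [h1]
    refine (norm_sub_le _ _).trans ?_
    rw [norm_smul, norm_smul, he, mul_one, Real.norm_eq_abs, Real.norm_eq_abs, abs_of_pos hκ0]
    have h2 : ‖(e - a) + (e - b)‖ ≤ 2 * δ := by
      refine (norm_add_le _ _).trans ?_
      rw [norm_sub_rev e a, norm_sub_rev e b]; linarith
    nlinarith [norm_nonneg ((e - a) + (e - b))]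
  have hNb : ‖e - ‖b‖⁻¹ • b‖ ≤ 2 * δ := by
    have h1 : e - ‖b‖⁻¹ • b = (e - b) + (1 - ‖b‖⁻¹) • b := by module
    rw [h1]
    refine (norm_add_le _ _).trans ?_
    have h2 : ‖(1 - ‖b‖⁻¹) • b‖ = |‖b‖ - 1| := by
      rw [norm_smul, Real.norm_eq_abs, ← abs_of_pos hbp, ← abs_mul, abs_of_pos hbp, sub_mul,
        inv_mul_cancel₀ hbp.ne', one_mul]
    rw [h2, norm_sub_rev]
    have : |‖b‖ - 1| ≤ δ := abs_le.2 hb1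
    linarith
  have hNb1 : ‖‖b‖⁻¹ • b‖ = 1 := by
    rw [norm_smul, norm_inv, norm_norm, inv_mul_cancel₀ hbp.ne']
  have hinv : |‖a‖⁻¹ - 1| ≤ 2 * δ := by
    have h1 : ‖a‖⁻¹ - 1 = (1 - ‖a‖) * ‖a‖⁻¹ := by field_simp
    have h2 : ‖a‖⁻¹ ≤ 2 := by
      rw [inv_le_comm₀ hap (by norm_num)]; linarith
    have h3 : |1 - ‖a‖| ≤ δ := by rw [abs_le]; constructor <;> linarith
    rw [h1, abs_mul, abs_of_pos (inv_pos.2 hap)]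
    nlinarith [abs_nonneg (1 - ‖a‖), inv_pos.2 hap]
  have hmd : inner ℝ m d = (‖a‖ - ‖b‖) * ‖a‖⁻¹ := by
    have h1 : inner ℝ (a + b) d = ‖a‖ ^ 2 - ‖b‖ ^ 2 := by
      rw [hd, inner_add_left, inner_sub_right, inner_sub_right, real_inner_self_eq_norm_sq,
        real_inner_self_eq_norm_sq, real_inner_comm a b]; ring
    rw [hmdef, real_inner_smul_left, h1, hκ]
    field_simp
    ring
  have hid : ‖a‖⁻¹ • a - ‖b‖⁻¹ • b - (d - inner ℝ e d • e)
      = (‖a‖⁻¹ - 1) • d + (inner ℝ e d • (e - ‖b‖⁻¹ • b) + inner ℝ (e - m) d • (‖b‖⁻¹ • b)) := by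
    rw [inner_sub_left, hmd]
    have h2 : (‖a‖ - ‖b‖) * ‖a‖⁻¹ * ‖b‖⁻¹ = ‖b‖⁻¹ - ‖a‖⁻¹ := by field_simp
    have h3 : ((‖a‖ - ‖b‖) * ‖a‖⁻¹) • (‖b‖⁻¹ • b) = (‖b‖⁻¹ - ‖a‖⁻¹) • b := by
      rw [smul_smul, h2]
    rw [sub_smul (inner ℝ e d), h3, hd]
    module
  rw [hid]
  have i1 : |inner ℝ e d| ≤ ‖d‖ := by
    simpa [he] using abs_real_inner_le_norm e d
  have i2 : |inner ℝ (e - m) d| ≤ 14 * δ * ‖d‖ :=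
    (abs_real_inner_le_norm _ _).trans (mul_le_mul_of_nonneg_right hm (norm_nonneg _))
  have n1 : ‖(‖a‖⁻¹ - 1) • d‖ ≤ 2 * δ * ‖d‖ := by
    rw [norm_smul, Real.norm_eq_abs]
    exact mul_le_mul_of_nonneg_right hinv (norm_nonneg _)
  have n2 : ‖inner ℝ e d • (e - ‖b‖⁻¹ • b)‖ ≤ ‖d‖ * (2 * δ) := by
    rw [norm_smul, Real.norm_eq_abs]
    exact mul_le_mul i1 hNb (norm_nonneg _) (norm_nonneg _)
  have n3 : ‖inner ℝ (e - m) d • (‖b‖⁻¹ • b)‖ ≤ 14 * δ * ‖d‖ := by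
    rw [norm_smul, hNb1, mul_one, Real.norm_eq_abs]
    exact i2
  have := (norm_add_le ((‖a‖⁻¹ - 1) • d)
    (inner ℝ e d • (e - ‖b‖⁻¹ • b) + inner ℝ (e - m) d • (‖b‖⁻¹ • b))).trans
    (add_le_add n1 ((norm_add_le _ _).trans (add_le_add n2 n3)))
  nlinarith [mul_nonneg hδ0 (norm_nonneg d)]

end Normalize

/-! ### The nonlinear constraint -/

theorem integral_eq_zero_of_antiperiodic {V : Type*} [NormedAddCommGroup V] [NormedSpace ℝ V]
    {g : ℝ → V} (hg : Continuous g) (h : ∀ θ, g (θ + π) = -g θ) :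
    ∫ θ in (0 : ℝ)..(2 * π), g θ = 0 := by
  rw [← intervalIntegral.integral_add_adjacent_intervals (b := π) (hg.intervalIntegrable _ _)
    (hg.intervalIntegrable _ _)]
  have h1 : ∫ θ in π..(2 * π), g θ = ∫ θ in (0 : ℝ)..π, g (θ + π) := by
    rw [intervalIntegral.integral_comp_add_right]
    congr 1 <;> ring
  rw [h1]
  simp only [h, intervalIntegral.integral_neg]
  abel

/-- The space curve `θ ↦ cos θ A + sin θ B`, an ellipse if `A` and `B` are independent. -/
noncomputable def spaceEllipse (A B : E3) (θ : ℝ) : E3 := cos θ • A + sin θ • B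

theorem continuous_spaceEllipse (A B : E3) : Continuous (spaceEllipse A B) :=
  (continuous_cos.smul continuous_const).add (continuous_sin.smul continuous_const)

theorem spaceEllipse_add_pi (A B : E3) (θ : ℝ) :
    spaceEllipse A B (θ + π) = -spaceEllipse A B θ := by
  simp [spaceEllipse, cos_add_pi, sin_add_pi]; abel

theorem circ_eq_spaceEllipse (θ : ℝ) :
    circ θ = spaceEllipse (EuclideanSpace.single 0 1) (EuclideanSpace.single 1 1) θ := by
  ext i
  fin_cases i <;> simp [circ, spaceEllipse]

theorem modePart_circ (θ : ℝ) : modePart circ θ = circ θ := by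
  have hc : Continuous fun t => cos t • circ t := continuous_cos.smul continuous_circ
  have hs : Continuous fun t => sin t • circ t := continuous_sin.smul continuous_circ
  have e1 : ∀ i, (∫ t in (0 : ℝ)..(2 * π), cos t • circ t) i
      = ∫ t in (0 : ℝ)..(2 * π), cos t * circ t i := fun i =>
    ((EuclideanSpace.proj i : E3 →L[ℝ] ℝ).intervalIntegral_comp_comm
      (hc.intervalIntegrable 0 (2 * π))).symm
  have e2 : ∀ i, (∫ t in (0 : ℝ)..(2 * π), sin t • circ t) i
      = ∫ t in (0 : ℝ)..(2 * π), sin t * circ t i := fun i =>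
    ((EuclideanSpace.proj i : E3 →L[ℝ] ℝ).intervalIntegral_comp_comm
      (hs.intervalIntegrable 0 (2 * π))).symm
  have i1 : ∫ t in (0 : ℝ)..(2 * π), cos t * cos t = π := by
    simp only [← sq, integral_cos_sq]; simp
  have i2 : ∫ t in (0 : ℝ)..(2 * π), sin t * sin t = π := by
    simp only [← sq, integral_sin_sq]; simp
  have i3 : ∫ t in (0 : ℝ)..(2 * π), sin t * cos t = 0 := by
    rw [integral_sin_mul_cos₁]; simp
  have i4 : ∫ t in (0 : ℝ)..(2 * π), cos t * sin t = 0 := by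
    simp only [mul_comm (cos _), i3]
  have hpi := pi_ne_zero
  ext i
  rw [modePart]
  simp only [PiLp.add_apply, PiLp.smul_apply, e1, e2]
  fin_cases i <;> simp [circ, i1, i2, i3, i4, hpi]

theorem norm_modePart_sub_le {z : ℝ → E3} (hz : Continuous z) {ε : ℝ}
    (h : ∀ θ, ‖z θ - circ θ‖ ≤ ε) (θ : ℝ) : ‖modePart z θ - circ θ‖ ≤ 4 * ε := by
  have hε : 0 ≤ ε := (norm_nonneg _).trans (h 0)
  have key : ∀ c : ℝ → ℝ, Continuous c → (∀ t, |c t| ≤ 1) →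
      ‖((1 / π) • ∫ t in (0 : ℝ)..(2 * π), c t • z t)
        - (1 / π) • ∫ t in (0 : ℝ)..(2 * π), c t • circ t‖ ≤ 2 * ε := by
    intro c hc hc1
    have h1 : Continuous fun t => c t • z t := hc.smul hz
    have h2 : Continuous fun t => c t • circ t := hc.smul continuous_circ
    rw [← smul_sub, ← intervalIntegral.integral_sub (h1.intervalIntegrable _ _)
      (h2.intervalIntegrable _ _), norm_smul]
    have h3 := intervalIntegral.norm_integral_le_of_norm_le_const (a := 0) (b := 2 * π)
      (f := fun t => c t • z t - c t • circ t) (C := ε) (fun t _ => by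
        rw [← smul_sub, norm_smul, Real.norm_eq_abs]
        exact (mul_le_mul (hc1 t) (h t) (norm_nonneg _) zero_le_one).trans (by rw [one_mul]))
    rw [sub_zero, abs_of_pos two_pi_pos] at h3
    rw [norm_of_nonneg (by positivity), one_div, inv_mul_le_iff₀ pi_pos]
    linarith
  have k1 := key cos continuous_cos abs_cos_le_one
  have k2 := key sin continuous_sin abs_sin_le_one
  rw [← modePart_circ θ, modePart, modePart, add_sub_add_comm, ← smul_sub (cos θ),
    ← smul_sub (sin θ)]
  refine (norm_add_le _ _).trans ?_
  rw [norm_smul, norm_smul, Real.norm_eq_abs, Real.norm_eq_abs]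
  have a1 := mul_le_mul (abs_cos_le_one θ) k1 (norm_nonneg _) zero_le_one
  have a2 := mul_le_mul (abs_sin_le_one θ) k2 (norm_nonneg _) zero_le_one
  linarith

theorem poisson_le {q : ℝ} (hq0 : 0 ≤ q) (hq1 : q < 1) (θ : ℝ) :
    poisson q θ ≤ 2 / (1 - q) := by
  have h1 : 0 < 1 - q := by linarith
  rw [poisson, div_le_div_iff₀ (poisson_denom_pos hq0 hq1 θ) h1]
  have h2 : (1 - q) ^ 2 ≤ 1 - 2 * q * cos (2 * θ) + q ^ 2 := by
    nlinarith [mul_nonneg hq0 (sub_nonneg.2 (cos_le_one (2 * θ)))]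
  nlinarith

theorem tang_sub (e x y : E3) : tang e (x - y) = tang e x - tang e y := by
  rw [tang, tang, tang, inner_sub_right]; module

theorem ne_zero_of_near {a e : E3} {δ : ℝ} (he : ‖e‖ = 1) (hδ : δ ≤ 1 / 2) (h : ‖a - e‖ ≤ δ) :
    a ≠ 0 := by
  rintro rfl
  rw [zero_sub, norm_neg, he] at h
  linarith

theorem continuous_normalize {z : ℝ → E3} (hz : Continuous z) (h0 : ∀ θ, z θ ≠ 0) :
    Continuous fun θ => ‖z θ‖⁻¹ • z θ :=
  (hz.norm.inv₀ fun θ => norm_ne_zero_iff.2 (h0 θ)).smul hz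

/-- If the normalization of `z` has weighted mean zero, then `z` satisfies the linearized
constraint up to a quadratically small error. -/
theorem norm_linearized_constraint_le {q : ℝ} (hq0 : 0 ≤ q) (hq1 : q < 1) {z : ℝ → E3}
    (hz : Continuous z) {ε : ℝ} (hε : 4 * ε ≤ 1 / 2) (h : ∀ θ, ‖z θ - circ θ‖ ≤ ε)
    (hcon : ∫ θ in (0 : ℝ)..(2 * π), poisson q θ • (‖z θ‖⁻¹ • z θ) = 0) :
    ‖∫ θ in (0 : ℝ)..(2 * π), poisson q θ • tang (circ θ) (z θ)‖ ≤
      2 / (1 - q) * (80 * ε) * ∫ θ in (0 : ℝ)..(2 * π), ‖z θ - modePart z θ‖ := by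
  have hε0 : 0 ≤ ε := (norm_nonneg _).trans (h 0)
  set p := modePart z with hp
  have hpc : Continuous p := continuous_modePart z
  have hpn := norm_modePart_sub_le hz h
  have hpp : ∀ θ, p (θ + π) = -p θ := fun θ => spaceEllipse_add_pi _ _ θ
  have hz0 : ∀ θ, z θ ≠ 0 := fun θ => ne_zero_of_near (norm_circ θ) (by linarith) (h θ)
  have hp0 : ∀ θ, p θ ≠ 0 := fun θ => ne_zero_of_near (norm_circ θ) hε (hpn θ)
  have hP := continuous_poisson hq0 hq1
  have c1 : Continuous fun θ => poisson q θ • (‖z θ‖⁻¹ • z θ) :=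
    hP.smul (continuous_normalize hz hz0)
  have c2 : Continuous fun θ => poisson q θ • (‖p θ‖⁻¹ • p θ) :=
    hP.smul (continuous_normalize hpc hp0)
  have c3 : Continuous fun θ => poisson q θ • tang (circ θ) (z θ) :=
    hP.smul (continuous_tang hz)
  have c4 : Continuous fun θ => poisson q θ • tang (circ θ) (p θ) :=
    hP.smul (continuous_tang hpc)
  have z2 := integral_eq_zero_of_antiperiodic c2 fun θ => by
    rw [poisson_add_pi, hpp, norm_neg]; simp only [smul_neg]
  have z4 := integral_eq_zero_of_antiperiodic c4 fun θ => by
    rw [poisson_add_pi, hpp, circ_add_pi, tang, tang, inner_neg_neg]; module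
  have e : ∫ θ in (0 : ℝ)..(2 * π), poisson q θ • tang (circ θ) (z θ)
      = -∫ θ in (0 : ℝ)..(2 * π), poisson q θ • (‖z θ‖⁻¹ • z θ - ‖p θ‖⁻¹ • p θ
          - ((z θ - p θ) - inner ℝ (circ θ) (z θ - p θ) • circ θ)) := by
    have e1 : ∀ θ, poisson q θ • (‖z θ‖⁻¹ • z θ - ‖p θ‖⁻¹ • p θ
          - ((z θ - p θ) - inner ℝ (circ θ) (z θ - p θ) • circ θ))
        = (poisson q θ • (‖z θ‖⁻¹ • z θ) - poisson q θ • (‖p θ‖⁻¹ • p θ))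
          - (poisson q θ • tang (circ θ) (z θ) - poisson q θ • tang (circ θ) (p θ)) := fun θ => by
      rw [← smul_sub (poisson q θ) (tang _ _), ← tang_sub, tang, smul_sub, smul_sub]
    have c12 : Continuous fun θ =>
      poisson q θ • (‖z θ‖⁻¹ • z θ) - poisson q θ • (‖p θ‖⁻¹ • p θ) := c1.sub c2
    have c34 : Continuous fun θ =>
      poisson q θ • tang (circ θ) (z θ) - poisson q θ • tang (circ θ) (p θ) := c3.sub c4
    simp only [e1]
    rw [intervalIntegral.integral_sub (c12.intervalIntegrable _ _)
      (c34.intervalIntegrable _ _), intervalIntegral.integral_sub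
      (c1.intervalIntegrable _ _) (c2.intervalIntegrable _ _), intervalIntegral.integral_sub
      (c3.intervalIntegrable _ _) (c4.intervalIntegrable _ _), hcon, z2, z4]
    simp
  rw [e, norm_neg, ← intervalIntegral.integral_const_mul]
  refine intervalIntegral.norm_integral_le_of_norm_le two_pi_pos.le (ae_of_all _ fun θ _ => ?_)
    ((continuous_const.mul (hz.sub hpc).norm).intervalIntegrable _ _)
  rw [norm_smul, norm_of_nonneg (poisson_pos hq0 hq1 θ).le, mul_assoc]
  refine mul_le_mul (poisson_le hq0 hq1 θ) ?_ (norm_nonneg _) (by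
    have : 0 < 1 - q := by linarith
    positivity)
  have := norm_normalize_sub_sub_le (norm_circ θ) hε ((h θ).trans (by linarith)) (hpn θ)
  refine this.trans (le_of_eq (by ring))

/-- The local inequality near the unit circle: under the nonlinear constraint that the
normalization of `z` has weighted mean zero, `∫ |z'|² - |z|²` is bounded below by the squared
distance of `z` to its Fourier modes `±1`. -/
theorem local_gap {q : ℝ} (hq0 : 0 ≤ q) (hq1 : q < 1) :
    ∃ ε : ℝ, 0 < ε ∧ 4 * ε ≤ 1 / 2 ∧ ∀ z z' : ℝ → E3, H1Pair z z' →
      (∀ θ, ‖z θ - circ θ‖ ≤ ε) →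
      ∫ θ in (0 : ℝ)..(2 * π), poisson q θ • (‖z θ‖⁻¹ • z θ) = 0 →
      (1 - q ^ 2) / 32 * (∫ θ in (0 : ℝ)..(2 * π), ‖z θ - modePart z θ‖ ^ 2) ≤
        (∫ θ in (0 : ℝ)..(2 * π), ‖z' θ‖ ^ 2) - ∫ θ in (0 : ℝ)..(2 * π), ‖z θ‖ ^ 2 := by
  have h1q : 0 < 1 - q := by linarith
  have h1q2 : 0 < 1 - q ^ 2 := by nlinarith
  set K : ℝ := 4 * gapConst q * ((2 / (1 - q) * 80) ^ 2 * (2 * π)) with hK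
  have hK0 : 0 ≤ K := by
    rw [hK, gapConst]; positivity
  -- the error term `K ε²` is absorbed by half of the gap
  obtain ⟨ε, hε0, hε1, hε2⟩ : ∃ ε : ℝ, 0 < ε ∧ 4 * ε ≤ 1 / 2 ∧ K * ε ^ 2 ≤ (1 - q ^ 2) / 32 := by
    refine ⟨min (1 / 8) ((1 - q ^ 2) / 32 / (K + 1)), by positivity, ?_, ?_⟩
    · linarith [min_le_left (1 / 8) ((1 - q ^ 2) / 32 / (K + 1))]
    · set m := min (1 / 8) ((1 - q ^ 2) / 32 / (K + 1)) with hm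
      have m0 : 0 ≤ m := by positivity
      have m1 : m ≤ 1 := (min_le_left _ _).trans (by norm_num)
      have m2 : m ≤ (1 - q ^ 2) / 32 / (K + 1) := min_le_right _ _
      rw [le_div_iff₀ (by positivity)] at m2
      nlinarith [mul_nonneg hK0 m0]
  refine ⟨ε, hε0, hε1, fun z z' hz hnear hcon => ?_⟩
  have hL := norm_linearized_constraint_le hq0 hq1 hz.continuous hε1 hnear hcon
  have hc : Continuous fun θ => ‖z θ - modePart z θ‖ :=
    (hz.continuous.sub (continuous_modePart z)).norm
  have hcs := sq_integral_le (hc.intervalIntegrable _ _) ((hc.pow 2).intervalIntegrable _ _)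
  have hgap := gap hq0 hq1 hz
  set D := ∫ θ in (0 : ℝ)..(2 * π), ‖z θ - modePart z θ‖ ^ 2
  have hD : 0 ≤ D := intervalIntegral.integral_nonneg two_pi_pos.le fun x _ => sq_nonneg _
  have hL2 := pow_le_pow_left₀ (norm_nonneg _) hL 2
  have hg0 : 0 ≤ 4 * gapConst q := by rw [gapConst]; positivity
  have h5 : 4 * gapConst q *
      ‖∫ θ in (0 : ℝ)..(2 * π), poisson q θ • tang (circ θ) (z θ)‖ ^ 2 ≤ K * ε ^ 2 * D := by
    refine (mul_le_mul_of_nonneg_left hL2 hg0).trans ?_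
    rw [mul_pow]
    have h6 := mul_le_mul_of_nonneg_left hcs (sq_nonneg (2 / (1 - q) * (80 * ε)))
    refine (mul_le_mul_of_nonneg_left h6 hg0).trans (le_of_eq ?_)
    rw [hK]; ring
  have h7 := mul_le_mul_of_nonneg_right hε2 hD
  linarith

/-! ### Vector fields near the unit circle -/

/-- The derivative of `circ`. -/
noncomputable def circDeriv (θ : ℝ) : E3 := !₂[-sin θ, cos θ, 0]

theorem hasDerivAt_circ (θ : ℝ) : HasDerivAt circ (circDeriv θ) θ := by
  have h : circ = fun θ => cos θ • (EuclideanSpace.single 0 1 : E3)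
      + sin θ • (EuclideanSpace.single 1 1 : E3) := funext fun θ => circ_eq_spaceEllipse θ
  have h' : circDeriv θ = (-sin θ) • (EuclideanSpace.single 0 1 : E3)
      + cos θ • (EuclideanSpace.single 1 1 : E3) := by
    ext i; fin_cases i <;> simp [circDeriv]
  rw [h, h']
  exact ((hasDerivAt_cos θ).smul_const _).add ((hasDerivAt_sin θ).smul_const _)

theorem continuous_circDeriv : Continuous circDeriv := by
  unfold circDeriv
  exact (PiLp.continuous_toLp 2 _).comp (continuous_pi fun i => by fin_cases i <;> simp <;> fun_prop)

theorem norm_circDeriv (θ : ℝ) : ‖circDeriv θ‖ = 1 := by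
  have : ‖circDeriv θ‖ ^ 2 = 1 := by
    rw [EuclideanSpace.real_norm_sq_eq, Fin.sum_univ_three]
    simp [circDeriv]
  nlinarith [norm_nonneg (circDeriv θ)]

theorem h1Pair_circ : H1Pair circ circDeriv :=
  H1Pair.of_hasDerivAt (fun θ => by simp [circ]) hasDerivAt_circ continuous_circDeriv

theorem H1Pair.norm_sub_sq_le {W : Type*} [NormedAddCommGroup W] [NormedSpace ℝ W] {f f' : ℝ → W}
    (h : H1Pair f f') (x y : ℝ) :
    ‖f x - f y‖ ^ 2 ≤ 2 * π * ∫ t in (0 : ℝ)..(2 * π), ‖f' t‖ ^ 2 := by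
  obtain ⟨x', hx', ex⟩ := h.periodic.exists_mem_Ico₀ two_pi_pos x
  obtain ⟨y', hy', ey⟩ := h.periodic.exists_mem_Ico₀ two_pi_pos y
  rw [ex, ey, ← h.integral]
  have h1 : ‖∫ t in y'..x', f' t‖ ≤ |∫ t in (0 : ℝ)..(2 * π), ‖f' t‖| := by
    refine intervalIntegral.norm_integral_le_abs_integral_norm.trans ?_
    refine intervalIntegral.abs_integral_mono_interval ?_ (ae_of_all _ fun t => norm_nonneg _)
      (h.intervalIntegrable _ _).norm
    rw [uIoc_of_le two_pi_pos.le]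
    exact Ioc_subset_Ioc (le_min hy'.1 hx'.1) (max_le hy'.2.le hx'.2.le)
  have h2 := sq_integral_le (h.intervalIntegrable 0 (2 * π)).norm (h.sq_intervalIntegrable _ _)
  refine (pow_le_pow_left₀ (norm_nonneg _) h1 2).trans ?_
  rwa [sq_abs]

theorem norm_sq_product_deriv {v v' : E3} (hv : ‖v‖ = 1) (ho : inner ℝ v v' = 0) (a b : ℝ) :
    ‖b • v + a • v'‖ ^ 2 = b ^ 2 + a ^ 2 * ‖v'‖ ^ 2 := by
  rw [norm_add_sq_real, norm_smul, norm_smul, real_inner_smul_left, real_inner_smul_right, ho, hv,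
    mul_pow, mul_pow, Real.norm_eq_abs, Real.norm_eq_abs, sq_abs, sq_abs]
  ring

/-- Functions of almost minimal energy are almost constant: if the unit vector field `V` is
`H¹`-close to the unit circle, then the energy controls `∫ f'²`. -/
theorem integral_sq_deriv_le {V V' : ℝ → E3} (hV : H1Pair V V') (hV1 : ∀ θ, ‖V θ‖ = 1)
    (hVo : ∀ θ, inner ℝ (V θ) (V' θ) = 0) {δ : ℝ} (hδ0 : 0 ≤ δ) (hδ1 : δ ≤ 1)
    (hd : ∫ θ in (0 : ℝ)..(2 * π), ‖V' θ - circDeriv θ‖ ^ 2 ≤ δ ^ 2)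
    {f f' : ℝ → ℝ} (hf : H1Pair f f') (hf1 : ∀ θ, |f θ| ≤ 1) :
    ∫ θ in (0 : ℝ)..(2 * π), f' θ ^ 2 ≤
      ((∫ θ in (0 : ℝ)..(2 * π), ‖f' θ • V θ + f θ • V' θ‖ ^ 2)
        - ∫ θ in (0 : ℝ)..(2 * π), ‖f θ • V θ‖ ^ 2) + 7 * δ := by
  have hz := hf.smul hV
  have hw := hV.sub h1Pair_circ
  set s : ℝ → ℝ := fun θ => ‖V' θ - circDeriv θ‖ with hs
  have hsi : IntervalIntegrable s volume 0 (2 * π) := (hw.intervalIntegrable _ _).norm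
  have hs2 : IntervalIntegrable (fun θ => s θ ^ 2) volume 0 (2 * π) := hw.sq_intervalIntegrable _ _
  have hz1 : IntervalIntegrable (fun θ => ‖f θ • V θ‖ ^ 2) volume 0 (2 * π) :=
    (hz.continuous.norm.pow 2).intervalIntegrable _ _
  have hz2 := hz.sq_intervalIntegrable 0 (2 * π)
  have hf2 : IntervalIntegrable (fun θ => f' θ ^ 2) volume 0 (2 * π) := by
    simpa only [Real.norm_eq_abs, sq_abs] using hf.sq_intervalIntegrable 0 (2 * π)
  have hpt : ∀ θ, f' θ ^ 2 ≤ (‖f' θ • V θ + f θ • V' θ‖ ^ 2 - ‖f θ • V θ‖ ^ 2)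
      + (s θ ^ 2 + 2 * s θ) := fun θ => by
    rw [norm_sq_product_deriv (hV1 θ) (hVo θ), norm_smul, hV1, mul_one, Real.norm_eq_abs, sq_abs]
    have h1 : 1 - s θ ≤ ‖V' θ‖ := by
      have := norm_sub_norm_le (circDeriv θ) (V' θ)
      rw [norm_circDeriv, norm_sub_rev] at this
      linarith
    have h2 : 1 - ‖V' θ‖ ^ 2 ≤ s θ ^ 2 + 2 * s θ := by
      have h3 : 0 ≤ s θ := norm_nonneg _
      rcases le_total (s θ) 1 with h4 | h4
      · nlinarith [norm_nonneg (V' θ)]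
      · nlinarith [sq_nonneg ‖V' θ‖]
    have h3 : 0 ≤ s θ ^ 2 + 2 * s θ := by
      have : 0 ≤ s θ := norm_nonneg _
      positivity
    have h4 : f θ ^ 2 ≤ 1 := by rw [← sq_abs]; exact pow_le_one₀ (abs_nonneg _) (hf1 θ)
    nlinarith [mul_le_mul_of_nonneg_left h2 (sq_nonneg (f θ))]
  have hmono := intervalIntegral.integral_mono two_pi_pos.le hf2
    ((hz2.sub hz1).add (hs2.add (hsi.const_mul 2))) hpt
  rw [intervalIntegral.integral_add (hz2.sub hz1) (hs2.add (hsi.const_mul 2)),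
    intervalIntegral.integral_sub hz2 hz1, intervalIntegral.integral_add hs2 (hsi.const_mul 2),
    intervalIntegral.integral_const_mul] at hmono
  have hcs := sq_integral_le hsi hs2
  have hs0 : 0 ≤ ∫ θ in (0 : ℝ)..(2 * π), s θ :=
    intervalIntegral.integral_nonneg two_pi_pos.le fun θ _ => norm_nonneg _
  have h3 : ∫ θ in (0 : ℝ)..(2 * π), s θ ≤ 3 * δ := by
    refine (le_abs_self _).trans (abs_le_of_sq_le_sq ?_ (by positivity))
    nlinarith [pi_lt_d2, mul_le_mul_of_nonneg_left hd two_pi_pos.le, sq_nonneg δ]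
  nlinarith

/-- The local estimate on the circle: a function of almost minimal energy, with maximum `1`, has
energy at least a multiple of the squared distance of `V` to a normalized ellipse. -/
theorem local_estimate {q : ℝ} (hq0 : 0 ≤ q) (hq1 : q < 1) :
    ∃ δ : ℝ, 0 < δ ∧ ∃ c : ℝ, 0 < c ∧ ∀ V V' : ℝ → E3, H1Pair V V' →
      (∀ θ, ‖V θ‖ = 1) → (∀ θ, inner ℝ (V θ) (V' θ) = 0) →
      ∫ θ in (0 : ℝ)..(2 * π), poisson q θ • V θ = 0 →
      (∀ θ, ‖V θ - circ θ‖ ≤ δ) →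
      ∫ θ in (0 : ℝ)..(2 * π), ‖V' θ - circDeriv θ‖ ^ 2 ≤ δ ^ 2 →
      ∀ f f' : ℝ → ℝ, H1Pair f f' → ∀ θ₀, f θ₀ = 1 → (∀ θ, |f θ| ≤ 1) →
      (∫ θ in (0 : ℝ)..(2 * π), ‖f' θ • V θ + f θ • V' θ‖ ^ 2)
        - (∫ θ in (0 : ℝ)..(2 * π), ‖f θ • V θ‖ ^ 2) ≤ δ →
      ∃ A B : E3, (∀ θ, ‖spaceEllipse A B θ - circ θ‖ ≤ 1 / 2) ∧
        c * (∫ θ in (0 : ℝ)..(2 * π),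
          ‖V θ - ‖spaceEllipse A B θ‖⁻¹ • spaceEllipse A B θ‖ ^ 2) ≤
        (∫ θ in (0 : ℝ)..(2 * π), ‖f' θ • V θ + f θ • V' θ‖ ^ 2)
        - ∫ θ in (0 : ℝ)..(2 * π), ‖f θ • V θ‖ ^ 2 := by
  obtain ⟨ε, hε0, hε1, H⟩ := local_gap hq0 hq1
  have h1q2 : 0 < 1 - q ^ 2 := by nlinarith
  -- `‖f - 1‖² ≤ 2 π ∫ f'² ≤ 16 π δ`, which has to be at most `(ε / 2)²`
  set δ := ε ^ 2 / 256 with hδ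
  have hδε : δ ≤ ε / 2 := by rw [hδ]; nlinarith
  have hδ1 : δ ≤ 1 := by linarith
  refine ⟨δ, by positivity, (1 - q ^ 2) / 32 / 144, by positivity, ?_⟩
  intro V V' hV hV1 hVo hcon hnear hd f f' hf θ₀ hθ₀ hf1 hE
  have hδ0 : 0 ≤ δ := by positivity
  have hfd := integral_sq_deriv_le hV hV1 hVo hδ0 hδ1 hd hf hf1
  have hf1' : ∀ θ, |f θ - 1| ≤ ε / 2 := fun θ => by
    have h1 := hf.norm_sub_sq_le θ θ₀
    simp only [hθ₀, Real.norm_eq_abs, sq_abs] at h1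
    refine abs_le_of_sq_le_sq (h1.trans ?_) (by positivity)
    have h2 : ∫ θ in (0 : ℝ)..(2 * π), f' θ ^ 2 ≤ 8 * δ := by linarith
    have h3 := mul_le_mul_of_nonneg_left h2 two_pi_pos.le
    rw [hδ] at h3
    nlinarith [pi_lt_d2, sq_nonneg ε]
  have hzn : ∀ θ, ‖f θ • V θ - circ θ‖ ≤ ε := fun θ => by
    have e : f θ • V θ - circ θ = (f θ - 1) • V θ + (V θ - circ θ) := by module
    rw [e]
    refine (norm_add_le _ _).trans ?_
    rw [norm_smul, hV1, mul_one, Real.norm_eq_abs]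
    linarith [hf1' θ, hnear θ]
  have hfp : ∀ θ, 0 < f θ := fun θ => by
    have := abs_le.1 (hf1' θ); linarith
  have hN : ∀ θ, ‖f θ • V θ‖⁻¹ • (f θ • V θ) = V θ := fun θ => by
    rw [norm_smul, hV1, mul_one, norm_of_nonneg (hfp θ).le, smul_smul,
      inv_mul_cancel₀ (hfp θ).ne', one_smul]
  have hz := hf.smul hV
  have key := H _ _ hz hzn (by simpa only [hN] using hcon)
  set p := modePart fun θ => f θ • V θ with hp
  have hpn : ∀ θ, ‖p θ - circ θ‖ ≤ 4 * ε := norm_modePart_sub_le hz.continuous hzn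
  have hp0 : ∀ θ, p θ ≠ 0 := fun θ => ne_zero_of_near (norm_circ θ) hε1 (hpn θ)
  have hpc : Continuous p := continuous_modePart _
  refine ⟨_, _, fun θ => (hpn θ).trans hε1, ?_⟩
  change (1 - q ^ 2) / 32 / 144 * (∫ θ in (0 : ℝ)..(2 * π), ‖V θ - ‖p θ‖⁻¹ • p θ‖ ^ 2) ≤ _
  refine le_trans ?_ key
  have hle : ∫ θ in (0 : ℝ)..(2 * π), ‖V θ - ‖p θ‖⁻¹ • p θ‖ ^ 2 ≤
      ∫ θ in (0 : ℝ)..(2 * π), 144 * ‖f θ • V θ - p θ‖ ^ 2 := by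
    refine intervalIntegral.integral_mono two_pi_pos.le
      (((hV.continuous.sub (continuous_normalize hpc hp0)).norm.pow 2).intervalIntegrable _ _)
      ((continuous_const.mul ((hz.continuous.sub hpc).norm.pow 2)).intervalIntegrable _ _)
      fun θ => ?_
    have h1 := norm_normalize_sub_sub_le (norm_circ θ) hε1 ((hzn θ).trans (by linarith)) (hpn θ)
    rw [hN] at h1
    set d := f θ • V θ - p θ with hdd
    have h2 : ‖d - inner ℝ (circ θ) d • circ θ‖ ≤ 2 * ‖d‖ := by
      refine (norm_sub_le _ _).trans ?_
      rw [norm_smul, norm_circ, mul_one, Real.norm_eq_abs]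
      have := abs_real_inner_le_norm (circ θ) d
      rw [norm_circ, one_mul] at this
      linarith
    have h3 : ‖V θ - ‖p θ‖⁻¹ • p θ‖ ≤ 12 * ‖d‖ := by
      have h4 := norm_sub_norm_le (V θ - ‖p θ‖⁻¹ • p θ) (d - inner ℝ (circ θ) d • circ θ)
      have h5 : 20 * (4 * ε) * ‖d‖ ≤ 10 * ‖d‖ :=
        mul_le_mul_of_nonneg_right (by linarith) (norm_nonneg _)
      linarith
    calc ‖V θ - ‖p θ‖⁻¹ • p θ‖ ^ 2 ≤ (12 * ‖d‖) ^ 2 := pow_le_pow_left₀ (norm_nonneg _) h3 2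
      _ = 144 * ‖d‖ ^ 2 := by ring
  rw [intervalIntegral.integral_const_mul] at hle
  have := mul_le_mul_of_nonneg_left hle (show 0 ≤ (1 - q ^ 2) / 32 / 144 by positivity)
  linarith

/-! ### Arclength as a function of the angle -/

/-- The arclength parameter `s = σ(θ)` as a function of the angle `θ`: up to a positive factor
`(cos σ, β sin σ)` is `(cos θ, sin θ)`, if `q = (1 - β) / (1 + β)`. -/
noncomputable def angleParam (q θ : ℝ) : ℝ := ∫ t in (0 : ℝ)..θ, poisson q t

section AngleParam

variable {q : ℝ}

theorem hasDerivAt_angleParam (hq0 : 0 ≤ q) (hq1 : q < 1) (θ : ℝ) :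
    HasDerivAt (angleParam q) (poisson q θ) θ :=
  (continuous_poisson hq0 hq1).integral_hasStrictDerivAt 0 θ |>.hasDerivAt

theorem continuous_angleParam (hq0 : 0 ≤ q) (hq1 : q < 1) : Continuous (angleParam q) :=
  continuous_iff_continuousAt.2 fun θ => (hasDerivAt_angleParam hq0 hq1 θ).continuousAt

theorem strictMono_angleParam (hq0 : 0 ≤ q) (hq1 : q < 1) : StrictMono (angleParam q) :=
  strictMono_of_hasDerivAt_pos (hasDerivAt_angleParam hq0 hq1) fun θ => poisson_pos hq0 hq1 θ

theorem integral_poisson (hq0 : 0 ≤ q) (hq1 : q < 1) :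
    ∫ θ in (0 : ℝ)..(2 * π), poisson q θ = 2 * π := by
  have hc1 : Continuous fun _ : ℝ => (1 : ℂ) := continuous_const
  have h := hasSum_coeff_geom_mul hq0 hq1 hc1
  have hcoe : ∀ n : ℤ, coeff (fun _ => 1) n = if n = 0 then 1 else 0 := fun n => by
    have : (fun _ : ℝ => (1 : ℂ)) = char 0 := by funext θ; rw [char_zero]
    rw [this, coeff_char]
  have h1 : coeff (fun θ => geom q θ * 1) 0 = 1 := by
    refine h.unique ?_
    convert! hasSum_single (f := fun k : ℕ => (q : ℂ) ^ k * coeff (fun _ => 1) (-(2 * k))) 0 ?_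
    · simp [hcoe]
    · intro k hk
      rw [hcoe, if_neg (by omega), mul_zero]
  simp only [mul_one] at h1
  have hg := continuous_geom hq0 hq1
  have hgc : Continuous fun θ => (starRingEnd ℂ) (geom q θ) := Complex.continuous_conj.comp hg
  have hga : Continuous fun θ => geom q θ + (starRingEnd ℂ) (geom q θ) := hg.add hgc
  have h2 : coeff (fun θ => (poisson q θ : ℂ)) 0 = 1 := by
    have e : (fun θ => (poisson q θ : ℂ)) = fun θ => (geom q θ + (starRingEnd ℂ) (geom q θ)) - 1 := by
      funext θ; rw [poisson_eq_add hq0 hq1]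
    have h1' : coeff (geom q) 0 = 1 := h1
    rw [e, coeff_sub hga hc1, coeff_add hg hgc, coeff_conj, neg_zero, h1', hcoe]
    simp
  simp only [coeff, neg_zero, char_zero, one_mul, intervalIntegral.integral_ofReal,
    Complex.real_smul, ← Complex.ofReal_mul] at h2
  have h3 : 1 / (2 * π) * ∫ θ in (0 : ℝ)..(2 * π), poisson q θ = 1 := by exact_mod_cast h2
  field_simp at h3
  linarith

theorem angleParam_zero : angleParam q 0 = 0 := by simp [angleParam]

theorem poisson_periodic (q : ℝ) : Function.Periodic (poisson q) (2 * π) := fun θ => by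
  rw [two_mul, ← add_assoc, poisson_add_pi, poisson_add_pi]

theorem angleParam_add_two_pi (hq0 : 0 ≤ q) (hq1 : q < 1) (θ : ℝ) :
    angleParam q (θ + 2 * π) = angleParam q θ + 2 * π := by
  have hP := continuous_poisson hq0 hq1
  rw [angleParam, ← intervalIntegral.integral_add_adjacent_intervals (b := θ)
    (hP.intervalIntegrable _ _) (hP.intervalIntegrable _ _),
    (poisson_periodic q).intervalIntegral_add_eq θ 0, zero_add, integral_poisson hq0 hq1, angleParam]

theorem surjective_angleParam (hq0 : 0 ≤ q) (hq1 : q < 1) :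
    Function.Surjective (angleParam q) := by
  have hper : Function.Periodic (fun θ => angleParam q θ - θ) (2 * π) := fun θ => by
    simp only [angleParam_add_two_pi hq0 hq1]; ring
  have hn : ∀ n : ℤ, angleParam q (n * (2 * π)) = n * (2 * π) := fun n => by
    have := hper.int_mul_eq n
    simp only [angleParam_zero, sub_zero] at this
    linarith
  intro y
  obtain ⟨n, hn1, hn2⟩ : ∃ n : ℤ, n * (2 * π) ≤ y ∧ y ≤ (n + 1 : ℤ) * (2 * π) := by
    refine ⟨⌊y / (2 * π)⌋, ?_, ?_⟩
    · rw [← le_div_iff₀ two_pi_pos]; exact Int.floor_le _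
    · rw [← div_le_iff₀ two_pi_pos]; push_cast; exact (Int.lt_floor_add_one _).le
  rw [← hn] at hn1 hn2
  have hle : (n : ℝ) * (2 * π) ≤ (n + 1 : ℤ) * (2 * π) := by
    push_cast; nlinarith [two_pi_pos]
  obtain ⟨θ, -, hθ⟩ := intermediate_value_Icc hle (continuous_angleParam hq0 hq1).continuousOn
    ⟨hn1, hn2⟩
  exact ⟨θ, hθ⟩

variable {W : Type*} [NormedAddCommGroup W] [NormedSpace ℝ W]

theorem image_angleParam_Ioc (hq0 : 0 ≤ q) (hq1 : q < 1) (a b : ℝ) :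
    angleParam q '' Ioc a b = Ioc (angleParam q a) (angleParam q b) :=
  ((strictMono_angleParam hq0 hq1).orderIsoOfSurjective _
    (surjective_angleParam hq0 hq1)).image_Ioc a b

theorem intervalIntegral_comp_angleParam (hq0 : 0 ≤ q) (hq1 : q < 1) (g : ℝ → W) (a b : ℝ) :
    ∫ θ in a..b, poisson q θ • g (angleParam q θ)
      = ∫ s in angleParam q a..angleParam q b, g s := by
  have hmono := strictMono_angleParam hq0 hq1
  have main : ∀ a b, a ≤ b → ∫ θ in a..b, poisson q θ • g (angleParam q θ)
      = ∫ s in angleParam q a..angleParam q b, g s := fun a b hab => by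
    rw [intervalIntegral.integral_of_le hab, intervalIntegral.integral_of_le (hmono.monotone hab),
      ← image_angleParam_Ioc hq0 hq1, integral_image_eq_integral_abs_deriv_smul measurableSet_Ioc
      (fun x _ => (hasDerivAt_angleParam hq0 hq1 x).hasDerivWithinAt) hmono.injective.injOn]
    simp only [abs_of_pos (poisson_pos hq0 hq1 _)]
  rcases le_total a b with h | h
  · exact main a b h
  · rw [intervalIntegral.integral_symm, main b a h, intervalIntegral.integral_symm, neg_neg]

theorem integral_period_comp_angleParam (hq0 : 0 ≤ q) (hq1 : q < 1) (g : ℝ → W) :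
    ∫ θ in (0 : ℝ)..(2 * π), poisson q θ • g (angleParam q θ)
      = ∫ s in (0 : ℝ)..(2 * π), g s := by
  have := angleParam_add_two_pi hq0 hq1 0
  rw [intervalIntegral_comp_angleParam hq0 hq1, angleParam_zero]
  rw [zero_add, angleParam_zero, zero_add] at this
  rw [this]

theorem intervalIntegrable_comp_angleParam (hq0 : 0 ≤ q) (hq1 : q < 1) {g : ℝ → W}
    (hg : ∀ a b, IntervalIntegrable g volume a b) (a b : ℝ) :
    IntervalIntegrable (fun θ => poisson q θ • g (angleParam q θ)) volume a b := by
  have hmono := strictMono_angleParam hq0 hq1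
  have main : ∀ a b, a ≤ b →
      IntervalIntegrable (fun θ => poisson q θ • g (angleParam q θ)) volume a b := fun a b hab => by
    have h := hg (angleParam q a) (angleParam q b)
    rw [intervalIntegrable_iff_integrableOn_Ioc_of_le (hmono.monotone hab),
      ← image_angleParam_Ioc hq0 hq1, integrableOn_image_iff_integrableOn_abs_deriv_smul
      measurableSet_Ioc (fun x _ => (hasDerivAt_angleParam hq0 hq1 x).hasDerivWithinAt)
      hmono.injective.injOn] at h
    rw [intervalIntegrable_iff_integrableOn_Ioc_of_le hab]
    simpa only [abs_of_pos (poisson_pos hq0 hq1 _)] using h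
  rcases le_total a b with h | h
  · exact main a b h
  · exact (main b a h).symm

theorem H1Pair.sq_comp_angleParam_intervalIntegrable (hq0 : 0 ≤ q) (hq1 : q < 1) {f f' : ℝ → W}
    (h : H1Pair f f') (a b : ℝ) :
    IntervalIntegrable (fun θ => poisson q θ * ‖f' (angleParam q θ)‖ ^ 2) volume a b :=
  intervalIntegrable_comp_angleParam hq0 hq1 (fun a b => h.sq_intervalIntegrable a b) a b

theorem norm_sq_poisson_smul (hq0 : 0 ≤ q) (hq1 : q < 1) (θ : ℝ) (w : W) :
    ‖poisson q θ • w‖ ^ 2 = poisson q θ * (poisson q θ * ‖w‖ ^ 2) := by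
  rw [norm_smul, norm_of_nonneg (poisson_pos hq0 hq1 θ).le]; ring

/-- The change of variables `s = σ(θ)` in `H¹`. -/
theorem H1Pair.comp_angleParam (hq0 : 0 ≤ q) (hq1 : q < 1) {f f' : ℝ → W} (h : H1Pair f f') :
    H1Pair (fun θ => f (angleParam q θ)) (fun θ => poisson q θ • f' (angleParam q θ)) where
  periodic := fun θ => by simp only [angleParam_add_two_pi hq0 hq1, h.periodic (angleParam q θ)]
  periodic' := fun θ => by
    simp only [angleParam_add_two_pi hq0 hq1, h.periodic' (angleParam q θ), poisson_periodic q θ]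
  memLp := by
    have hi := intervalIntegrable_comp_angleParam hq0 hq1 (fun a b => h.intervalIntegrable a b)
    refine memLp_of_sq (locallyIntegrable_of_intervalIntegrable hi).aestronglyMeasurable ?_
    simp only [norm_sq_poisson_smul hq0 hq1]
    exact (h.sq_comp_angleParam_intervalIntegrable hq0 hq1 _ _).continuousOn_mul
      (continuous_poisson hq0 hq1).continuousOn
  integral := fun a b => by
    rw [intervalIntegral_comp_angleParam hq0 hq1, h.integral]

theorem H1Pair.integral_sq_comp_angleParam_le (hq0 : 0 ≤ q) (hq1 : q < 1) {f f' : ℝ → W}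
    (h : H1Pair f f') :
    ∫ θ in (0 : ℝ)..(2 * π), ‖poisson q θ • f' (angleParam q θ)‖ ^ 2 ≤
      2 / (1 - q) * ∫ s in (0 : ℝ)..(2 * π), ‖f' s‖ ^ 2 := by
  rw [← integral_period_comp_angleParam hq0 hq1 fun s => ‖f' s‖ ^ 2,
    ← intervalIntegral.integral_const_mul]
  refine intervalIntegral.integral_mono two_pi_pos.le
    ((h.comp_angleParam hq0 hq1).sq_intervalIntegrable _ _)
    ((h.sq_comp_angleParam_intervalIntegrable hq0 hq1 _ _).const_mul _) fun θ => ?_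
  rw [norm_sq_poisson_smul hq0 hq1]
  exact mul_le_mul_of_nonneg_right (poisson_le hq0 hq1 θ)
    (mul_nonneg (poisson_pos hq0 hq1 θ).le (sq_nonneg _))

end AngleParam

section Radius

variable {β : ℝ}

/-- The square of `angleRadius`. -/
noncomputable def angleRadiusSq (β θ : ℝ) : ℝ := cos θ ^ 2 + sin θ ^ 2 / β ^ 2

/-- The factor `η` in `η (cos σ, β sin σ) = (cos θ, sin θ)`. -/
noncomputable def angleRadius (β θ : ℝ) : ℝ := √(angleRadiusSq β θ)

/-- Half of the derivative of `angleRadiusSq`. -/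
noncomputable def angleRadiusMoment (β θ : ℝ) : ℝ := (1 / β ^ 2 - 1) * (sin θ * cos θ)

theorem angleRadiusSq_pos (hβ : 0 < β) (θ : ℝ) : 0 < angleRadiusSq β θ := by
  rw [angleRadiusSq]
  by_cases h : cos θ = 0
  · have : sin θ ^ 2 = 1 := by have := sin_sq_add_cos_sq θ; rw [h] at this; linarith
    rw [this]; positivity
  · positivity

theorem angleRadius_pos (hβ : 0 < β) (θ : ℝ) : 0 < angleRadius β θ :=
  Real.sqrt_pos.2 (angleRadiusSq_pos hβ θ)

theorem sq_angleRadius (hβ : 0 < β) (θ : ℝ) : angleRadius β θ ^ 2 = angleRadiusSq β θ :=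
  Real.sq_sqrt (angleRadiusSq_pos hβ θ).le

theorem hasDerivAt_angleRadius (hβ : 0 < β) (θ : ℝ) :
    HasDerivAt (angleRadius β) (angleRadiusMoment β θ / angleRadius β θ) θ := by
  have h1 : HasDerivAt (angleRadiusSq β) (2 * angleRadiusMoment β θ) θ := by
    have := ((hasDerivAt_cos θ).pow 2).add (((hasDerivAt_sin θ).pow 2).div_const (β ^ 2))
    convert! this using 1
    rw [angleRadiusMoment]
    simp
    field_simp
    ring
  have h2 := h1.sqrt (angleRadiusSq_pos hβ θ).ne'
  convert! h2 using 1
  rw [angleRadius]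
  field_simp

theorem continuous_angleRadius (hβ : 0 < β) : Continuous (angleRadius β) :=
  continuous_iff_continuousAt.2 fun θ => (hasDerivAt_angleRadius hβ θ).continuousAt

theorem h1Pair_angleRadius (hβ : 0 < β) :
    H1Pair (angleRadius β) (fun θ => angleRadiusMoment β θ / angleRadius β θ) :=
  H1Pair.of_hasDerivAt (fun θ => by simp [angleRadius, angleRadiusSq]) (hasDerivAt_angleRadius hβ)
    (Continuous.div (by unfold angleRadiusMoment; fun_prop) (continuous_angleRadius hβ)
      fun θ => (angleRadius_pos hβ θ).ne')

theorem h1Pair_angleRadiusMoment (β : ℝ) :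
    H1Pair (angleRadiusMoment β) (fun θ => (1 / β ^ 2 - 1) * (cos θ ^ 2 - sin θ ^ 2)) :=
  H1Pair.of_hasDerivAt (fun θ => by simp [angleRadiusMoment])
    (fun θ => by
      have := ((hasDerivAt_sin θ).mul (hasDerivAt_cos θ)).const_mul (1 / β ^ 2 - 1)
      convert! this using 1
      ring)
    (by fun_prop)

/-- The parameter of the Poisson kernel that belongs to the ratio `β` of the axes. -/
noncomputable def eccParam (β : ℝ) : ℝ := (1 - β) / (1 + β)

theorem eccParam_nonneg (hβ : 0 < β) (hβ1 : β ≤ 1) : 0 ≤ eccParam β :=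
  div_nonneg (by linarith) (by linarith)

theorem eccParam_lt_one (hβ : 0 < β) : eccParam β < 1 := by
  rw [eccParam, div_lt_one (by linarith)]; linarith

theorem poisson_eccParam (hβ : 0 < β) (hβ1 : β ≤ 1) (θ : ℝ) :
    poisson (eccParam β) θ = 1 / (β * angleRadiusSq β θ) := by
  have h1 := poisson_denom_pos (eccParam_nonneg hβ hβ1) (eccParam_lt_one hβ) θ
  have h2 := angleRadiusSq_pos hβ θ
  have h3 : 1 - 2 * eccParam β * cos (2 * θ) + eccParam β ^ 2
      = 4 * β ^ 2 / (1 + β) ^ 2 * angleRadiusSq β θ := by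
    rw [eccParam, angleRadiusSq, cos_two_mul]
    have := sin_sq_add_cos_sq θ
    have hs : sin θ ^ 2 = 1 - cos θ ^ 2 := by linarith
    rw [hs]
    field_simp
    ring
  have h4 : 1 - eccParam β ^ 2 = 4 * β / (1 + β) ^ 2 := by
    rw [eccParam]; field_simp; ring
  rw [poisson, h3, h4]
  field_simp

end Radius

/-! ### Invariance of the energy -/

section Unfold

variable {β : ℝ}

/-- Polar coordinates of `cos θ + i sin θ / β`. The angle is identified by differentiating
`(cos θ + i sin θ / β) exp (-i σ(θ)) / η(θ)`, which turns out to be constant. -/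
theorem angleParam_exp (hβ : 0 < β) (hβ1 : β ≤ 1) (θ : ℝ) :
    (cos θ + (sin θ / β : ℝ) * Complex.I : ℂ) =
      angleRadius β θ * Complex.exp (angleParam (eccParam β) θ * Complex.I) := by
  have hq0 := eccParam_nonneg hβ hβ1
  have hq1 := eccParam_lt_one hβ
  set σ := angleParam (eccParam β) with hσ
  set G : ℝ → ℂ := fun θ => (cos θ + (sin θ / β : ℝ) * Complex.I : ℂ) *
    Complex.exp (-(σ θ * Complex.I)) * ((angleRadius β θ)⁻¹ : ℝ) with hG
  have hd : ∀ θ, HasDerivAt G 0 θ := fun θ => by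
    have h1 : HasDerivAt (fun θ : ℝ => (cos θ + (sin θ / β : ℝ) * Complex.I : ℂ))
        ((-sin θ : ℝ) + (cos θ / β : ℝ) * Complex.I : ℂ) θ :=
      (hasDerivAt_cos θ).ofReal_comp.add
        ((((hasDerivAt_sin θ).div_const β).ofReal_comp).mul_const Complex.I)
    have h2 : HasDerivAt (fun θ : ℝ => Complex.exp (-(σ θ * Complex.I)))
        (Complex.exp (-(σ θ * Complex.I)) * -((poisson (eccParam β) θ : ℝ) * Complex.I)) θ :=
      (((hasDerivAt_angleParam hq0 hq1 θ).ofReal_comp.mul_const Complex.I).neg).cexp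
    have h3 : HasDerivAt (fun θ => (((angleRadius β θ)⁻¹ : ℝ) : ℂ))
        ((-(angleRadiusMoment β θ / angleRadius β θ) / angleRadius β θ ^ 2 : ℝ) : ℂ) θ :=
      ((hasDerivAt_angleRadius hβ θ).inv (angleRadius_pos hβ θ).ne').ofReal_comp
    have h := (h1.mul h2).mul h3
    convert! h using 1
    have hη : (angleRadius β θ : ℂ) ≠ 0 := by exact_mod_cast (angleRadius_pos hβ θ).ne'
    have hβ' : (β : ℂ) ≠ 0 := by exact_mod_cast hβ.ne'
    have hw : (angleRadius β θ : ℂ) ^ 2 = (cos θ : ℂ) ^ 2 + (sin θ : ℂ) ^ 2 / (β : ℂ) ^ 2 := by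
      exact_mod_cast (sq_angleRadius hβ θ).trans rfl
    have hP : (poisson (eccParam β) θ : ℂ) = 1 / (β * (angleRadius β θ : ℂ) ^ 2) := by
      rw [poisson_eccParam hβ hβ1, ← sq_angleRadius hβ]; push_cast; rfl
    have hcs : (sin θ : ℂ) ^ 2 + (cos θ : ℂ) ^ 2 = 1 := by exact_mod_cast sin_sq_add_cos_sq θ
    have hw' : (angleRadius β θ : ℂ) ^ 2 * (β : ℂ) ^ 2
        = (cos θ : ℂ) ^ 2 * (β : ℂ) ^ 2 + (sin θ : ℂ) ^ 2 := by
      rw [hw]; field_simp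
    simp only [Pi.mul_apply, hP, angleRadiusMoment]
    push_cast
    set C := Complex.exp (-(σ θ * Complex.I))
    simp only [← Complex.ofReal_cos, ← Complex.ofReal_sin]
    set c : ℂ := Complex.ofReal (cos θ)
    set s : ℂ := Complex.ofReal (sin θ)
    set η : ℂ := Complex.ofReal (angleRadius β θ)
    set b : ℂ := Complex.ofReal (β)
    field_simp
    linear_combination (-C * (-s * b + c * Complex.I)) * hw'
      - C * (-b * s + Complex.I * c * b ^ 2) * hcs + C * b * s * Complex.I_sq
  have hconst : ∀ x y, G x = G y := is_const_of_deriv_eq_zero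
    (fun x => (hd x).differentiableAt) fun x => (hd x).deriv
  have h0 : G θ = 1 := by
    rw [hconst θ 0, hG]
    simp [hσ, angleParam_zero, angleRadius, angleRadiusSq]
  have hη : (angleRadius β θ : ℂ) ≠ 0 := by exact_mod_cast (angleRadius_pos hβ θ).ne'
  rw [hG] at h0
  simp only at h0
  rw [Complex.exp_neg, Complex.ofReal_inv] at h0
  field_simp at h0
  rw [h0, mul_comm, mul_comm Complex.I]

theorem cos_angleParam (hβ : 0 < β) (hβ1 : β ≤ 1) (θ : ℝ) :
    angleRadius β θ * cos (angleParam (eccParam β) θ) = cos θ := by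
  have h := congrArg Complex.re (angleParam_exp hβ hβ1 θ)
  rw [Complex.re_ofReal_mul, Complex.exp_ofReal_mul_I_re] at h
  simpa only [Complex.add_re, Complex.ofReal_re, Complex.mul_re, Complex.I_re, mul_zero,
    Complex.ofReal_im, zero_mul, sub_zero, add_zero] using h.symm

theorem sin_angleParam (hβ : 0 < β) (hβ1 : β ≤ 1) (θ : ℝ) :
    angleRadius β θ * (β * sin (angleParam (eccParam β) θ)) = sin θ := by
  have h := congrArg Complex.im (angleParam_exp hβ hβ1 θ)
  rw [Complex.im_ofReal_mul, Complex.exp_ofReal_mul_I_im] at h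
  have h2 : sin θ / β = angleRadius β θ * sin (angleParam (eccParam β) θ) := by
    simpa only [Complex.add_im, Complex.ofReal_im, Complex.mul_im, Complex.I_im, mul_one,
      Complex.ofReal_re, Complex.I_re, mul_zero, zero_add, add_zero] using h
  rw [mul_left_comm, ← h2]
  field_simp

theorem ellipse_angleParam (hβ : 0 < β) (hβ1 : β ≤ 1) (θ : ℝ) :
    angleRadius β θ • ellipse β (angleParam (eccParam β) θ) = circ θ := by
  ext i
  fin_cases i
  · simpa [ellipse, circ] using cos_angleParam hβ hβ1 θ
  · simpa [ellipse, circ] using sin_angleParam hβ hβ1 θ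
  · simp [ellipse, circ]

theorem H1Pair.norm_sq {f f' : ℝ → E3} (h : H1Pair f f') :
    H1Pair (fun x => ‖f x‖ ^ 2) (fun x => 2 * inner ℝ (f x) (f' x)) := by
  have hc : ∀ i : Fin 3, H1Pair (fun x => f x i) (fun x => f' x i) := fun i =>
    h.clm (EuclideanSpace.proj i : E3 →L[ℝ] ℝ)
  have hs := fun i => (hc i).smul (hc i)
  have := ((hs 0).add (hs 1)).add (hs 2)
  have e1 : ∀ x, ‖f x‖ ^ 2 = f x 0 • f x 0 + f x 1 • f x 1 + f x 2 • f x 2 := fun x => by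
    rw [EuclideanSpace.real_norm_sq_eq, Fin.sum_univ_three]
    simp only [smul_eq_mul]; ring
  have e2 : ∀ x, 2 * inner ℝ (f x) (f' x) = f' x 0 • f x 0 + f x 0 • f' x 0 +
      (f' x 1 • f x 1 + f x 1 • f' x 1) + (f' x 2 • f x 2 + f x 2 • f' x 2) := fun x => by
    simp only [PiLp.inner_apply, Fin.sum_univ_three, smul_eq_mul, RCLike.inner_apply, conj_trivial]
    ring
  simp only [e1, e2]
  exact this

/-- The form `∫ |X'|² - |X|²` is invariant, up to the factor `β`, under the projective change of
variables `X(σ(θ)) = Z(θ) / η(θ)`. -/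
theorem energy_unfold (hβ : 0 < β) (hβ1 : β ≤ 1) {X X' : ℝ → E3} (h : H1Pair X X') :
    (∫ s in (0 : ℝ)..(2 * π), ‖X' s‖ ^ 2) - (∫ s in (0 : ℝ)..(2 * π), ‖X s‖ ^ 2) =
      β * ((∫ θ in (0 : ℝ)..(2 * π),
        ‖(angleRadiusMoment β θ / angleRadius β θ) • X (angleParam (eccParam β) θ)
          + angleRadius β θ • poisson (eccParam β) θ • X' (angleParam (eccParam β) θ)‖ ^ 2)
        - ∫ θ in (0 : ℝ)..(2 * π),
          ‖angleRadius β θ • X (angleParam (eccParam β) θ)‖ ^ 2) := by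
  have hq0 := eccParam_nonneg hβ hβ1
  have hq1 := eccParam_lt_one hβ
  have hY := h.comp_angleParam hq0 hq1
  have hZ := (h1Pair_angleRadius hβ).smul hY
  have hK := (h1Pair_angleRadiusMoment β).smul hY.norm_sq
  have hXc : IntervalIntegrable (fun s => ‖X s‖ ^ 2) volume 0 (2 * π) :=
    (h.continuous.norm.pow 2).intervalIntegrable _ _
  have hZc : IntervalIntegrable (fun θ => ‖angleRadius β θ • X (angleParam (eccParam β) θ)‖ ^ 2)
    volume 0 (2 * π) := (hZ.continuous.norm.pow 2).intervalIntegrable _ _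
  rw [← intervalIntegral.integral_sub (h.sq_intervalIntegrable _ _) hXc,
    ← intervalIntegral.integral_sub (hZ.sq_intervalIntegrable _ _) hZc,
    ← integral_period_comp_angleParam hq0 hq1]
  have h0 := hK.integral_period
  have hmain := intervalIntegral.integral_sub ((hZ.sq_intervalIntegrable 0 (2 * π)).sub hZc)
    (hK.intervalIntegrable 0 (2 * π))
  rw [h0, sub_zero] at hmain
  rw [← hmain, ← intervalIntegral.integral_const_mul]
  -- up to the factor `β` the two integrands differ by the derivative of
  -- `angleRadiusMoment * ‖X ∘ σ‖ ^ 2`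
  refine intervalIntegral.integral_congr fun θ _ => ?_
  have hη := angleRadius_pos hβ θ
  have hw := sq_angleRadius hβ θ
  set σ := angleParam (eccParam β) θ
  set Y := X σ
  set P := poisson (eccParam β) θ with hP
  have hP2 : P = 1 / (β * angleRadius β θ ^ 2) := by rw [hP, poisson_eccParam hβ hβ1, hw]
  set η := angleRadius β θ
  simp only [smul_eq_mul]
  rw [norm_add_sq_real, norm_smul, norm_smul, norm_smul, norm_smul, real_inner_smul_left,
    real_inner_smul_right, real_inner_smul_right]
  simp only [mul_pow, Real.norm_eq_abs, sq_abs]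
  rw [hP2]
  have key : β ^ 2 * (angleRadiusMoment β θ ^ 2 - (η ^ 2) ^ 2
      - (1 / β ^ 2 - 1) * (cos θ ^ 2 - sin θ ^ 2) * η ^ 2) = -1 := by
    rw [hw, angleRadiusSq, angleRadiusMoment]
    have hs : sin θ ^ 2 = 1 - cos θ ^ 2 := by have := sin_sq_add_cos_sq θ; linarith
    rw [mul_pow, mul_pow, hs]
    field_simp
    ring
  set M := angleRadiusMoment β θ
  set k' := (1 / β ^ 2 - 1) * (cos θ ^ 2 - sin θ ^ 2)
  set I := inner ℝ Y (X' σ)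
  field_simp
  linear_combination (-‖Y‖ ^ 2) * key

end Unfold

/-! ### The local estimate in the arclength variable -/

/-- The unit tangent of the planar loop with parameter `β`. -/
noncomputable def ellipseTangent (β s : ℝ) : E3 := ‖ellipse β s‖⁻¹ • ellipse β s

section EllipseTangent

variable {β : ℝ}

theorem ellipse_ne_zero (hβ : 0 < β) (s : ℝ) : ellipse β s ≠ 0 := by
  intro h
  have h0 : cos s = 0 := by simpa [ellipse] using congrArg (fun x : E3 => x 0) h
  have h1 : β = 0 ∨ sin s = 0 := by simpa [ellipse] using congrArg (fun x : E3 => x 1) h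
  have := sin_sq_add_cos_sq s
  rw [h0, h1.resolve_left hβ.ne'] at this
  norm_num at this

theorem ellipse_eq_spaceEllipse (β s : ℝ) :
    ellipse β s = spaceEllipse (EuclideanSpace.single 0 1) (EuclideanSpace.single 1 β) s := by
  ext i
  fin_cases i <;> simp [ellipse, spaceEllipse, mul_comm]

theorem contDiff_ellipse (β : ℝ) : ContDiff ℝ 1 (ellipse β) := by
  have : ellipse β = fun s => cos s • (EuclideanSpace.single 0 1 : E3)
      + sin s • (EuclideanSpace.single 1 β : E3) := funext fun s => ellipse_eq_spaceEllipse β s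
  rw [this]
  exact (contDiff_cos.smul contDiff_const).add (contDiff_sin.smul contDiff_const)

theorem contDiff_norm_ellipse (hβ : 0 < β) : ContDiff ℝ 1 fun s => ‖ellipse β s‖ :=
  (contDiff_ellipse β).norm ℝ fun s => ellipse_ne_zero hβ s

theorem contDiff_ellipseTangent (hβ : 0 < β) : ContDiff ℝ 1 (ellipseTangent β) :=
  ((contDiff_norm_ellipse hβ).inv fun s => norm_ne_zero_iff.2 (ellipse_ne_zero hβ s)).smul
    (contDiff_ellipse β)

theorem norm_ellipseTangent (hβ : 0 < β) (s : ℝ) : ‖ellipseTangent β s‖ = 1 := by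
  rw [ellipseTangent, norm_smul, norm_inv, norm_norm,
    inv_mul_cancel₀ (norm_ne_zero_iff.2 (ellipse_ne_zero hβ s))]

theorem ellipse_periodic (β : ℝ) : Function.Periodic (ellipse β) (2 * π) := fun s => by
  simp [ellipse]

theorem h1Pair_ellipseTangent (hβ : 0 < β) :
    H1Pair (ellipseTangent β) (deriv (ellipseTangent β)) :=
  H1Pair.of_hasDerivAt (fun s => by simp only [ellipseTangent, ellipse_periodic β s])
    (fun s => ((contDiff_ellipseTangent hβ).differentiable (by norm_num) s).hasDerivAt)
    ((contDiff_ellipseTangent hβ).continuous_deriv (by norm_num))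

theorem ellipseTangent_angleParam (hβ : 0 < β) (hβ1 : β ≤ 1) (θ : ℝ) :
    ellipseTangent β (angleParam (eccParam β) θ) = circ θ := by
  have h := ellipse_angleParam hβ hβ1 θ
  have hη := angleRadius_pos hβ θ
  have h1 : angleRadius β θ * ‖ellipse β (angleParam (eccParam β) θ)‖ = 1 := by
    rw [← norm_circ θ, ← h, norm_smul, norm_of_nonneg hη.le]
  rw [ellipseTangent, ← eq_inv_of_mul_eq_one_left h1]
  exact h

theorem deriv_ellipseTangent_angleParam (hβ : 0 < β) (hβ1 : β ≤ 1) (θ : ℝ) :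
    poisson (eccParam β) θ • deriv (ellipseTangent β) (angleParam (eccParam β) θ)
      = circDeriv θ := by
  have h1 := ((contDiff_ellipseTangent hβ).differentiable (by norm_num)
    (angleParam (eccParam β) θ)).hasDerivAt.scomp θ
    (hasDerivAt_angleParam (eccParam_nonneg hβ hβ1) (eccParam_lt_one hβ) θ)
  have h2 : ellipseTangent β ∘ angleParam (eccParam β) = circ :=
    funext fun θ => ellipseTangent_angleParam hβ hβ1 θ
  rw [h2] at h1
  exact h1.unique (hasDerivAt_circ θ)

theorem one_le_angleRadius (hβ : 0 < β) (hβ1 : β ≤ 1) (θ : ℝ) : 1 ≤ angleRadius β θ := by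
  rw [angleRadius, Real.one_le_sqrt, angleRadiusSq, ← sin_sq_add_cos_sq θ, add_comm]
  have h1 : β ^ 2 ≤ 1 := pow_le_one₀ hβ.le hβ1
  have h2 : sin θ ^ 2 ≤ sin θ ^ 2 / β ^ 2 := by
    rw [le_div_iff₀ (by positivity)]
    exact mul_le_of_le_one_right (sq_nonneg _) h1
  linarith

end EllipseTangent

/-- A nonzero continuous periodic function can be rescaled so that its maximum is `1` and is
an upper bound of its absolute value. -/
theorem exists_normalized {f : ℝ → ℝ} (hc : Continuous f) (hp : Function.Periodic f (2 * π))
    (h0 : ∃ x, f x ≠ 0) : ∃ t x₀ : ℝ, t ≠ 0 ∧ t * f x₀ = 1 ∧ ∀ x, |t * f x| ≤ 1 := by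
  obtain ⟨x₀, -, hx₀⟩ := isCompact_Icc.exists_isMaxOn (s := Icc 0 (2 * π))
    ⟨0, le_rfl, two_pi_pos.le⟩ hc.abs.continuousOn
  have hmax : ∀ x, |f x| ≤ |f x₀| := fun x => by
    obtain ⟨y, hy, e⟩ := hp.exists_mem_Ico₀ two_pi_pos x
    rw [e]
    exact hx₀ (Ico_subset_Icc_self hy)
  obtain ⟨x, hx⟩ := h0
  have hne : f x₀ ≠ 0 := fun h => by
    have := hmax x
    rw [h, abs_zero] at this
    exact hx (abs_nonpos_iff.1 this)
  refine ⟨(f x₀)⁻¹, x₀, inv_ne_zero hne, inv_mul_cancel₀ hne, fun x => ?_⟩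
  rw [abs_mul, abs_inv, inv_mul_le_iff₀ (abs_pos.2 hne), mul_one]
  exact hmax x

/-- The energy of `Φ` with respect to the unit vector field `U`, in the angle variable. -/
theorem energy_unfold_smul {β : ℝ} (hβ : 0 < β) (hβ1 : β ≤ 1) {U U' : ℝ → E3} (hU : H1Pair U U')
    {Φ Φ' : ℝ → ℝ} (hΦ : H1Pair Φ Φ') :
    (∫ s in (0 : ℝ)..(2 * π), ‖Φ' s • U s + Φ s • U' s‖ ^ 2)
        - (∫ s in (0 : ℝ)..(2 * π), ‖Φ s • U s‖ ^ 2) =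
      β * ((∫ θ in (0 : ℝ)..(2 * π),
        ‖((angleRadiusMoment β θ / angleRadius β θ) • Φ (angleParam (eccParam β) θ)
          + angleRadius β θ • poisson (eccParam β) θ • Φ' (angleParam (eccParam β) θ)) •
            U (angleParam (eccParam β) θ) +
          (angleRadius β θ • Φ (angleParam (eccParam β) θ)) •
            (poisson (eccParam β) θ • U' (angleParam (eccParam β) θ))‖ ^ 2)
        - ∫ θ in (0 : ℝ)..(2 * π), ‖(angleRadius β θ • Φ (angleParam (eccParam β) θ)) •
            U (angleParam (eccParam β) θ)‖ ^ 2) := by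
  rw [energy_unfold hβ hβ1 (hΦ.smul hU)]
  congr 2
  · congr 1; funext θ; congr 2
    simp only [smul_eq_mul]; module
  · congr 1; funext θ; congr 2
    simp only [smul_eq_mul]; module

/-- The local estimate in the arclength variable. The factor `t` rescales `Φ` so that its transform
to the angle variable has maximum `1`, as `local_estimate` requires. -/
theorem local_estimate_arclength {β : ℝ} (hβ : 0 < β) (hβ1 : β ≤ 1) :
    ∃ δ : ℝ, 0 < δ ∧ ∃ c : ℝ, 0 < c ∧ ∀ U U' : ℝ → E3, H1Pair U U' →
      (∀ s, ‖U s‖ = 1) → (∀ s, inner ℝ (U s) (U' s) = 0) →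
      ∫ s in (0 : ℝ)..(2 * π), U s = 0 →
      (∀ s, ‖U s - ellipseTangent β s‖ ≤ δ) →
      ∫ s in (0 : ℝ)..(2 * π), ‖U' s - deriv (ellipseTangent β) s‖ ^ 2 ≤ δ ^ 2 →
      ∀ Φ Φ' : ℝ → ℝ, H1Pair Φ Φ' → Φ ≠ 0 →
      (∫ s in (0 : ℝ)..(2 * π), ‖Φ' s • U s + Φ s • U' s‖ ^ 2)
        - (∫ s in (0 : ℝ)..(2 * π), ‖Φ s • U s‖ ^ 2) ≤
          δ * ∫ s in (0 : ℝ)..(2 * π), ‖Φ s • U s‖ ^ 2 →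
      ∃ A B : E3, (∀ θ, ‖spaceEllipse A B θ - circ θ‖ ≤ 1 / 2) ∧ ∃ t : ℝ, t ≠ 0 ∧
        c * (∫ θ in (0 : ℝ)..(2 * π),
          ‖U (angleParam (eccParam β) θ) - ‖spaceEllipse A B θ‖⁻¹ • spaceEllipse A B θ‖ ^ 2) ≤
        t ^ 2 * ((∫ s in (0 : ℝ)..(2 * π), ‖Φ' s • U s + Φ s • U' s‖ ^ 2)
          - ∫ s in (0 : ℝ)..(2 * π), ‖Φ s • U s‖ ^ 2) ∧
        t ^ 2 * (∫ s in (0 : ℝ)..(2 * π), ‖Φ s • U s‖ ^ 2) ≤ 2 * π := by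
  have hq0 := eccParam_nonneg hβ hβ1
  have hq1 := eccParam_lt_one hβ
  have hq1' : 0 < 1 - eccParam β := by linarith
  obtain ⟨δ, hδ, c, hc, H⟩ := local_estimate hq0 hq1
  set R := 2 / (1 - eccParam β) with hR
  have hR0 : 0 < R := by positivity
  obtain ⟨δ', hδ'0, hδ'1, hδ'2, hδ'3⟩ : ∃ δ' : ℝ, 0 < δ' ∧ δ' ≤ δ ∧ R * δ' ^ 2 ≤ δ ^ 2 ∧
      2 * π * δ' ≤ β * δ := by
    refine ⟨min (min 1 (δ / (R + 1))) (min (δ / 2) (min δ (β * δ / (2 * π)))), by positivity,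
      (min_le_right _ _).trans ((min_le_right _ _).trans (min_le_left _ _)), ?_, ?_⟩
    · set m := min (min 1 (δ / (R + 1))) (min (δ / 2) (min δ (β * δ / (2 * π)))) with hm
      have m0 : 0 < m := by positivity
      have m2 : m ≤ δ / (R + 1) := (min_le_left _ _).trans (min_le_right _ _)
      have m3 : m ≤ δ :=
        (min_le_right _ _).trans ((min_le_right _ _).trans (min_le_left _ _))
      rw [le_div_iff₀ (by positivity)] at m2
      nlinarith
    · have : min (min 1 (δ / (R + 1))) (min (δ / 2) (min δ (β * δ / (2 * π))))
        ≤ β * δ / (2 * π) :=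
        (min_le_right _ _).trans ((min_le_right _ _).trans (min_le_right _ _))
      rw [le_div_iff₀ two_pi_pos] at this
      linarith
  refine ⟨δ', hδ'0, β * c, by positivity, ?_⟩
  intro U U' hU hU1 hUo hUm hUn hUd Φ Φ' hΦ hΦ0 hE
  set σ := angleParam (eccParam β) with hσ
  have hΦσ := (h1Pair_angleRadius hβ).smul (hΦ.comp_angleParam hq0 hq1)
  obtain ⟨t, θ₀, ht, ht1, ht2⟩ := exists_normalized hΦσ.continuous hΦσ.periodic (by
    obtain ⟨s, hs⟩ := Function.ne_iff.1 hΦ0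
    obtain ⟨θ, hθ⟩ := surjective_angleParam hq0 hq1 s
    refine ⟨θ, ?_⟩
    rw [hθ]
    exact smul_ne_zero (angleRadius_pos hβ θ).ne' hs)
  have hsq : ∫ s in (0 : ℝ)..(2 * π), ‖Φ s • U s‖ ^ 2 = ∫ s in (0 : ℝ)..(2 * π), Φ s ^ 2 := by
    simp only [norm_smul, hU1, mul_one, Real.norm_eq_abs, sq_abs]
  have hΦle : ∀ s, (t * Φ s) ^ 2 ≤ 1 := fun s => by
    obtain ⟨θ, rfl⟩ := surjective_angleParam hq0 hq1 s
    have h1 := ht2 θ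
    rw [smul_eq_mul, mul_left_comm, abs_mul, abs_of_pos (angleRadius_pos hβ θ)] at h1
    have h2 : |t * Φ (angleParam (eccParam β) θ)| ≤ 1 :=
      (le_mul_of_one_le_left (abs_nonneg _) (one_le_angleRadius hβ hβ1 θ)).trans h1
    rw [← sq_abs]
    exact pow_le_one₀ (abs_nonneg _) h2
  have hN : t ^ 2 * (∫ s in (0 : ℝ)..(2 * π), ‖Φ s • U s‖ ^ 2) ≤ 2 * π := by
    rw [hsq, ← intervalIntegral.integral_const_mul]
    have : ∫ s in (0 : ℝ)..(2 * π), t ^ 2 * Φ s ^ 2 ≤ ∫ s in (0 : ℝ)..(2 * π), (1 : ℝ) :=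
      intervalIntegral.integral_mono two_pi_pos.le
        ((continuous_const.mul (hΦ.continuous.pow 2)).intervalIntegrable _ _) (by simp)
        fun s => by rw [← mul_pow]; exact hΦle s
    simpa using this
  have hV := hU.comp_angleParam hq0 hq1
  have hcon : ∫ θ in (0 : ℝ)..(2 * π), poisson (eccParam β) θ • U (angleParam (eccParam β) θ) = 0 := by
    rw [integral_period_comp_angleParam hq0 hq1, hUm]
  have hnear : ∀ θ, ‖U (angleParam (eccParam β) θ) - circ θ‖ ≤ δ := fun θ => by
    rw [← ellipseTangent_angleParam hβ hβ1 θ]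
    exact (hUn _).trans hδ'1
  have hd : ∫ θ in (0 : ℝ)..(2 * π), ‖poisson (eccParam β) θ • U' (angleParam (eccParam β) θ)
      - circDeriv θ‖ ^ 2 ≤ δ ^ 2 := by
    have h1 := (hU.sub (h1Pair_ellipseTangent hβ)).integral_sq_comp_angleParam_le hq0 hq1
    simp only [smul_sub, deriv_ellipseTangent_angleParam hβ hβ1] at h1
    exact h1.trans ((mul_le_mul_of_nonneg_left hUd hR0.le).trans hδ'2)
  have hun := energy_unfold_smul hβ hβ1 hU hΦ
  set E := (∫ s in (0 : ℝ)..(2 * π), ‖Φ' s • U s + Φ s • U' s‖ ^ 2)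
        - ∫ s in (0 : ℝ)..(2 * π), ‖Φ s • U s‖ ^ 2 with hEdef
  have hscale : (∫ θ in (0 : ℝ)..(2 * π),
        ‖(t • ((angleRadiusMoment β θ / angleRadius β θ) • Φ (angleParam (eccParam β) θ)
          + angleRadius β θ • poisson (eccParam β) θ • Φ' (angleParam (eccParam β) θ))) •
            U (angleParam (eccParam β) θ) +
          (t • angleRadius β θ • Φ (angleParam (eccParam β) θ)) •
            (poisson (eccParam β) θ • U' (angleParam (eccParam β) θ))‖ ^ 2)
        - ∫ θ in (0 : ℝ)..(2 * π), ‖(t • angleRadius β θ • Φ (angleParam (eccParam β) θ)) •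
            U (angleParam (eccParam β) θ)‖ ^ 2 = t ^ 2 * E / β := by
    rw [hun]
    have e : ∀ r : ℝ, t ^ 2 * (β * r) / β = t ^ 2 * r := fun r => by field_simp
    rw [e, mul_sub, ← intervalIntegral.integral_const_mul, ← intervalIntegral.integral_const_mul]
    congr 1
    · congr 1; funext θ
      rw [smul_assoc, smul_assoc t, ← smul_add, norm_smul, mul_pow, Real.norm_eq_abs, sq_abs]
    · congr 1; funext θ
      rw [smul_assoc t, norm_smul t, mul_pow, Real.norm_eq_abs, sq_abs]
  have hE1 : t ^ 2 * E / β ≤ δ := by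
    rw [div_le_iff₀ hβ]
    have h1 := mul_le_mul_of_nonneg_left hE (sq_nonneg t)
    have h2 := mul_le_mul_of_nonneg_left hN hδ'0.le
    linarith
  obtain ⟨A, B, hAB, hle⟩ := H _ _ hV (fun θ => hU1 _)
    (fun θ => by rw [real_inner_smul_right, hUo, mul_zero]) hcon hnear hd _ _
    (hΦσ.const_smul t) θ₀ ht1 ht2 (hscale.le.trans hE1)
  refine ⟨A, B, hAB, t, ht, ?_, hN⟩
  rw [hscale, le_div_iff₀ hβ] at hle
  linarith

/-! ### Rigidity -/

/-- The ellipses near the unit circle form a compact family. -/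
theorem isCompact_spaceEllipse_near_circ :
    IsCompact {x : E3 × E3 | ∀ θ, ‖spaceEllipse x.1 x.2 θ - circ θ‖ ≤ 1 / 2} := by
  have hcl : IsClosed {x : E3 × E3 | ∀ θ, ‖spaceEllipse x.1 x.2 θ - circ θ‖ ≤ 1 / 2} := by
    rw [ofPred_forall]
    refine isClosed_iInter fun θ => ?_
    have h1 : Continuous fun x : E3 × E3 => spaceEllipse x.1 x.2 θ :=
      (continuous_fst.const_smul (cos θ)).add (continuous_snd.const_smul (sin θ))
    have h2 : Continuous fun x : E3 × E3 => ‖spaceEllipse x.1 x.2 θ - circ θ‖ :=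
      (h1.sub continuous_const).norm
    exact isClosed_le h2 continuous_const
  refine ((isCompact_closedBall (circ 0) (1 / 2)).prod
    (isCompact_closedBall (circ (π / 2)) (1 / 2))).of_isClosed_subset hcl fun x hx => ?_
  have h1 := hx 0
  have h2 := hx (π / 2)
  simp only [spaceEllipse, cos_zero, sin_zero, one_smul, zero_smul, add_zero, cos_pi_div_two,
    sin_pi_div_two, zero_add] at h1 h2
  exact ⟨mem_closedBall_iff_norm.2 h1, mem_closedBall_iff_norm.2 h2⟩

/-- A field that is approximated arbitrarily well by normalizations of ellipses near the unit
circle is one of them. -/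
theorem exists_eq_normalized_spaceEllipse {V : ℝ → E3} (hV : Continuous V)
    (hp : Function.Periodic V (2 * π))
    (h : ∀ η : ℝ, 0 < η → ∃ A B : E3, (∀ θ, ‖spaceEllipse A B θ - circ θ‖ ≤ 1 / 2) ∧
      ∫ θ in (0 : ℝ)..(2 * π),
        ‖V θ - ‖spaceEllipse A B θ‖⁻¹ • spaceEllipse A B θ‖ ^ 2 ≤ η) :
    ∃ A B : E3, (∀ θ, spaceEllipse A B θ ≠ 0) ∧
      ∀ θ, V θ = ‖spaceEllipse A B θ‖⁻¹ • spaceEllipse A B θ := by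
  set K : Set (E3 × E3) := {x | ∀ θ, ‖spaceEllipse x.1 x.2 θ - circ θ‖ ≤ 1 / 2} with hK
  have hne : ∀ x ∈ K, ∀ θ, spaceEllipse x.1 x.2 θ ≠ 0 := fun x hx θ =>
    ne_zero_of_near (norm_circ θ) le_rfl (hx θ)
  have hKc : IsCompact K := isCompact_spaceEllipse_near_circ
  set F : E3 × E3 → ℝ := fun x => ∫ θ in (0 : ℝ)..(2 * π),
    ‖V θ - ‖spaceEllipse x.1 x.2 θ‖⁻¹ • spaceEllipse x.1 x.2 θ‖ ^ 2 with hF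
  have hFc : ContinuousOn F K := by
    rw [continuousOn_iff_continuous_domRestrict]
    refine intervalIntegral.continuous_parametric_intervalIntegral_of_continuous' (μ := volume)
      (f := fun (x : K) θ =>
        ‖V θ - ‖spaceEllipse x.1.1 x.1.2 θ‖⁻¹ • spaceEllipse x.1.1 x.1.2 θ‖ ^ 2) ?_ _ _
    have h1 : Continuous fun y : K × ℝ => spaceEllipse y.1.1.1 y.1.1.2 y.2 :=
      ((continuous_cos.comp continuous_snd).smul
        (continuous_fst.comp (continuous_subtype_val.comp continuous_fst))).add
      ((continuous_sin.comp continuous_snd).smul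
        (continuous_snd.comp (continuous_subtype_val.comp continuous_fst)))
    have h2 : Continuous fun y : K × ℝ => ‖spaceEllipse y.1.1.1 y.1.1.2 y.2‖⁻¹ :=
      h1.norm.inv₀ fun y => norm_ne_zero_iff.2 (hne y.1.1 y.1.2 y.2)
    exact (((hV.comp continuous_snd).sub (h2.smul h1)).norm.pow 2)
  have hF0 : ∀ x, 0 ≤ F x := fun x =>
    intervalIntegral.integral_nonneg two_pi_pos.le fun θ _ => sq_nonneg _
  obtain ⟨A₁, B₁, hAB₁, -⟩ := h 1 one_pos
  obtain ⟨x, hxK, hxmin⟩ := hKc.exists_isMinOn ⟨(A₁, B₁), hAB₁⟩ hFc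
  have hFx : F x = 0 := by
    refine le_antisymm (le_of_forall_pos_le_add fun η hη => ?_) (hF0 x)
    obtain ⟨A, B, hAB, hle⟩ := h η hη
    rw [zero_add]
    exact (hxmin (show (A, B) ∈ K from hAB)).trans hle
  refine ⟨x.1, x.2, hne x hxK, ?_⟩
  have hNc := continuous_normalize (continuous_spaceEllipse x.1 x.2) (hne x hxK)
  have hgc : Continuous fun θ =>
      ‖V θ - ‖spaceEllipse x.1 x.2 θ‖⁻¹ • spaceEllipse x.1 x.2 θ‖ ^ 2 := (hV.sub hNc).norm.pow 2
  have hzero : ∀ θ ∈ Icc 0 (2 * π),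
      ‖V θ - ‖spaceEllipse x.1 x.2 θ‖⁻¹ • spaceEllipse x.1 x.2 θ‖ ^ 2 = 0 := by
    by_contra! hcon
    obtain ⟨θ, hθ, hθ0⟩ := hcon
    have := intervalIntegral.integral_pos two_pi_pos hgc.continuousOn (fun _ _ => sq_nonneg _)
      ⟨θ, hθ, lt_of_le_of_ne (sq_nonneg _) (Ne.symm hθ0)⟩
    rw [hF] at hFx
    simp only at hFx
    linarith
  have hper : Function.Periodic (fun θ =>
      ‖V θ - ‖spaceEllipse x.1 x.2 θ‖⁻¹ • spaceEllipse x.1 x.2 θ‖ ^ 2) (2 * π) := fun θ => by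
    have : spaceEllipse x.1 x.2 (θ + 2 * π) = spaceEllipse x.1 x.2 θ := by simp [spaceEllipse]
    simp only [hp θ, this]
  intro θ
  obtain ⟨y, hy, e⟩ := hper.exists_mem_Ico₀ two_pi_pos θ
  rw [hzero y (Ico_subset_Icc_self hy)] at e
  exact sub_eq_zero.1 (norm_eq_zero.1 (pow_eq_zero_iff (two_ne_zero)|>.1 e))

/-- The local theorem for the tangent of a closed curve near the tangent of the planar loop: the
energy is nonnegative, and the infimum of the Rayleigh quotient can be `1` only if the tangent is
the normalization of an ellipse. -/
theorem local_minimality {β : ℝ} (hβ : 0 < β) (hβ1 : β ≤ 1) :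
    ∃ δ : ℝ, 0 < δ ∧ ∀ U U' : ℝ → E3, H1Pair U U' →
      (∀ s, ‖U s‖ = 1) → (∀ s, inner ℝ (U s) (U' s) = 0) →
      ∫ s in (0 : ℝ)..(2 * π), U s = 0 →
      (∀ s, ‖U s - ellipseTangent β s‖ ≤ δ) →
      ∫ s in (0 : ℝ)..(2 * π), ‖U' s - deriv (ellipseTangent β) s‖ ^ 2 ≤ δ ^ 2 →
      (∀ Φ Φ' : ℝ → ℝ, H1Pair Φ Φ' → ∫ s in (0 : ℝ)..(2 * π), ‖Φ s • U s‖ ^ 2 ≤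
        ∫ s in (0 : ℝ)..(2 * π), ‖Φ' s • U s + Φ s • U' s‖ ^ 2) ∧
      ((∀ η : ℝ, 0 < η → ∃ Φ Φ' : ℝ → ℝ, H1Pair Φ Φ' ∧ Φ ≠ 0 ∧
        (∫ s in (0 : ℝ)..(2 * π), ‖Φ' s • U s + Φ s • U' s‖ ^ 2)
          - (∫ s in (0 : ℝ)..(2 * π), ‖Φ s • U s‖ ^ 2)
            ≤ η * ∫ s in (0 : ℝ)..(2 * π), ‖Φ s • U s‖ ^ 2) →
        ∃ A B : E3, (∀ s, spaceEllipse A B s ≠ 0) ∧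
          ∀ s, U s = ‖spaceEllipse A B s‖⁻¹ • spaceEllipse A B s) := by
  obtain ⟨δ, hδ, c, hc, H⟩ := local_estimate_arclength hβ hβ1
  refine ⟨δ, hδ, fun U U' hU hU1 hUo hUm hUn hUd => ?_⟩
  have hq0 := eccParam_nonneg hβ hβ1
  have hq1 := eccParam_lt_one hβ
  have H' := H U U' hU hU1 hUo hUm hUn hUd
  have hnn : ∀ Φ : ℝ → ℝ, 0 ≤ ∫ s in (0 : ℝ)..(2 * π), ‖Φ s • U s‖ ^ 2 := fun Φ =>
    intervalIntegral.integral_nonneg two_pi_pos.le fun _ _ => sq_nonneg _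
  refine ⟨fun Φ Φ' hΦ => ?_, fun hinf => ?_⟩
  · by_contra! hlt
    have hΦ0 : Φ ≠ 0 := by
      rintro rfl
      have : 0 ≤ ∫ s in (0 : ℝ)..(2 * π), ‖Φ' s • U s + (0 : ℝ → ℝ) s • U' s‖ ^ 2 :=
        intervalIntegral.integral_nonneg two_pi_pos.le fun _ _ => sq_nonneg _
      simp at hlt this
      linarith
    obtain ⟨A, B, -, t, ht, hle, -⟩ := H' Φ Φ' hΦ hΦ0 (by
      have := mul_nonneg hδ.le (hnn Φ); linarith)
    have h1 : 0 ≤ c * ∫ θ in (0 : ℝ)..(2 * π),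
          ‖U (angleParam (eccParam β) θ) - ‖spaceEllipse A B θ‖⁻¹ • spaceEllipse A B θ‖ ^ 2 :=
      mul_nonneg hc.le
        (intervalIntegral.integral_nonneg two_pi_pos.le fun _ _ => sq_nonneg _)
    have h2 : 0 < t ^ 2 := by positivity
    nlinarith
  · obtain ⟨A, B, hAB, hUAB⟩ := exists_eq_normalized_spaceEllipse
      (hU.comp_angleParam hq0 hq1).continuous (hU.comp_angleParam hq0 hq1).periodic (by
      intro η hη
      set η' := min δ (c * η / (2 * π)) with hη'
      have hη'0 : 0 < η' := by positivity
      obtain ⟨Φ, Φ', hΦ, hΦ0, hle⟩ := hinf η' hη'0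
      obtain ⟨A, B, hAB, t, ht, h1, h2⟩ := H' Φ Φ' hΦ hΦ0
        (hle.trans (mul_le_mul_of_nonneg_right (min_le_left _ _) (hnn Φ)))
      refine ⟨A, B, hAB, ?_⟩
      have h3 := mul_le_mul_of_nonneg_left hle (sq_nonneg t)
      have h4 := mul_le_mul_of_nonneg_left h2 hη'0.le
      have h5 : η' * (2 * π) ≤ c * η := by
        rw [← le_div_iff₀ two_pi_pos]; exact min_le_right _ _
      refine le_of_mul_le_mul_left ?_ hc
      linarith)
    have key : ∀ θ, spaceEllipse A B θ
        = angleRadius β θ • spaceEllipse A (β • B) (angleParam (eccParam β) θ) := fun θ => by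
      rw [spaceEllipse, spaceEllipse, ← cos_angleParam hβ hβ1, ← sin_angleParam hβ hβ1 θ]
      module
    refine ⟨A, β • B, fun s => ?_, fun s => ?_⟩ <;>
    obtain ⟨θ, rfl⟩ := surjective_angleParam hq0 hq1 s
    · intro h0
      exact hAB θ (by rw [key, h0, smul_zero])
    · have hη := angleRadius_pos hβ θ
      rw [hUAB θ, key, norm_smul, norm_of_nonneg hη.le, mul_inv, smul_smul, mul_right_comm,
        inv_mul_cancel₀ hη.ne', one_mul]

/-! ### The normal form of an ellipse in space -/

theorem spaceEllipse_add (A B : E3) (s t : ℝ) :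
    spaceEllipse A B (s + t)
      = spaceEllipse (spaceEllipse A B s) (spaceEllipse A B (s + π / 2)) t := by
  simp only [spaceEllipse, cos_add, sin_add, cos_pi_div_two, sin_pi_div_two]
  module

theorem continuous_ellipseTangent {β : ℝ} (hβ : 0 < β) : Continuous (ellipseTangent β) :=
  (contDiff_ellipseTangent hβ).continuous

theorem ellipseTangent_add_pi (β s : ℝ) : ellipseTangent β (s + π) = -ellipseTangent β s := by
  rw [ellipseTangent, ellipseTangent, ellipse_eq_spaceEllipse, spaceEllipse_add_pi,
    ← ellipse_eq_spaceEllipse, norm_neg, smul_neg]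

/-- The principal axes of an ellipse: the point of maximal norm is orthogonal to its conjugate
point. -/
theorem exists_principal_axes (A B : E3) : ∃ s : ℝ,
    inner ℝ (spaceEllipse A B s) (spaceEllipse A B (s + π / 2)) = 0 ∧
      ‖spaceEllipse A B (s + π / 2)‖ ≤ ‖spaceEllipse A B s‖ := by
  have hper : Function.Periodic (spaceEllipse A B) (2 * π) := fun θ => by simp [spaceEllipse]
  obtain ⟨s, -, hs⟩ := isCompact_Icc.exists_isMaxOn (s := Icc 0 (2 * π))
    ⟨0, le_rfl, two_pi_pos.le⟩ (continuous_spaceEllipse A B).norm.continuousOn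
  have hmax : ∀ x, ‖spaceEllipse A B x‖ ≤ ‖spaceEllipse A B s‖ := fun x => by
    obtain ⟨y, hy, e⟩ := hper.exists_mem_Ico₀ two_pi_pos x
    rw [e]
    exact hs (Ico_subset_Icc_self hy)
  refine ⟨s, ?_, hmax _⟩
  set P := spaceEllipse A B s with hP
  set Q := spaceEllipse A B (s + π / 2) with hQ
  have hg : ∀ t, ‖spaceEllipse A B (s + t)‖ ^ 2
      = cos t ^ 2 * ‖P‖ ^ 2 + 2 * (cos t * sin t) * inner ℝ P Q + sin t ^ 2 * ‖Q‖ ^ 2 := fun t => by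
    rw [spaceEllipse_add, ← hP, ← hQ, spaceEllipse, norm_add_sq_real, norm_smul, norm_smul,
      real_inner_smul_left, real_inner_smul_right, mul_pow, mul_pow, Real.norm_eq_abs,
      Real.norm_eq_abs, sq_abs, sq_abs]
    ring
  have hd : HasDerivAt (fun t => cos t ^ 2 * ‖P‖ ^ 2 + 2 * (cos t * sin t) * inner ℝ P Q
      + sin t ^ 2 * ‖Q‖ ^ 2) (2 * inner ℝ P Q) 0 := by
    have hc := hasDerivAt_cos 0
    have hs := hasDerivAt_sin 0
    have := (((hc.pow 2).mul_const (‖P‖ ^ 2)).add (((hc.mul hs).const_mul 2).mul_const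
      (inner ℝ P Q))).add ((hs.pow 2).mul_const (‖Q‖ ^ 2))
    convert! this using 1
    simp
  have hloc : IsLocalMax (fun t => cos t ^ 2 * ‖P‖ ^ 2 + 2 * (cos t * sin t) * inner ℝ P Q
      + sin t ^ 2 * ‖Q‖ ^ 2) 0 := by
    refine Filter.Eventually.of_forall fun t => ?_
    simp only [← hg, add_zero]
    exact pow_le_pow_left₀ (norm_nonneg _) (hmax _) 2
  have := hloc.hasDerivAt_eq_zero hd
  linarith

/-- Two orthonormal vectors are the images, up to a common sign, of the first two basis vectors
under a rotation. -/
theorem exists_rotation {u v : E3} (hu : ‖u‖ = 1) (hv : ‖v‖ = 1) (huv : inner ℝ u v = 0) :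
    ∃ R : E3 ≃ₗᵢ[ℝ] E3, LinearMap.det (R.toLinearEquiv : E3 →ₗ[ℝ] E3) = 1 ∧
      ((R (EuclideanSpace.single 0 1) = u ∧ R (EuclideanSpace.single 1 1) = v) ∨
        (R (EuclideanSpace.single 0 1) = -u ∧ R (EuclideanSpace.single 1 1) = -v)) := by
  have hon : Orthonormal ℝ (({0, 1} : Set (Fin 3)).domRestrict ![u, v, 0]) := by
    constructor
    · rintro ⟨i, hi⟩
      rcases hi with rfl | rfl
      · simpa using hu
      · simpa using hv
    · rintro ⟨i, hi⟩ ⟨j, hj⟩ hij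
      rcases hi with rfl | rfl <;> rcases hj with rfl | rfl
      · exact absurd rfl hij
      · simpa using huv
      · simpa [real_inner_comm] using huv
      · exact absurd rfl hij
  obtain ⟨b, hb⟩ := hon.exists_orthonormalBasis_extension_of_card_eq (by simp)
  have hb0 : b 0 = u := by simpa using hb 0 (by simp)
  have hb1 : b 1 = v := by simpa using hb 1 (by simp)
  set R := b.repr.symm with hR
  have hRi : ∀ i, R (EuclideanSpace.single i 1) = b i := fun i => b.repr_symm_single i
  set e := EuclideanSpace.basisFun (Fin 3) ℝ with he
  have hdet : LinearMap.det (R.toLinearEquiv : E3 →ₗ[ℝ] E3) = e.toBasis.det b := by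
    have h1 := e.toBasis.det_comp (R.toLinearEquiv : E3 →ₗ[ℝ] E3) e
    have h2 : e.toBasis.det e = 1 := by
      have := e.toBasis.det_self
      simpa using this
    rw [h2, mul_one] at h1
    rw [← h1]
    congr 1
  rcases e.det_to_matrix_orthonormalBasis_real b with h | h
  · exact ⟨R, hdet.trans h, Or.inl ⟨by rw [hRi, hb0], by rw [hRi, hb1]⟩⟩
  · refine ⟨R.trans (LinearIsometryEquiv.neg ℝ), ?_, Or.inr ⟨?_, ?_⟩⟩
    · have : ((R.trans (LinearIsometryEquiv.neg ℝ)).toLinearEquiv : E3 →ₗ[ℝ] E3)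
          = (-1 : ℝ) • (R.toLinearEquiv : E3 →ₗ[ℝ] E3) := by
        ext x; simp
      rw [this, LinearMap.det_smul, hdet, h]
      simp
      norm_num
    · simp [hRi, hb0]
    · simp [hRi, hb1]

/-- The normal form of a nondegenerate ellipse in space. -/
theorem exists_normal_form {A B : E3} (h0 : ∀ s, spaceEllipse A B s ≠ 0) :
    ∃ β : ℝ, 0 < β ∧ β ≤ 1 ∧ ∃ R : E3 ≃ₗᵢ[ℝ] E3,
      LinearMap.det (R.toLinearEquiv : E3 →ₗ[ℝ] E3) = 1 ∧ ∃ θ : ℝ, ∀ s,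
        ‖spaceEllipse A B s‖⁻¹ • spaceEllipse A B s = R (ellipseTangent β (s + θ)) := by
  obtain ⟨s₀, horth, hle⟩ := exists_principal_axes A B
  set P := spaceEllipse A B s₀ with hP
  set Q := spaceEllipse A B (s₀ + π / 2) with hQ
  have hP0 : 0 < ‖P‖ := norm_pos_iff.2 (h0 _)
  have hQ0 : 0 < ‖Q‖ := norm_pos_iff.2 (h0 _)
  obtain ⟨R, hdet, hR⟩ := exists_rotation (u := ‖P‖⁻¹ • P) (v := ‖Q‖⁻¹ • Q)
    (by rw [norm_smul, norm_inv, norm_norm, inv_mul_cancel₀ hP0.ne'])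
    (by rw [norm_smul, norm_inv, norm_norm, inv_mul_cancel₀ hQ0.ne'])
    (by rw [real_inner_smul_left, real_inner_smul_right, horth]; simp)
  set β := ‖Q‖ / ‖P‖ with hβ
  have key : ∀ s, ‖spaceEllipse A B s‖⁻¹ • spaceEllipse A B s
      = ‖cos (s - s₀) • (‖P‖⁻¹ • P) + sin (s - s₀) • (β • (‖Q‖⁻¹ • Q))‖⁻¹ •
        (cos (s - s₀) • (‖P‖⁻¹ • P) + sin (s - s₀) • (β • (‖Q‖⁻¹ • Q))) := fun s => by
    have h1 : spaceEllipse A B s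
        = ‖P‖ • (cos (s - s₀) • (‖P‖⁻¹ • P) + sin (s - s₀) • (β • (‖Q‖⁻¹ • Q))) := by
      have h2 : ‖P‖ * (β * ‖Q‖⁻¹) = 1 := by rw [hβ]; field_simp
      have h3 : spaceEllipse A B s = spaceEllipse P Q (s - s₀) := by
        rw [hP, hQ, ← spaceEllipse_add]; congr 1; ring
      rw [h3, spaceEllipse, smul_add, smul_comm ‖P‖, smul_comm ‖P‖ (sin _), smul_smul ‖P‖,
        mul_inv_cancel₀ hP0.ne', one_smul, smul_smul β, smul_smul ‖P‖, h2, one_smul]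
    rw [h1, norm_smul, norm_norm, mul_inv, smul_smul, mul_right_comm, inv_mul_cancel₀ hP0.ne',
      one_mul]
  have hell : ∀ t, R (ellipse β t)
      = cos t • R (EuclideanSpace.single 0 1) + sin t • (β • R (EuclideanSpace.single 1 1)) :=
    fun t => by
    have h1 : (EuclideanSpace.single 1 β : E3) = β • EuclideanSpace.single 1 1 := by
      ext i; fin_cases i <;> simp
    rw [ellipse_eq_spaceEllipse, spaceEllipse, h1, map_add, map_smul, map_smul, map_smul]
  have hRt : ∀ t, R (ellipseTangent β t) = ‖R (ellipse β t)‖⁻¹ • R (ellipse β t) := fun t => by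
    rw [ellipseTangent, map_smul, R.norm_map]
  refine ⟨β, div_pos hQ0 hP0, (div_le_one hP0).2 hle, R, hdet, ?_⟩
  rcases hR with ⟨r1, r2⟩ | ⟨r1, r2⟩
  · refine ⟨-s₀, fun s => ?_⟩
    rw [key, hRt, hell, r1, r2, ← sub_eq_add_neg]
  · refine ⟨-s₀ + π, fun s => ?_⟩
    rw [← add_assoc, ellipseTangent_add_pi, map_neg, key, hRt, hell, r1, r2, ← sub_eq_add_neg]
    have e : cos (s - s₀) • -(‖P‖⁻¹ • P) + sin (s - s₀) • β • -(‖Q‖⁻¹ • Q)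
        = -(cos (s - s₀) • (‖P‖⁻¹ • P) + sin (s - s₀) • (β • (‖Q‖⁻¹ • Q))) := by module
    rw [e, norm_neg, smul_neg, neg_neg]

theorem hasDerivAt_planarLoop {β : ℝ} (hβ : 0 < β) (s : ℝ) :
    HasDerivAt (planarLoop β) (ellipseTangent β s) s :=
  ((continuous_ellipseTangent hβ).integral_hasStrictDerivAt 0 s).hasDerivAt

theorem hasDerivAt_family {β : ℝ} (hβ : 0 < β) (R : E3 ≃ₗᵢ[ℝ] E3) (a : E3) (θ s : ℝ) :
    HasDerivAt (fun s => a + R (planarLoop β (s + θ))) (R (ellipseTangent β (s + θ))) s := by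
  have h1 := (hasDerivAt_planarLoop hβ (s + θ)).comp_add_const s θ
  exact ((R.toContinuousLinearEquiv : E3 →L[ℝ] E3).hasFDerivAt.comp_hasDerivAt s h1).const_add a

/-- A curve whose tangent is the normalization of a nondegenerate ellipse belongs to the family. -/
theorem inFamily_of_tangent {γ : ℝ → E3} (hγ : Differentiable ℝ γ) {A B : E3}
    (h0 : ∀ s, spaceEllipse A B s ≠ 0)
    (hU : ∀ s, deriv γ s = ‖spaceEllipse A B s‖⁻¹ • spaceEllipse A B s) : InFamily γ := by
  obtain ⟨β, hβ, hβ1, R, hdet, θ, hR⟩ := exists_normal_form h0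
  refine ⟨β, hβ, hβ1, R, hdet, γ 0 - R (planarLoop β (0 + θ)), θ, fun s => ?_⟩
  have hd : ∀ s, HasDerivAt (fun s => γ s - (0 + R (planarLoop β (s + θ)))) 0 s := fun s => by
    have h1 := (hγ s).hasDerivAt
    rw [hU, hR] at h1
    have := h1.sub (hasDerivAt_family hβ R 0 θ s)
    rw [sub_self] at this
    exact this
  have := is_const_of_deriv_eq_zero (fun x => (hd x).differentiableAt) (fun x => (hd x).deriv) s 0
  simp only [zero_add] at this ⊢
  rw [← this]
  abel

/-! ### Rotations and shifts of the reference loop -/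

theorem integral_period_add_right {E : Type*} [NormedAddCommGroup E] [NormedSpace ℝ E] {g : ℝ → E}
    (hg : Function.Periodic g (2 * π)) (c : ℝ) :
    ∫ s in (0 : ℝ)..(2 * π), g (s + c) = ∫ s in (0 : ℝ)..(2 * π), g s := by
  rw [intervalIntegral.integral_comp_add_right, zero_add, add_comm (2 * π) c]
  simpa using hg.intervalIntegral_add_eq c 0

/-- Local minimality near a member of the family in general position: rotations and shifts of the
initial point preserve all the quantities involved. -/
theorem local_minimality_of_family {β : ℝ} (hβ : 0 < β) (hβ1 : β ≤ 1) (R : E3 ≃ₗᵢ[ℝ] E3) (θ : ℝ) :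
    ∃ δ : ℝ, 0 < δ ∧ ∀ U U' : ℝ → E3, H1Pair U U' →
      (∀ s, ‖U s‖ = 1) → (∀ s, inner ℝ (U s) (U' s) = 0) →
      ∫ s in (0 : ℝ)..(2 * π), U s = 0 →
      (∀ s, ‖U s - R (ellipseTangent β (s + θ))‖ ≤ δ) →
      ∫ s in (0 : ℝ)..(2 * π), ‖U' s - R (deriv (ellipseTangent β) (s + θ))‖ ^ 2 ≤ δ ^ 2 →
      (∀ Φ Φ' : ℝ → ℝ, H1Pair Φ Φ' → ∫ s in (0 : ℝ)..(2 * π), ‖Φ s • U s‖ ^ 2 ≤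
        ∫ s in (0 : ℝ)..(2 * π), ‖Φ' s • U s + Φ s • U' s‖ ^ 2) ∧
      ((∀ η : ℝ, 0 < η → ∃ Φ Φ' : ℝ → ℝ, H1Pair Φ Φ' ∧ Φ ≠ 0 ∧
        (∫ s in (0 : ℝ)..(2 * π), ‖Φ' s • U s + Φ s • U' s‖ ^ 2)
          - (∫ s in (0 : ℝ)..(2 * π), ‖Φ s • U s‖ ^ 2) ≤
            η * ∫ s in (0 : ℝ)..(2 * π), ‖Φ s • U s‖ ^ 2) →
        ∃ A B : E3, (∀ s, spaceEllipse A B s ≠ 0) ∧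
          ∀ s, U s = ‖spaceEllipse A B s‖⁻¹ • spaceEllipse A B s) := by
  obtain ⟨δ, hδ, H⟩ := local_minimality hβ hβ1
  refine ⟨δ, hδ, fun U U' hU hU1 hUo hUm hUn hUd => ?_⟩
  have hnum : ∀ Φ Φ' : ℝ → ℝ, H1Pair Φ Φ' →
      ∫ s in (0 : ℝ)..(2 * π), ‖Φ (s + -θ) • R.symm (U (s + -θ))‖ ^ 2
        = ∫ s in (0 : ℝ)..(2 * π), ‖Φ s • U s‖ ^ 2 := fun Φ Φ' hΦ => by
    rw [← integral_period_add_right (g := fun s => ‖Φ s • U s‖ ^ 2)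
      (fun s => by simp only [hΦ.periodic s, hU.periodic s]) (-θ)]
    simp only [norm_smul, LinearIsometryEquiv.norm_map]
  have hen : ∀ Φ Φ' : ℝ → ℝ, H1Pair Φ Φ' →
      ∫ s in (0 : ℝ)..(2 * π), ‖Φ' (s + -θ) • R.symm (U (s + -θ))
          + Φ (s + -θ) • R.symm (U' (s + -θ))‖ ^ 2
        = ∫ s in (0 : ℝ)..(2 * π), ‖Φ' s • U s + Φ s • U' s‖ ^ 2 := fun Φ Φ' hΦ => by
    rw [← integral_period_add_right (g := fun s => ‖Φ' s • U s + Φ s • U' s‖ ^ 2)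
      (fun s => by simp only [hΦ.periodic s, hU.periodic s, hΦ.periodic' s, hU.periodic' s]) (-θ)]
    simp only [← map_smul, ← map_add, LinearIsometryEquiv.norm_map]
  obtain ⟨h1, h2⟩ := H (fun s => R.symm (U (s + -θ))) (fun s => R.symm (U' (s + -θ)))
    ((hU.shift (-θ)).clm (R.symm.toContinuousLinearEquiv : E3 →L[ℝ] E3))
    (fun s => by rw [LinearIsometryEquiv.norm_map, hU1])
    (fun s => by rw [LinearIsometryEquiv.inner_map_map, hUo])
    (by
      have h := (R.symm.toContinuousLinearEquiv : E3 →L[ℝ] E3).intervalIntegral_comp_comm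
        (((hU.shift (-θ)).continuous).intervalIntegrable (μ := volume) 0 (2 * π))
      rw [integral_period_add_right hU.periodic, hUm, map_zero] at h
      exact h)
    (fun s => by
      have h := hUn (s + -θ)
      rwa [neg_add_cancel_right, ← R.symm.norm_map, map_sub, R.symm_apply_apply] at h)
    (by
      rw [← integral_period_add_right (fun s => by
        simp only [hU.periodic' s, add_right_comm s (2 * π) θ,
          (h1Pair_ellipseTangent hβ).periodic' (s + θ)]) (-θ)] at hUd
      refine le_of_eq_of_le ?_ hUd
      congr 1
      funext s
      rw [neg_add_cancel_right, ← R.symm.norm_map (U' (s + -θ) - _), map_sub, R.symm_apply_apply])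
  refine ⟨fun Φ Φ' hΦ => ?_, fun h => ?_⟩
  · rw [← hnum Φ Φ' hΦ, ← hen Φ Φ' hΦ]
    exact h1 _ _ (hΦ.shift (-θ))
  · obtain ⟨A, B, h0, hAB⟩ := h2 fun η hη => by
      obtain ⟨Φ, Φ', hΦ, hΦ0, hle⟩ := h η hη
      refine ⟨_, _, hΦ.shift (-θ), ?_, ?_⟩
      · obtain ⟨s, hs⟩ := Function.ne_iff.1 hΦ0
        refine Function.ne_iff.2 ⟨s + θ, ?_⟩
        simpa using hs
      · rw [hnum Φ Φ' hΦ, hen Φ Φ' hΦ]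
        exact hle
    have hR : ∀ s, spaceEllipse (R (spaceEllipse A B θ)) (R (spaceEllipse A B (θ + π / 2))) s
        = R (spaceEllipse A B (s + θ)) := fun s => by
      rw [add_comm s θ, spaceEllipse_add A B θ s]
      simp only [spaceEllipse, map_add, map_smul]
    refine ⟨R (spaceEllipse A B θ), R (spaceEllipse A B (θ + π / 2)), fun s => ?_, fun s => ?_⟩
    · rw [hR]
      exact fun e => h0 (s + θ) (by simpa using e)
    · have h := congrArg R (hAB (s + θ))
      simp only [add_neg_cancel_right, R.apply_symm_apply, map_smul] at h
      rw [hR, R.norm_map, h]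

/-! ### Convergence of the tangents -/

/-- The supremum of an `H¹` function is controlled by its `H¹` norm. -/
theorem H1Pair.norm_sq_le {V : Type*} [NormedAddCommGroup V] [NormedSpace ℝ V] {f f' : ℝ → V}
    (h : H1Pair f f') (x : ℝ) :
    ‖f x‖ ^ 2 ≤ (∫ t in (0 : ℝ)..(2 * π), ‖f t‖ ^ 2)
      + 4 * π * ∫ t in (0 : ℝ)..(2 * π), ‖f' t‖ ^ 2 := by
  set K := ∫ t in (0 : ℝ)..(2 * π), ‖f' t‖ ^ 2 with hK
  have h1 : ∀ y, ‖f x‖ ^ 2 - 4 * π * K ≤ 2 * ‖f y‖ ^ 2 := fun y => by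
    have h2 := h.norm_sub_sq_le x y
    have h3 : ‖f x‖ ≤ ‖f x - f y‖ + ‖f y‖ := by
      simpa using norm_add_le (f x - f y) (f y)
    nlinarith [sq_nonneg (‖f x - f y‖ - ‖f y‖), norm_nonneg (f x)]
  have h2 : ∫ y in (0 : ℝ)..(2 * π), (‖f x‖ ^ 2 - 4 * π * K)
      ≤ ∫ y in (0 : ℝ)..(2 * π), 2 * ‖f y‖ ^ 2 :=
    intervalIntegral.integral_mono two_pi_pos.le (by simp)
      ((continuous_const.mul (h.continuous.norm.pow 2)).intervalIntegrable _ _) h1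
  rw [intervalIntegral.integral_const, intervalIntegral.integral_const_mul, sub_zero,
    smul_eq_mul] at h2
  have h3 : 0 ≤ ∫ t in (0 : ℝ)..(2 * π), ‖f t‖ ^ 2 :=
    intervalIntegral.integral_nonneg two_pi_pos.le fun _ _ => by positivity
  have h4 : π * (‖f x‖ ^ 2 - 4 * π * K) ≤ ∫ t in (0 : ℝ)..(2 * π), ‖f t‖ ^ 2 := by linarith
  by_contra! hlt
  have h5 : ∫ t in (0 : ℝ)..(2 * π), ‖f t‖ ^ 2 < ‖f x‖ ^ 2 - 4 * π * K := by linarith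
  nlinarith [pi_gt_three]

theorem h1Norm_sq {V : Type*} [NormedAddCommGroup V] [NormedSpace ℝ V] [CompleteSpace V]
    {f f' : ℝ → V} (h : H1Pair f f') :
    h1Norm f ^ 2 = (∫ s in (0 : ℝ)..(2 * π), ‖f s‖ ^ 2) + ∫ s in (0 : ℝ)..(2 * π), ‖f' s‖ ^ 2 := by
  have hi : IntervalIntegrable (fun s => ‖f s‖ ^ 2) volume 0 (2 * π) :=
    (h.continuous.norm.pow 2).intervalIntegrable _ _
  rw [h1Norm, Real.sq_sqrt (intervalIntegral.integral_nonneg two_pi_pos.le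
    fun _ _ => by positivity), ← intervalIntegral.integral_add hi (h.sq_intervalIntegrable _ _)]
  refine intervalIntegral.integral_congr_ae ?_
  filter_upwards [h.ae_hasDerivAt] with x hx _
  rw [hx.deriv]

theorem integral_norm_sq_add_le {V : Type*} [NormedAddCommGroup V] [NormedSpace ℝ V]
    {r u v : ℝ → V} (hr : IntervalIntegrable (fun s => ‖r s‖ ^ 2) volume 0 (2 * π))
    (hu : IntervalIntegrable (fun s => ‖u s‖ ^ 2) volume 0 (2 * π))
    (hv : IntervalIntegrable (fun s => ‖v s‖ ^ 2) volume 0 (2 * π))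
    (hi : IntervalIntegrable (fun s => ‖r s + u s + v s‖ ^ 2) volume 0 (2 * π)) :
    ∫ s in (0 : ℝ)..(2 * π), ‖r s + u s + v s‖ ^ 2 ≤
      3 * ((∫ s in (0 : ℝ)..(2 * π), ‖r s‖ ^ 2) + (∫ s in (0 : ℝ)..(2 * π), ‖u s‖ ^ 2)
        + ∫ s in (0 : ℝ)..(2 * π), ‖v s‖ ^ 2) := by
  rw [← intervalIntegral.integral_add hr hu, ← intervalIntegral.integral_add (hr.add hu) hv,
    ← intervalIntegral.integral_const_mul]
  refine intervalIntegral.integral_mono two_pi_pos.le hi (((hr.add hu).add hv).const_mul 3)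
    fun s => ?_
  have h : ‖r s + u s + v s‖ ≤ ‖r s‖ + ‖u s‖ + ‖v s‖ := norm_add₃_le
  have h0 := norm_nonneg (r s + u s + v s)
  nlinarith [sq_nonneg (‖r s‖ - ‖u s‖), sq_nonneg (‖u s‖ - ‖v s‖), sq_nonneg (‖r s‖ - ‖v s‖)]

/-- If `U μ` has an expansion `T + μ u₁ + μ² u₂ + o(1)` in `H¹`, then `U μ` is eventually as close
to `T` in `H¹` as desired. -/
theorem eventually_close {T T' u u' v v' : ℝ → E3} (hT : H1Pair T T') (hu : H1Pair u u')
    (hv : H1Pair v v') {U : ℝ → ℝ → E3} (hU : ∀ᶠ μ in 𝓝 (0 : ℝ), IsH1 (U μ))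
    (hexp : Tendsto (fun μ : ℝ => h1Norm (fun s : ℝ => U μ s - (T s + μ • u s + μ ^ 2 • v s)))
      (𝓝 0) (𝓝 0)) {δ : ℝ} (hδ : 0 < δ) :
    ∀ᶠ μ in 𝓝 (0 : ℝ), (∀ s, ‖U μ s - T s‖ ≤ δ) ∧
      ∫ s in (0 : ℝ)..(2 * π), ‖deriv (U μ) s - T' s‖ ^ 2 ≤ δ ^ 2 := by
  set X : ℝ → ℝ := fun μ =>
    3 * (h1Norm (fun s : ℝ => U μ s - (T s + μ • u s + μ ^ 2 • v s)) ^ 2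
      + μ ^ 2 * h1Norm u ^ 2 + (μ ^ 2) ^ 2 * h1Norm v ^ 2) with hX
  have hX0 : Tendsto X (𝓝 0) (𝓝 0) := by
    have hμ : Tendsto (fun μ : ℝ => μ) (𝓝 0) (𝓝 0) := tendsto_id
    have := (((hexp.pow 2).add ((hμ.pow 2).mul_const (h1Norm u ^ 2))).add
      (((hμ.pow 2).pow 2).mul_const (h1Norm v ^ 2))).const_mul 3
    simpa using this
  have hlt : ∀ᶠ μ in 𝓝 (0 : ℝ), X μ < δ ^ 2 / (4 * π) :=
    hX0.eventually_lt_const (by positivity)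
  filter_upwards [hlt, hU] with μ h1 h2
  have hUμ := h2.h1Pair
  have hr := hUμ.sub ((hT.add (hu.const_smul μ)).add (hv.const_smul (μ ^ 2)))
  have hD := hUμ.sub hT
  have e0 : h1Norm (fun s : ℝ => U μ s - (T s + μ • u s + μ ^ 2 • v s)) ^ 2 = _ := h1Norm_sq hr
  have e1 := h1Norm_sq hu
  have e2 := h1Norm_sq hv
  have key : (∫ s in (0 : ℝ)..(2 * π), ‖U μ s - T s‖ ^ 2)
      + (∫ s in (0 : ℝ)..(2 * π), ‖deriv (U μ) s - T' s‖ ^ 2) ≤ X μ := by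
    have a1 := integral_norm_sq_add_le
      ((hr.continuous.norm.pow 2).intervalIntegrable 0 (2 * π))
      (((hu.const_smul μ).continuous.norm.pow 2).intervalIntegrable 0 (2 * π))
      (((hv.const_smul (μ ^ 2)).continuous.norm.pow 2).intervalIntegrable 0 (2 * π))
      ((((hr.continuous.add (hu.const_smul μ).continuous).add
        (hv.const_smul (μ ^ 2)).continuous).norm.pow 2).intervalIntegrable 0 (2 * π))
    have a2 := integral_norm_sq_add_le (hr.sq_intervalIntegrable 0 (2 * π))
      ((hu.const_smul μ).sq_intervalIntegrable 0 (2 * π))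
      ((hv.const_smul (μ ^ 2)).sq_intervalIntegrable 0 (2 * π))
      (((hr.add (hu.const_smul μ)).add (hv.const_smul (μ ^ 2))).sq_intervalIntegrable 0 (2 * π))
    have s1 : ∀ s, U μ s - (T s + μ • u s + μ ^ 2 • v s) + μ • u s + μ ^ 2 • v s = U μ s - T s :=
      fun s => by abel
    have s2 : ∀ s, deriv (U μ) s - (T' s + μ • u' s + μ ^ 2 • v' s) + μ • u' s + μ ^ 2 • v' s
      = deriv (U μ) s - T' s := fun s => by abel
    have s3 : ∀ (c : ℝ) (x : E3), ‖c • x‖ ^ 2 = c ^ 2 * ‖x‖ ^ 2 := fun c x => by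
      rw [norm_smul, mul_pow, Real.norm_eq_abs, sq_abs]
    simp only [s1, s2, s3, intervalIntegral.integral_const_mul] at a1 a2
    simp only [hX]
    rw [e0, e1, e2]
    linarith
  have n1 : 0 ≤ ∫ s in (0 : ℝ)..(2 * π), ‖U μ s - T s‖ ^ 2 :=
    intervalIntegral.integral_nonneg two_pi_pos.le fun _ _ => by positivity
  have n2 : 0 ≤ ∫ s in (0 : ℝ)..(2 * π), ‖deriv (U μ) s - T' s‖ ^ 2 :=
    intervalIntegral.integral_nonneg two_pi_pos.le fun _ _ => by positivity
  rw [lt_div_iff₀ (by positivity)] at h1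
  have hpi := pi_gt_three
  constructor
  · intro s
    have h3 := hD.norm_sq_le s
    refine abs_le_of_sq_le_sq' ?_ hδ.le |>.2
    nlinarith
  · nlinarith

/-! ### The lowest eigenvalue -/

theorem inner_deriv_eq_zero {U : ℝ → E3} (hU : ∀ s, ‖U s‖ = 1) (s : ℝ) :
    inner ℝ (U s) (deriv U s) = 0 := by
  by_cases h : DifferentiableAt ℝ U s
  · have h1 := h.hasDerivAt.norm_sq
    have h2 : (fun s => ‖U s‖ ^ 2) = fun _ => (1 : ℝ) := funext fun s => by rw [hU, one_pow]
    rw [h2] at h1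
    have := h1.unique (hasDerivAt_const s 1)
    linarith
  · rw [deriv_zero_of_not_differentiableAt h, inner_zero_right]

theorem rayleigh_eq {γ : ℝ → E3} (hγ : ∀ s, ‖tangent γ s‖ = 1) (Φ : ℝ → ℝ) :
    rayleigh γ Φ = (∫ s in (0 : ℝ)..(2 * π), ‖deriv Φ s • tangent γ s
      + Φ s • deriv (tangent γ) s‖ ^ 2) / ∫ s in (0 : ℝ)..(2 * π), ‖Φ s • tangent γ s‖ ^ 2 := by
  rw [rayleigh]
  congr 2
  · funext s
    rw [norm_sq_product_deriv (hγ s) (inner_deriv_eq_zero hγ s), curvature]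
    ring
  · funext s
    rw [norm_smul, hγ, mul_one, Real.norm_eq_abs, sq_abs]

theorem IsH1.integral_sq_pos {Φ : ℝ → ℝ} (h : IsH1 Φ) (h0 : Φ ≠ 0) :
    0 < ∫ s in (0 : ℝ)..(2 * π), Φ s ^ 2 := by
  obtain ⟨s, hs⟩ := Function.ne_iff.1 h0
  obtain ⟨y, hy, e⟩ := h.periodic.exists_mem_Ico₀ two_pi_pos s
  refine intervalIntegral.integral_pos two_pi_pos (h.h1Pair.continuous.pow 2).continuousOn
    (fun _ _ => sq_nonneg _) ⟨y, Ico_subset_Icc_self hy, ?_⟩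
  rw [← e]
  exact sq_pos_of_ne_zero hs

theorem isH1_of_contDiff {f : ℝ → ℝ} (hp : Function.Periodic f (2 * π)) (hf : ContDiff ℝ 1 f) :
    IsH1 f := by
  have h := H1Pair.of_hasDerivAt hp
    (fun s => (hf.differentiable (by norm_num) s).hasDerivAt) (hf.continuous_deriv (by norm_num))
  exact ⟨h.periodic, h.memLp, h.integral⟩

theorem one_le_e0 {γ : ℝ → E3} (hγ : ∀ s, ‖tangent γ s‖ = 1)
    (h : ∀ Φ Φ' : ℝ → ℝ, H1Pair Φ Φ' → ∫ s in (0 : ℝ)..(2 * π), ‖Φ s • tangent γ s‖ ^ 2 ≤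
        ∫ s in (0 : ℝ)..(2 * π), ‖Φ' s • tangent γ s + Φ s • deriv (tangent γ) s‖ ^ 2) :
    1 ≤ e0 γ := by
  refine le_csInf ⟨_, fun _ => 1, isH1_of_contDiff (fun _ => rfl) contDiff_const,
    fun e => one_ne_zero (congrFun e 0), rfl⟩ ?_
  rintro r ⟨Φ, hΦ, hΦ0, rfl⟩
  have hpos : 0 < ∫ s in (0 : ℝ)..(2 * π), ‖Φ s • tangent γ s‖ ^ 2 := by
    simpa only [norm_smul, hγ, mul_one, Real.norm_eq_abs, sq_abs] using hΦ.integral_sq_pos hΦ0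
  rw [rayleigh_eq hγ, le_div_iff₀ hpos, one_mul]
  exact h Φ _ hΦ.h1Pair

theorem exists_of_e0_le_one {γ : ℝ → E3} (hγ : ∀ s, ‖tangent γ s‖ = 1) (h : e0 γ ≤ 1) {η : ℝ}
    (hη : 0 < η) : ∃ Φ Φ' : ℝ → ℝ, H1Pair Φ Φ' ∧ Φ ≠ 0 ∧
        (∫ s in (0 : ℝ)..(2 * π), ‖Φ' s • tangent γ s + Φ s • deriv (tangent γ) s‖ ^ 2)
          - (∫ s in (0 : ℝ)..(2 * π), ‖Φ s • tangent γ s‖ ^ 2) ≤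
            η * ∫ s in (0 : ℝ)..(2 * π), ‖Φ s • tangent γ s‖ ^ 2 := by
  have hne : {r : ℝ | ∃ Φ : ℝ → ℝ, IsH1 Φ ∧ Φ ≠ 0 ∧ r = rayleigh γ Φ}.Nonempty :=
    ⟨_, fun _ => 1, isH1_of_contDiff (fun _ => rfl) contDiff_const,
      fun e => one_ne_zero (congrFun e 0), rfl⟩
  obtain ⟨r, ⟨Φ, hΦ, hΦ0, rfl⟩, hr⟩ :=
    exists_lt_of_csInf_lt hne (lt_of_le_of_lt h (lt_add_of_pos_right 1 hη))
  have hpos : 0 < ∫ s in (0 : ℝ)..(2 * π), ‖Φ s • tangent γ s‖ ^ 2 := by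
    simpa only [norm_smul, hγ, mul_one, Real.norm_eq_abs, sq_abs] using hΦ.integral_sq_pos hΦ0
  rw [rayleigh_eq hγ, div_lt_iff₀ hpos] at hr
  exact ⟨Φ, _, hΦ.h1Pair, hΦ0, by linarith⟩

theorem e0_le_rayleigh (γ : ℝ → E3) {Φ : ℝ → ℝ} (hΦ : IsH1 Φ) (hΦ0 : Φ ≠ 0) :
    e0 γ ≤ rayleigh γ Φ := by
  refine csInf_le ⟨0, ?_⟩ ⟨Φ, hΦ, hΦ0, rfl⟩
  rintro r ⟨Ψ, -, -, rfl⟩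
  exact div_nonneg (intervalIntegral.integral_nonneg two_pi_pos.le fun _ _ => by positivity)
    (intervalIntegral.integral_nonneg two_pi_pos.le fun _ _ => by positivity)

theorem IsLoop.integral_tangent {γ : ℝ → E3} (hγ : IsLoop γ) (hc : Continuous (tangent γ)) :
    ∫ s in (0 : ℝ)..(2 * π), tangent γ s = 0 := by
  rw [intervalIntegral.integral_eq_sub_of_hasDerivAt (f := γ) (f' := tangent γ)
    (fun s _ => (hγ.differentiable s).hasDerivAt) (hc.intervalIntegrable _ _), sub_eq_zero]
  simpa using hγ.periodic 0

/-- The unit tangents of the family have Rayleigh quotient `1` at `Φ(s) = |p(s)|`, where `p` is the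
ellipse: then `Φ U = p`, and `∫ |p'|² = ∫ |p|²`. -/
theorem rayleigh_norm_ellipse {β : ℝ} (hβ : 0 < β) {γ : ℝ → E3} (R : E3 ≃ₗᵢ[ℝ] E3) (θ : ℝ)
    (hγ : tangent γ = fun s => R (ellipseTangent β (s + θ))) :
    IsH1 (fun s => ‖ellipse β (s + θ)‖) ∧ (fun s => ‖ellipse β (s + θ)‖) ≠ 0 ∧
      rayleigh γ (fun s => ‖ellipse β (s + θ)‖) = 1 := by
  have hu : ∀ s, ‖tangent γ s‖ = 1 := fun s => by
    rw [hγ, R.norm_map, norm_ellipseTangent hβ]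
  have hcd : ContDiff ℝ 1 fun s => ‖ellipse β (s + θ)‖ :=
    (contDiff_norm_ellipse hβ).comp (contDiff_id.add contDiff_const)
  have hH : IsH1 (fun s => ‖ellipse β (s + θ)‖) :=
    isH1_of_contDiff (fun s => by
      simp only [add_right_comm s (2 * π) θ, ellipse_periodic β (s + θ)]) hcd
  have hne : (fun s => ‖ellipse β (s + θ)‖) ≠ 0 := fun e =>
    ellipse_ne_zero hβ (0 + θ) (norm_eq_zero.1 (congrFun e 0))
  refine ⟨hH, hne, ?_⟩
  have hpos : 0 < ∫ s in (0 : ℝ)..(2 * π), ‖‖ellipse β (s + θ)‖ • tangent γ s‖ ^ 2 := by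
    simpa only [norm_smul, hu, mul_one, Real.norm_eq_abs, sq_abs] using hH.integral_sq_pos hne
  have hp : ∀ s, ‖ellipse β (s + θ)‖ • tangent γ s
      = R (spaceEllipse (EuclideanSpace.single 0 1) (EuclideanSpace.single 1 β) (s + θ)) :=
    fun s => by
    rw [hγ, ← ellipse_eq_spaceEllipse, ← map_smul, ellipseTangent, smul_smul,
      mul_inv_cancel₀ (norm_ne_zero_iff.2 (ellipse_ne_zero hβ _)), one_smul]
  have hT : Differentiable ℝ (tangent γ) := by
    rw [hγ]
    exact (R.toContinuousLinearEquiv : E3 →L[ℝ] E3).differentiable.comp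
      (((contDiff_ellipseTangent hβ).differentiable (by norm_num)).comp
        (differentiable_id.add_const θ))
  have hd : ∀ s, deriv (fun s => ‖ellipse β (s + θ)‖) s • tangent γ s
      + ‖ellipse β (s + θ)‖ • deriv (tangent γ) s
      = R ((-sin (s + θ)) • EuclideanSpace.single 0 1
        + cos (s + θ) • EuclideanSpace.single 1 β) := fun s => by
    have h1 := (hcd.differentiable (by norm_num) s).hasDerivAt.smul (hT s).hasDerivAt
    have h2 : HasDerivAt (spaceEllipse (EuclideanSpace.single 0 1) (EuclideanSpace.single 1 β))
        ((-sin (s + θ)) • EuclideanSpace.single 0 1 + cos (s + θ) • EuclideanSpace.single 1 β)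
        (s + θ) :=
      ((hasDerivAt_cos _).smul_const _).add ((hasDerivAt_sin _).smul_const _)
    have h3 := (R.toContinuousLinearEquiv : E3 →L[ℝ] E3).hasFDerivAt.comp_hasDerivAt s
      (h2.comp_add_const s θ)
    have h4 : (fun s => ‖ellipse β (s + θ)‖) • tangent γ = fun s =>
        R (spaceEllipse (EuclideanSpace.single 0 1) (EuclideanSpace.single 1 β) (s + θ)) :=
      funext hp
    have h5 : HasDerivAt ((fun s => ‖ellipse β (s + θ)‖) • tangent γ) _ s := h1
    rw [h4] at h5
    rw [add_comm]
    exact h5.unique h3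
  rw [rayleigh_eq hu, div_eq_one_iff_eq hpos.ne', ← sub_eq_zero]
  have n1 : ∀ s, ‖deriv (fun s => ‖ellipse β (s + θ)‖) s • tangent γ s
      + ‖ellipse β (s + θ)‖ • deriv (tangent γ) s‖ ^ 2
      = sin (s + θ) ^ 2 + β ^ 2 * cos (s + θ) ^ 2 := fun s => by
    rw [hd, R.norm_map, EuclideanSpace.real_norm_sq_eq, Fin.sum_univ_three]
    simp
    ring
  have n2 : ∀ s, ‖‖ellipse β (s + θ)‖ • tangent γ s‖ ^ 2
      = cos (s + θ) ^ 2 + β ^ 2 * sin (s + θ) ^ 2 := fun s => by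
    rw [hp, R.norm_map, spaceEllipse, EuclideanSpace.real_norm_sq_eq, Fin.sum_univ_three]
    simp
    ring
  simp only [n1, n2]
  rw [integral_period_add_right (g := fun s => sin s ^ 2 + β ^ 2 * cos s ^ 2)
      (fun s => by simp) θ,
    integral_period_add_right (g := fun s => cos s ^ 2 + β ^ 2 * sin s ^ 2)
      (fun s => by simp) θ,
    intervalIntegral.integral_add (Continuous.intervalIntegrable (by fun_prop) _ _)
      (Continuous.intervalIntegrable (by fun_prop) _ _),
    intervalIntegral.integral_add (Continuous.intervalIntegrable (by fun_prop) _ _)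
      (Continuous.intervalIntegrable (by fun_prop) _ _),
    intervalIntegral.integral_const_mul, intervalIntegral.integral_const_mul,
    integral_sin_sq, integral_cos_sq]
  simp

end CurvatureLoop

open CurvatureLoop in
theorem theorem1p1
    (γ₀ : ℝ → CurvatureLoop.E3) (hγ₀ : CurvatureLoop.InFamily γ₀)
    (γ : ℝ → ℝ → CurvatureLoop.E3)
    (hloop : ∀ᶠ μ in 𝓝 (0 : ℝ), CurvatureLoop.IsLoop (γ μ))
    (hH1 : ∀ᶠ μ in 𝓝 (0 : ℝ), CurvatureLoop.IsH1 (CurvatureLoop.tangent (γ μ)))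
    (u₁ u₂ : ℝ → CurvatureLoop.E3)
    (hu₁ : CurvatureLoop.IsH1 u₁) (hu₂ : CurvatureLoop.IsH1 u₂)
    (hexp : (fun μ : ℝ => CurvatureLoop.h1Norm (fun s : ℝ =>
        CurvatureLoop.tangent (γ μ) s -
          (CurvatureLoop.tangent γ₀ s + μ • u₁ s + μ ^ 2 • u₂ s)))
      =o[𝓝 (0 : ℝ)] (fun μ : ℝ => μ ^ 2)) :
    CurvatureLoop.e0 γ₀ = 1 ∧
    ∃ c : ℝ, 0 < c ∧ ∀ μ : ℝ, |μ| < c →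
      CurvatureLoop.e0 γ₀ ≤ CurvatureLoop.e0 (γ μ) ∧
      (¬ CurvatureLoop.InFamily (γ μ) →
        CurvatureLoop.e0 γ₀ < CurvatureLoop.e0 (γ μ)) := by
  obtain ⟨β, hβ, hβ1, R, -, a, θ, hγ⟩ := hγ₀
  have hT : tangent γ₀ = fun s => R (ellipseTangent β (s + θ)) := by
    funext s
    rw [tangent, show γ₀ = fun s => a + R (planarLoop β (s + θ)) from funext hγ]
    exact (hasDerivAt_family hβ R a θ s).deriv
  have hpair : H1Pair (tangent γ₀) (fun s => R (deriv (ellipseTangent β) (s + θ))) := by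
    rw [hT]
    exact ((h1Pair_ellipseTangent hβ).shift θ).clm (R.toContinuousLinearEquiv : E3 →L[ℝ] E3)
  have hu : ∀ s, ‖tangent γ₀ s‖ = 1 := fun s => by
    rw [hT, R.norm_map, norm_ellipseTangent hβ]
  obtain ⟨δ, hδ, H⟩ := local_minimality_of_family hβ hβ1 R θ
  have hder : deriv (tangent γ₀) = fun s => R (deriv (ellipseTangent β) (s + θ)) := by
    rw [hT]
    funext s
    exact ((R.toContinuousLinearEquiv : E3 →L[ℝ] E3).hasFDerivAt.comp_hasDerivAt s
      (((contDiff_ellipseTangent hβ).differentiable (by norm_num)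
        (s + θ)).hasDerivAt.comp_add_const s θ)).deriv
  have h0 : e0 γ₀ = 1 := by
    refine le_antisymm ?_ ?_
    · obtain ⟨hH, hne, h⟩ := rayleigh_norm_ellipse hβ R θ hT
      rw [← h]
      exact e0_le_rayleigh γ₀ hH hne
    · refine one_le_e0 hu (H _ _ (by rw [hder]; exact hpair) hu (inner_deriv_eq_zero hu) ?_ ?_ ?_).1
      · refine integral_eq_zero_of_antiperiodic hpair.continuous fun s => ?_
        simp only [hT]
        rw [add_right_comm, ellipseTangent_add_pi, map_neg]
      · simp [hT, hδ.le]
      · simp [hder, sq_nonneg]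
  refine ⟨h0, ?_⟩
  rw [h0]
  have hlim : Tendsto (fun μ : ℝ => h1Norm (fun s : ℝ =>
      tangent (γ μ) s - (tangent γ₀ s + μ • u₁ s + μ ^ 2 • u₂ s))) (𝓝 0) (𝓝 0) := by
    refine hexp.isBigO.trans_tendsto ?_
    have : Tendsto (fun μ : ℝ => μ ^ 2) (𝓝 0) (𝓝 (0 ^ 2)) := tendsto_id.pow 2
    simpa using this
  obtain ⟨c, hc, hall⟩ := Metric.eventually_nhds_iff.1
    (hloop.and (hH1.and (eventually_close hpair hu₁.h1Pair hu₂.h1Pair hH1 hlim hδ)))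
  refine ⟨c, hc, fun μ hμ => ?_⟩
  obtain ⟨hl, hU, hclose, hclose'⟩ := hall (by simpa using hμ)
  obtain ⟨hmin, hrigid⟩ := H _ _ hU.h1Pair hl.unit_speed (inner_deriv_eq_zero hl.unit_speed)
    (hl.integral_tangent hU.h1Pair.continuous) (by simpa only [hT] using hclose) hclose'
  refine ⟨one_le_e0 hl.unit_speed hmin, fun hnot => ?_⟩
  by_contra! hle
  obtain ⟨A, B, hne, hAB⟩ := hrigid fun η hη => exists_of_e0_le_one hl.unit_speed hle hη
  exact hnot (inFamily_of_tangent hl.differentiable hne hAB)
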